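/- Let $p>0$ and $\nu\in\mathbb C$, and for $x\ne 0$, $|\arg x|<\pi/2$, let $$F_{p,\nu}(x)=\int_0^\infty t^{\nu-1}e^{-t^p-x/t}\,dt$$ (Krätzel's integral), which converges absolutely. Put $$\psi(\tau)=\frac{\tau^p}{p}+\frac1\tau,\qquad X=p^{1/(p+1)}x^{p/(p+1)},\qquad \kappa=\frac{p+1}{p},\qquad h=p^{1/p},\qquad \vartheta=\frac{\nu}{p}-\frac12,$$ $$A_0=(2\pi)^{-1/2}\kappa^{1/2-\vartheta}p^{-\vartheta},\qquad (\tfrac12)_k=\tfrac12\cdot\tfrac32\cdots(k-\tfrac12).$$ There is a function $\tau(w)$, analytic near $w=0$, with $\tau(0)=1$, $\tau'(0)=(p+1)^{-1/2}$ and $\tfrac12w^2=\psi(\tau(w))-\psi(1)$ (obtained by Lagrange inversion at the saddle $\tau=1$). Define $B_k$ by letting $(p+1)^{-1/2}B_k$ be the coefficient of $w^{2k}$ in the Taylor expansion of $\tau(w)^{\nu-1}\tau'(w)$ at $w=0$. There are also coefficients $c_j$ such that, for every $M\ge 0$, $$\Gamma(s)\,\Gamma\Bigl(\frac{s+\nu}{p}\Bigr)=2\pi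 A_0(h\kappa^\kappa)^{-s}\Bigl\{\sum_{j=0}^{M-1}(-1)^jc_j\,\Gamma(\kappa s+\vartheta-j)+O(1)\,\Gamma(\kappa s+\vartheta-M)\Bigr\}$$ as $|s|\to\infty$, uniformly in $|\arg s|\le\pi-\delta$ for each $\delta>0$. Then the following hold. 1. For every $M\ge 0$, as $|x|\to\infty$, uniformly in the sector $|\arg x|<\pi/2$, $$F_{p,\nu}(x)=\sqrt{\frac{2\pi}{(p+1)X}}\;\Bigl(\frac xp\Bigr)^{\nu/(p+1)}e^{-(p+1)(x/p)^{p/(p+1)}}\Bigl\{\sum_{k=0}^{M-1}\Bigl(\frac12\Bigr)_kB_k\Bigl(\frac X2\Bigr)^{-k}+O(X^{-M})\Bigr\}.$$ 2. The function $$\Bigl(\frac xp\Bigr)^{\nu/(p+1)}\int_0^\infty\tau^{\nu-1}e^{-X\psi(\tau)}\,d\tau$$ (the integral converging absolutely) is the analytic continuation of $F_{p,\nu}$ from $|\arg x|<\pi/2$ to the sector $|\arg X|<\pi/2$, that is, $|\arg x|<(p+1)\pi/(2p)$, where $x$ is a point of the Riemann surface of the logarithm. Still denoting it by $F_{p,\nu}(x)$,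 for every $M\ge 0$, $$F_{p,\nu}(x)=\frac{2\pi A_0}{\kappa p}(\kappa X)^{\vartheta}e^{-\kappa X}\Bigl\{\sum_{j=0}^{M-1}(-1)^jc_j(\kappa X)^{-j}+O(X^{-M})\Bigr\}$$ as $|X|\to\infty$ in $|\arg X|<\pi/2$, uniformly in $|\arg X|\le\pi/2-\delta$ for each $\delta>0$. 3. The two expansions are the same: throughout $|\arg X|<\pi/2$ (in particular for $|\arg x|<\pi/2$), $$\frac{2\pi A_0}{\kappa p}(\kappa X)^{\vartheta}e^{-\kappa X}=\sqrt{\frac{2\pi}{(p+1)X}}\;\Bigl(\frac xp\Bigr)^{\nu/(p+1)}e^{-(p+1)(x/p)^{p/(p+1)}},$$ and $c_j=(-1)^j(2\kappa)^j(\tfrac12)_jB_j$ for all $j\ge 0$. In particular the $c_j$ are uniquely determined. -/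

import Mathlib

open Filter Topology MeasureTheory Asymptotics

noncomputable section

namespace Kratzel

/-- The integrand `t^(ν-1) exp(-t^p - x/t)` of the integral of Krätzel. -/
def integrand (p : ℝ) (ν x : ℂ) (t : ℝ) : ℂ :=
  (t : ℂ) ^ (ν - 1) * Complex.exp (-((t ^ p : ℝ) : ℂ) - x / (t : ℂ))

/-- The integral of Krätzel, `F_{p,ν}(x) = ∫_0^∞ t^(ν-1) exp(-t^p - x/t) dt`. -/
def F (p : ℝ) (ν x : ℂ) : ℂ :=
  ∫ t in Set.Ioi (0 : ℝ), integrand p ν x t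

/-- The phase `ψ(τ) = τ^p / p + 1/τ`, with the principal power. -/
def psi (p : ℝ) (τ : ℂ) : ℂ := τ ^ (p : ℂ) / (p : ℂ) + 1 / τ

/-- The large variable `X = p^(1/(p+1)) x^(p/(p+1))`, with the principal power. -/
def X (p : ℝ) (x : ℂ) : ℂ :=
  ((p ^ (1 / (p + 1)) : ℝ) : ℂ) * x ^ ((p / (p + 1) : ℝ) : ℂ)

/-- The factor `√(2π/((p+1)X)) (x/p)^(ν/(p+1)) exp(-(p+1)(x/p)^(p/(p+1)))`. -/
def prefactor (p : ℝ) (ν x : ℂ) : ℂ :=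
  (2 * (Real.pi : ℂ) / (((p : ℂ) + 1) * X p x)) ^ (1 / 2 : ℂ)
    * (x / (p : ℂ)) ^ (ν / ((p : ℂ) + 1))
    * Complex.exp (-((p : ℂ) + 1) * (x / (p : ℂ)) ^ ((p / (p + 1) : ℝ) : ℂ))

/-- The Pochhammer symbol `(1/2)_k`. -/
def halfPoch (k : ℕ) : ℂ := (ascPochhammer ℂ k).eval (1 / 2 : ℂ)

/-! ### The saddle point coefficients -/

/-- `τ` is the analytic germ at `w = 0` that inverts `w^2/2 = ψ(τ) - ψ(1)` at the saddle `τ = 1`,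
on the branch `τ = 1 + (p+1)^(-1/2) w + ⋯`. -/
structure IsSaddleInverse (p : ℝ) (τ : ℂ → ℂ) : Prop where
  analytic : AnalyticAt ℂ τ 0
  map_zero : τ 0 = 1
  deriv_zero : deriv τ 0 = ((1 / Real.sqrt (p + 1) : ℝ) : ℂ)
  eqn : ∀ᶠ w in 𝓝 (0 : ℂ), w ^ 2 / 2 = psi p (τ w) - psi p 1

/-- `B_k`: the even part of `τ^(ν-1) dτ/dw` is `(p+1)^(-1/2) ∑ B_k w^(2k)`. -/
def B (p : ℝ) (ν : ℂ) (τ : ℂ → ℂ) (k : ℕ) : ℂ :=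
  ((Real.sqrt (p + 1) : ℝ) : ℂ)
    * (iteratedDeriv (2 * k) (fun w : ℂ => τ w ^ (ν - 1) * deriv τ w) 0
        / ((2 * k).factorial : ℂ))

/-! ### The inverse factorial expansion -/

/-- `κ = (p+1)/p`. -/
def kappa (p : ℝ) : ℝ := (p + 1) / p

/-- `h = p^(1/p)`. -/
def h (p : ℝ) : ℝ := p ^ (1 / p)

/-- `ϑ = ν/p - 1/2`. -/
def theta (p : ℝ) (ν : ℂ) : ℂ := ν / (p : ℂ) - 1 / 2

/-- `A₀ = (2π)^(-1/2) κ^(1/2-ϑ) p^(-ϑ)`. -/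
def A0 (p : ℝ) (ν : ℂ) : ℂ :=
  (((2 * Real.pi) ^ (-(1 / 2) : ℝ) : ℝ) : ℂ)
    * (kappa p : ℂ) ^ (1 / 2 - theta p ν) * (p : ℂ) ^ (-theta p ν)

/-- The `c_j` are coefficients of the inverse factorial expansion: for every `M`,
`Γ(s) Γ((s+ν)/p) = 2π A₀ (h κ^κ)^(-s)
  {∑_{j<M} (-1)^j c_j Γ(κs+ϑ-j) + O(1) Γ(κs+ϑ-M)}`
as `|s| → ∞`, uniformly in each closed subsector `|arg s| ≤ π - δ` of `|arg s| < π`. -/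
def IsInverseFactorialExpansion (p : ℝ) (ν : ℂ) (c : ℕ → ℂ) : Prop :=
  ∀ M : ℕ, ∀ δ : ℝ, 0 < δ →
    (fun s : ℂ =>
        Complex.Gamma s * Complex.Gamma ((s + ν) / (p : ℂ))
          - 2 * (Real.pi : ℂ) * A0 p ν * ((h p * kappa p ^ kappa p : ℝ) : ℂ) ^ (-s)
            * ∑ j ∈ Finset.range M,
                (-1) ^ j * c j * Complex.Gamma ((kappa p : ℂ) * s + theta p ν - (j : ℂ)))
      =O[Bornology.cobounded ℂ ⊓ 𝓟 {s : ℂ | |s.arg| ≤ Real.pi - δ}]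
    (fun s : ℂ =>
        2 * (Real.pi : ℂ) * A0 p ν * ((h p * kappa p ^ kappa p : ℝ) : ℂ) ^ (-s)
          * Complex.Gamma ((kappa p : ℂ) * s + theta p ν - (M : ℂ)))

/-- The factor `(2π A₀ / (κ p)) (κX)^ϑ exp(-κX)`, as a function of the value of `X`. -/
def mellinPrefactor (p : ℝ) (ν Y : ℂ) : ℂ :=
  2 * (Real.pi : ℂ) * A0 p ν / ((kappa p : ℂ) * (p : ℂ))
    * ((kappa p : ℂ) * Y) ^ theta p ν * Complex.exp (-(kappa p : ℂ) * Y)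

/-! ### Continuation to the sector `|arg X| < π/2`

This is the sector `|arg x| < (p+1)π/(2p)`, which for `p < 1` has an opening larger than `2π`, so
`x` is a point of the Riemann surface of the logarithm. It is given by its logarithm `ζ = log x`:
`|x| = exp (Re ζ)`, `arg x = Im ζ`, and `arg X = (p/(p+1)) Im ζ`. -/

/-- `X = p^(1/(p+1)) x^(p/(p+1))` at the point with `log x = ζ`. -/
def XLog (p : ℝ) (ζ : ℂ) : ℂ :=
  ((p ^ (1 / (p + 1)) : ℝ) : ℂ) * Complex.exp (((p / (p + 1) : ℝ) : ℂ) * ζ)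

/-- `arg X` at the point with `log x = ζ`, without reduction modulo `2π`. -/
def argX (p : ℝ) (ζ : ℂ) : ℝ := p / (p + 1) * ζ.im

/-- The factor `√(2π/((p+1)X)) (x/p)^(ν/(p+1)) exp(-(p+1)(x/p)^(p/(p+1)))` at the point with
`log x = ζ`. -/
def prefactorLog (p : ℝ) (ν ζ : ℂ) : ℂ :=
  (2 * (Real.pi : ℂ) / (((p : ℂ) + 1) * XLog p ζ)) ^ (1 / 2 : ℂ)
    * Complex.exp (ν / ((p : ℂ) + 1) * (ζ - (Real.log p : ℂ)))
    * Complex.exp (-((p : ℂ) + 1)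
        * Complex.exp (((p / (p + 1) : ℝ) : ℂ) * (ζ - (Real.log p : ℂ))))

/-- The integrand `τ^(ν-1) exp(-X ψ(τ))`, `τ > 0`. -/
def contIntegrand (p : ℝ) (ν ζ : ℂ) (τ : ℝ) : ℂ :=
  (τ : ℂ) ^ (ν - 1) * Complex.exp (-XLog p ζ * psi p (τ : ℂ))

/-- The continuation `(x/p)^(ν/(p+1)) ∫_0^∞ τ^(ν-1) exp(-X ψ(τ)) dτ` of `F_{p,ν}(x)`, at the point
with `log x = ζ`. -/
def FLog (p : ℝ) (ν ζ : ℂ) : ℂ :=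
  Complex.exp (ν / ((p : ℂ) + 1) * (ζ - (Real.log p : ℂ)))
    * ∫ τ in Set.Ioi (0 : ℝ), contIntegrand p ν ζ τ

end Kratzel

end

noncomputable section

namespace Kratzel

/-! For `x > 0` the substitution `t = (x/p)^(1/(p+1)) τ` turns `t^p + x/t` into `X ψ(τ)`, so `F`
equals `(x/p)^(ν/(p+1))` times a Laplace integral that depends on `X` alone and converges for `Re X
> 0` (`FLog_ofReal`). Both sides are holomorphic in `ζ = log x`, and the identity theorem carries
the equality to `|arg x| < π/2` (`FLog_eq_F`); the right side is the continuation.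

On `(0, ∞)` the phase `ψ` has its only minimum at `τ = 1`, with value `κ`. Laplace's method in the
variable `w` gives the saddle point expansion uniformly on cones `Re X ≥ c|X|`
(`saddleIntegral_isBigO`). The half plane `|arg x| < π/2` corresponds to `|arg X| < (π/2) p/(p+1)`,
which lies inside such a cone, so the first expansion is uniform up to the boundary.

For the coefficients `c_j`, Stirling's series in sectors shows that `Γ(s) Γ((s+ν)/p)`, divided by
`(h κ^κ)^(-s) Γ(κs+ϑ)`, has an asymptotic expansion in powers of `1/s`. Repeatedly subtracting the
limit and multiplying by the next linear factor of the Gamma recurrence turns this into an inverse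
factorial expansion (`exists_isInverseFactorialExpansion`).

The two expansions are identified by a direct Mellin transform, with no contour integral or Mellin
inversion. At large real `s` the transform of `F` is `Γ(s) Γ((s+ν)/p) / p`, and that of `(κX)^z
e^(-κX)` is `κ (h κ^κ)^(-s) Γ(κs+z)`. Transforming the saddle point expansion with its remainder
(`Gamma_mul_Gamma_sub_isBigO`) gives an expansion in the same Gamma functions along the positive
axis, where the coefficients are unique (`Gamma_shift_coeff_eq_zero`). This forces `c_j = (-1)^j
(2κ)^j (1/2)_j B_j`. The prefactors agree exactly, so the second expansion is the first one
rewritten. -/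

theorem analyticAt_dslope {f : ℂ → ℂ} {a : ℂ} (hf : AnalyticAt ℂ f a) :
    AnalyticAt ℂ (dslope f a) a := by
  obtain ⟨q, hq⟩ := hf
  exact ⟨_, hq.has_fpower_series_dslope_fslope⟩

theorem eq_add_mul_dslope (f : ℂ → ℂ) (w : ℂ) : f w = f 0 + w * dslope f 0 w := by
  have := sub_smul_dslope f 0 w
  simp only [sub_zero, smul_eq_mul] at this
  rw [this]; ring

/-! ### Sectors around the positive real axis -/

/-- The closed sector `cos (arg s) ≥ -(1 - η)`. -/
def sector (η : ℝ) : Set ℂ := {s | -(1 - η) * ‖s‖ ≤ s.re}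

/-- The filter of large points of a sector. -/
def sectorAtTop (η : ℝ) : Filter ℂ := Bornology.cobounded ℂ ⊓ 𝓟 (sector η)

theorem tendsto_norm_sectorAtTop (η : ℝ) : Tendsto (fun s : ℂ => ‖s‖) (sectorAtTop η) atTop :=
  tendsto_norm_cobounded_atTop.mono_left inf_le_left

theorem eventually_mem_sector (η : ℝ) : ∀ᶠ s in sectorAtTop η, s ∈ sector η :=
  mem_inf_of_right (mem_principal_self _)

theorem tendsto_inv_sectorAtTop (η : ℝ) : Tendsto (fun s : ℂ => s⁻¹) (sectorAtTop η) (𝓝 0) :=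
  tendsto_inv₀_cobounded.mono_left inf_le_left

theorem eventually_ne_zero_sectorAtTop (η : ℝ) : ∀ᶠ s in sectorAtTop η, s ≠ 0 := by
  filter_upwards [(tendsto_norm_sectorAtTop η).eventually_gt_atTop 0] with s hs
  exact norm_pos_iff.mp hs

theorem tendsto_ofReal_sectorAtTop {η : ℝ} (hη : η ≤ 2) :
    Tendsto (fun x : ℝ => (x : ℂ)) atTop (sectorAtTop η) := by
  refine tendsto_inf.mpr ⟨?_, tendsto_principal.mpr ?_⟩
  · rw [← tendsto_norm_atTop_iff_cobounded]
    simpa using tendsto_abs_atTop_atTop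
  · filter_upwards [eventually_gt_atTop 0] with x hx
    simp only [sector, Set.mem_ofPred_eq, Complex.norm_real, Real.norm_eq_abs, abs_of_pos hx,
      Complex.ofReal_re]
    nlinarith

theorem sectorAtTop_neBot {η : ℝ} (hη : η ≤ 2) : (sectorAtTop η).NeBot :=
  (tendsto_ofReal_sectorAtTop hη).neBot

theorem sectorAtTop_anti {η η' : ℝ} (h : η ≤ η') : sectorAtTop η' ≤ sectorAtTop η := by
  refine inf_le_inf_left _ (principal_mono.mpr fun s hs => ?_)
  simp only [sector, Set.mem_ofPred_eq] at hs ⊢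
  nlinarith [norm_nonneg s]

/-- A positive dilation preserves the sector and the translation by `β` is negligible at infinity,
so a slightly wider sector suffices; halving `min η 1` leaves the room. -/
theorem tendsto_affine_sectorAtTop {η α : ℝ} (hη : 0 < η) (hα : 0 < α) (β : ℂ) :
    Tendsto (fun s : ℂ => (α : ℂ) * s + β) (sectorAtTop η) (sectorAtTop (min η 1 / 2)) := by
  have h1 : Tendsto (fun s : ℂ => ‖(α : ℂ) * s + β‖) (sectorAtTop η) atTop := by
    refine tendsto_atTop_mono (f := fun s : ℂ => α * ‖s‖ + -‖β‖) (fun s => ?_)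
      (tendsto_atTop_add_const_right _ _ ((tendsto_norm_sectorAtTop η).const_mul_atTop hα))
    have := norm_sub_norm_le ((α : ℂ) * s) (-β)
    rw [norm_mul, Complex.norm_real, Real.norm_of_nonneg hα.le, norm_neg, sub_neg_eq_add] at this
    linarith
  refine tendsto_inf.mpr ⟨?_, tendsto_principal.mpr ?_⟩
  · rwa [← tendsto_norm_atTop_iff_cobounded]
  · have hm : 0 < min η 1 / 2 := by positivity
    filter_upwards [eventually_mem_sector η,
      h1.eventually_ge_atTop (2 * ‖β‖ / (min η 1 / 2))] with s hs hb
    simp only [sector, Set.mem_ofPred_eq] at hs ⊢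
    rw [div_le_iff₀ hm] at hb
    set m := min η 1 with hmdef
    have hm1 : m ≤ 1 := min_le_right _ _
    have hmη : m ≤ η := min_le_left _ _
    have h2 : ‖(α : ℂ) * s‖ ≤ ‖(α : ℂ) * s + β‖ + ‖β‖ := by
      have := norm_sub_le ((α : ℂ) * s + β) β
      rwa [add_sub_cancel_right] at this
    rw [norm_mul, Complex.norm_real, Real.norm_of_nonneg hα.le] at h2
    have h3 : -‖β‖ ≤ β.re := (abs_le.mp (Complex.abs_re_le_norm β)).1
    have h4 : ((α : ℂ) * s + β).re = α * s.re + β.re := by simp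
    rw [h4]
    have h5 : -(1 - m) * ‖s‖ ≤ s.re := by nlinarith [norm_nonneg s]
    have h6 : α * (-(1 - m) * ‖s‖) ≤ α * s.re := by gcongr
    have h7 : (1 - m) * (α * ‖s‖) ≤ (1 - m) * (‖(α : ℂ) * s + β‖ + ‖β‖) := by
      apply mul_le_mul_of_nonneg_left h2; linarith
    nlinarith [norm_nonneg β, norm_nonneg ((α : ℂ) * s + β)]

/-- From `|s+n|² ≥ |s|² - 2(1-η)n|s| + n² = (η/2)(|s|+n)² + (1-η/2)(|s|-n)²`, together with `η/2 ≥
(η/2)²`. -/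
theorem norm_add_natCast_ge_of_mem_sector {η : ℝ} (hη : 0 < η) (hη1 : η ≤ 1) {s : ℂ}
    (hs : s ∈ sector η) (n : ℕ) : η / 2 * (‖s‖ + n) ≤ ‖s + n‖ := by
  simp only [sector, Set.mem_ofPred_eq] at hs
  refine abs_le_of_sq_le_sq' ?_ (norm_nonneg _) |>.2
  have e1 : ‖s + n‖ ^ 2 = ‖s‖ ^ 2 + 2 * n * s.re + (n : ℝ) ^ 2 := by
    rw [Complex.sq_norm, Complex.sq_norm, Complex.normSq_apply, Complex.normSq_apply]
    simp; ring
  rw [e1]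
  have hn : (0 : ℝ) ≤ n := n.cast_nonneg
  have h2 : n * (-(1 - η) * ‖s‖) ≤ n * s.re := by gcongr
  have h3 := norm_nonneg s
  nlinarith [sq_nonneg (‖s‖ - n), mul_nonneg hn h3, mul_nonneg hη.le (sub_nonneg.mpr hη1),
    mul_nonneg (mul_nonneg hη.le (sub_nonneg.mpr hη1)) (sq_nonneg (‖s‖ + n)),
    mul_nonneg hη.le (sq_nonneg (‖s‖ - n)),mul_nonneg hη.le (sq_nonneg (‖s‖ + n))]

theorem exists_abs_arg_le_of_mem_sector {η : ℝ} (hη : 0 < η) (hη1 : η ≤ 1) :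
    ∃ δ > 0, ∀ s ∈ sector η, s ≠ 0 → |s.arg| ≤ Real.pi - δ := by
  refine ⟨Real.arccos (1 - η), Real.arccos_pos.mpr (by linarith), fun s hs h0 => ?_⟩
  simp only [sector, Set.mem_ofPred_eq] at hs
  have h1 : -(1 - η) ≤ Real.cos |s.arg| := by
    rw [Real.cos_abs, Complex.cos_arg h0, le_div_iff₀ (norm_pos_iff.mpr h0)]
    exact hs
  by_contra! hlt
  have h2 := Real.cos_lt_cos_of_nonneg_of_le_pi
    (by linarith [Real.arccos_le_pi (1 - η)]) (Complex.abs_arg_le_pi s) hlt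
  rw [Real.cos_pi_sub, Real.cos_arccos (by linarith) (by linarith)] at h2
  linarith

/-- In a sector `arg s` stays a fixed distance from `±π` while `arg (1 + u)` tends to `0`, so the
sum of the arguments does not cross the cut. -/
theorem log_mul_one_add_sectorAtTop {η : ℝ} (hη : 0 < η) {u : ℂ → ℂ}
    (hu : Tendsto u (sectorAtTop η) (𝓝 0)) :
    ∀ᶠ s in sectorAtTop η,
      Complex.log (s * (1 + u s)) = Complex.log s + Complex.log (1 + u s) := by
  obtain ⟨δ, hδ, h⟩ := exists_abs_arg_le_of_mem_sector (lt_min hη one_pos) (min_le_right η 1)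
  have h1 : Tendsto (fun s => Complex.arg (1 + u s)) (sectorAtTop η) (𝓝 0) := by
    have : ContinuousAt Complex.arg (1 + 0) := by
      apply Complex.continuousAt_arg; simp
    have := this.tendsto.comp (tendsto_const_nhds.add hu)
    simpa [Function.comp_def] using this
  have h2 : Tendsto (fun s => 1 + u s) (sectorAtTop η) (𝓝 (1 + 0)) := tendsto_const_nhds.add hu
  filter_upwards [eventually_ne_zero_sectorAtTop η, eventually_mem_sector η,
    h2.eventually_ne (by simp : (1 + 0 : ℂ) ≠ 0),
    (Metric.tendsto_nhds.mp h1 δ hδ)] with s h0 hs hu0 hd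
  rw [Complex.log_mul_eq_add_log_iff h0 hu0]
  have hs' : s ∈ sector (min η 1) := by
    simp only [sector, Set.mem_ofPred_eq] at hs ⊢
    nlinarith [norm_nonneg s, min_le_left η 1]
  have := abs_le.mp (h s hs' h0)
  rw [Real.dist_eq, sub_zero] at hd
  have h5 := abs_lt.mp hd
  constructor <;> linarith

theorem abs_arg_le_subset_sector {δ : ℝ} (hδ : 0 < δ) :
    ∃ η > 0, Bornology.cobounded ℂ ⊓ 𝓟 {s : ℂ | |s.arg| ≤ Real.pi - δ} ≤ sectorAtTop η := by
  by_cases hδ' : δ ≤ Real.pi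
  · refine ⟨1 - Real.cos δ, ?_, inf_le_inf_left _ (principal_mono.mpr fun s hs => ?_)⟩
    · have := Real.cos_lt_cos_of_nonneg_of_le_pi le_rfl hδ' hδ
      rw [Real.cos_zero] at this; linarith
    · simp only [sector, Set.mem_ofPred_eq] at hs ⊢
      rcases eq_or_ne s 0 with rfl | h0
      · simp
      have h1 := Real.cos_le_cos_of_nonneg_of_le_pi (abs_nonneg s.arg)
        (by linarith : Real.pi - δ ≤ Real.pi) hs
      rw [Real.cos_abs, Complex.cos_arg h0, Real.cos_pi_sub,
        le_div_iff₀ (norm_pos_iff.mpr h0)] at h1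
      linarith
  · refine ⟨1, one_pos, ?_⟩
    have : {s : ℂ | |s.arg| ≤ Real.pi - δ} = ∅ := by
      ext s; simp only [Set.mem_ofPred_eq, Set.mem_empty_iff_false, iff_false, not_le]
      exact lt_of_lt_of_le (by linarith) (abs_nonneg _)
    rw [this]; simp

/-! ### Functions with an asymptotic expansion in powers of `1/s` -/

/-- `f` has an asymptotic expansion in powers of `1/s` in every sector. -/
def HasInvExpansion (f : ℂ → ℂ) : Prop :=
  ∀ N : ℕ, ∃ g : ℂ → ℂ, AnalyticAt ℂ g 0 ∧
    ∀ η : ℝ, 0 < η → (fun s => f s - g s⁻¹) =O[sectorAtTop η] (fun s => s⁻¹ ^ N)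

theorem AnalyticAt.tendsto_comp_inv {g : ℂ → ℂ} (hg : AnalyticAt ℂ g 0) (η : ℝ) :
    Tendsto (fun s : ℂ => g s⁻¹) (sectorAtTop η) (𝓝 (g 0)) :=
  hg.continuousAt.tendsto.comp (tendsto_inv_sectorAtTop η)

theorem hasInvExpansion_of_analyticAt {f g : ℂ → ℂ} (hg : AnalyticAt ℂ g 0)
    (h : ∀ η : ℝ, 0 < η → ∀ᶠ s in sectorAtTop η, f s = g s⁻¹) : HasInvExpansion f := by
  refine fun N => ⟨g, hg, fun η hη => ?_⟩
  refine (isBigO_zero _ _).congr' ?_ EventuallyEq.rfl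
  filter_upwards [h η hη] with s hs
  simp [hs]

theorem hasInvExpansion_const (c : ℂ) : HasInvExpansion fun _ => c :=
  hasInvExpansion_of_analyticAt (g := fun _ => c) analyticAt_const
    fun _ _ => Eventually.of_forall fun _ => rfl

namespace HasInvExpansion

variable {f f₁ f₂ : ℂ → ℂ}

theorem congr (hf : HasInvExpansion f₁)
    (h : ∀ η : ℝ, 0 < η → ∀ᶠ s in sectorAtTop η, f₂ s = f₁ s) : HasInvExpansion f₂ := by
  intro N
  obtain ⟨g, hg, hO⟩ := hf N
  refine ⟨g, hg, fun η hη => (hO η hη).congr' ?_ EventuallyEq.rfl⟩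
  filter_upwards [h η hη] with s hs
  rw [hs]

theorem isBigO_one (hf : HasInvExpansion f) {η : ℝ} (hη : 0 < η) :
    f =O[sectorAtTop η] (fun _ => (1 : ℂ)) := by
  obtain ⟨g, hg, hO⟩ := hf 0
  have h1 := (AnalyticAt.tendsto_comp_inv hg η).isBigO_one ℂ
  have := (hO η hη).add (by simpa using h1)
  simpa using this

theorem add (h₁ : HasInvExpansion f₁) (h₂ : HasInvExpansion f₂) :
    HasInvExpansion fun s => f₁ s + f₂ s := by
  intro N
  obtain ⟨g₁, hg₁, hO₁⟩ := h₁ N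
  obtain ⟨g₂, hg₂, hO₂⟩ := h₂ N
  refine ⟨fun w => g₁ w + g₂ w, hg₁.add hg₂, fun η hη => ?_⟩
  refine ((hO₁ η hη).add (hO₂ η hη)).congr_left fun s => by ring

/-- Approximants are analytic germs in `1/s` rather than polynomials, so a product of approximants
is again one and nothing has to be truncated. -/
theorem mul (h₁ : HasInvExpansion f₁) (h₂ : HasInvExpansion f₂) :
    HasInvExpansion fun s => f₁ s * f₂ s := by
  intro N
  obtain ⟨g₁, hg₁, hO₁⟩ := h₁ N
  obtain ⟨g₂, hg₂, hO₂⟩ := h₂ N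
  refine ⟨fun w => g₁ w * g₂ w, hg₁.mul hg₂, fun η hη => ?_⟩
  have a := (hO₁ η hη).mul (h₂.isBigO_one hη)
  have b := ((AnalyticAt.tendsto_comp_inv hg₁ η).isBigO_one ℂ).mul (hO₂ η hη)
  simp only [mul_one, one_mul] at a b
  exact (a.add b).congr_left fun s => by ring

theorem tendsto (hf : HasInvExpansion f) :
    ∃ L : ℂ, ∀ η : ℝ, 0 < η → Tendsto f (sectorAtTop η) (𝓝 L) := by
  obtain ⟨g, hg, hO⟩ := hf 1
  refine ⟨g 0, fun η hη => ?_⟩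
  have h1 : Tendsto (fun s => f s - g s⁻¹) (sectorAtTop η) (𝓝 0) :=
    (hO η hη).trans_tendsto (by simpa using tendsto_inv_sectorAtTop η)
  simpa using h1.add (AnalyticAt.tendsto_comp_inv hg η)

/-- Multiplication by `s` costs one order, so the approximant `g` of order `N + 1` is used and
replaced by `(g(w) - g(0))/w`. Every such `g` has `g(0)` equal to the limit of `f`, hence `L` does
not depend on `N`. -/
theorem exists_sub_mul (hf : HasInvExpansion f) :
    ∃ L : ℂ, HasInvExpansion fun s => (f s - L) * s := by
  obtain ⟨L, hL⟩ := hf.tendsto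
  refine ⟨L, fun N => ?_⟩
  obtain ⟨g, hg, hO⟩ := hf (N + 1)
  have hgL : g 0 = L := by
    have := sectorAtTop_neBot (η := 1) (by norm_num)
    have h1 : Tendsto (fun s => f s - g s⁻¹) (sectorAtTop 1) (𝓝 0) :=
      (hO 1 one_pos).trans_tendsto (by simpa using (tendsto_inv_sectorAtTop 1).pow (N + 1))
    have h2 := h1.add (AnalyticAt.tendsto_comp_inv hg 1)
    simp only [sub_add_cancel, zero_add] at h2
    exact tendsto_nhds_unique h2 (hL 1 one_pos)
  refine ⟨dslope g 0, analyticAt_dslope hg, fun η hη => ?_⟩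
  refine ((isBigO_refl (fun s : ℂ => s) (sectorAtTop η)).mul (hO η hη)).congr' ?_ ?_
  · filter_upwards [eventually_ne_zero_sectorAtTop η] with s hs
    have := eq_add_mul_dslope g s⁻¹
    rw [this, hgL]
    field_simp
    ring
  · filter_upwards [eventually_ne_zero_sectorAtTop η] with s hs
    rw [pow_succ]; field_simp

theorem exp (hf : HasInvExpansion f) : HasInvExpansion fun s => Complex.exp (f s) := by
  intro N
  -- One order more than needed: the error must tend to `0`, also for `N = 0`, for `|e^z - 1| ≤
  -- 2|z|` to apply.
  obtain ⟨g, hg, hO⟩ := hf (N + 1)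
  refine ⟨fun w => Complex.exp (g w), hg.cexp, fun η hη => ?_⟩
  have h1 : Tendsto (fun s => f s - g s⁻¹) (sectorAtTop η) (𝓝 0) :=
    (hO η hη).trans_tendsto (by simpa using (tendsto_inv_sectorAtTop η).pow (N + 1))
  have h2 : (fun s => Complex.exp (f s - g s⁻¹) - 1) =O[sectorAtTop η] (fun s => s⁻¹ ^ (N + 1)) := by
    refine IsBigO.trans ?_ (hO η hη)
    refine IsBigO.of_bound 2 ?_
    filter_upwards [(Metric.tendsto_nhds.mp h1 1 one_pos)] with s hs
    rw [dist_zero_right] at hs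
    exact Complex.norm_exp_sub_one_le hs.le
  have h3 := ((AnalyticAt.tendsto_comp_inv hg.cexp η).isBigO_one ℂ).mul h2
  have h4 := ((tendsto_inv_sectorAtTop η).isBigO_one ℂ).mul
    (isBigO_refl (fun s : ℂ => s⁻¹ ^ N) (sectorAtTop η))
  refine (h3.congr' ?_ ?_).trans (by simpa only [one_mul] using h4)
  · refine Eventually.of_forall fun s => ?_
    simp only [Function.comp_apply, mul_sub, mul_one, ← Complex.exp_add]
    congr 2; ring
  · refine Eventually.of_forall fun s => ?_
    simp only [one_mul, pow_succ']

/-- With `w = 1/s`, the inverse of `αs + β` is `w/(α + βw)`, which is analytic at `w = 0`. -/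
theorem comp_affine (hf : HasInvExpansion f) {α : ℝ} (hα : 0 < α) (β : ℂ) :
    HasInvExpansion fun s => f (α * s + β) := by
  intro N
  obtain ⟨g, hg, hO⟩ := hf N
  have hα' : (α : ℂ) ≠ 0 := by exact_mod_cast hα.ne'
  have hφ : AnalyticAt ℂ (fun w : ℂ => w / (α + β * w)) 0 := by
    refine analyticAt_id.div (by fun_prop) ?_
    simpa using hα'
  refine ⟨fun w => g (w / (α + β * w)), ?_, fun η hη => ?_⟩
  · exact AnalyticAt.fun_comp (by simpa using hg) hφ
  have ht := tendsto_affine_sectorAtTop hη hα β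
  have h1 := (hO _ (by positivity)).comp_tendsto ht
  have key : ∀ᶠ s in sectorAtTop η, (α * s + β)⁻¹ = s⁻¹ / (α + β * s⁻¹) := by
    filter_upwards [eventually_ne_zero_sectorAtTop η] with s hs
    have : α + β * s⁻¹ = (α * s + β) * s⁻¹ := by field_simp
    rw [this]
    rw [div_mul_eq_div_div_swap, div_self (inv_ne_zero hs), one_div]
  have h2 : (fun s : ℂ => (α * s + β)⁻¹) =O[sectorAtTop η] fun s => s⁻¹ := by
    have hd : Tendsto (fun s : ℂ => (α + β * s⁻¹)⁻¹) (sectorAtTop η) (𝓝 (α + β * 0)⁻¹) :=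
      Tendsto.inv₀ (tendsto_const_nhds.add (tendsto_const_nhds.mul (tendsto_inv_sectorAtTop η)))
        (by simpa using hα')
    have := (isBigO_refl (fun s : ℂ => s⁻¹) (sectorAtTop η)).mul (hd.isBigO_one ℂ)
    simp only [mul_one] at this
    refine this.congr' ?_ EventuallyEq.rfl
    filter_upwards [key] with s hs
    rw [hs, div_eq_mul_inv]
  refine (h1.congr' ?_ EventuallyEq.rfl).trans (h2.pow N)
  filter_upwards [key] with s hs
  simp [hs]

end HasInvExpansion

/-! ### Stirling's series -/

theorem dslope_dslope_same {f : ℂ → ℂ} {a : ℂ} (hf : AnalyticAt ℂ f a) :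
    dslope (dslope f a) a a = iteratedDeriv 2 f a / 2 := by
  have h := hf.hasFPowerSeriesAt.has_fpower_series_dslope_fslope.has_fpower_series_dslope_fslope
  have h0 := h.coeff_zero 1
  rw [← h0]
  have : (FormalMultilinearSeries.ofScalars ℂ
      fun n => iteratedDeriv n f a / (n.factorial : ℂ)).fslope.fslope.coeff 0
      = iteratedDeriv 2 f a / 2 := by
    rw [FormalMultilinearSeries.coeff_fslope, FormalMultilinearSeries.coeff_fslope,
      FormalMultilinearSeries.coeff_ofScalars]
    simp
  rw [← this, FormalMultilinearSeries.coeff]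

/-- In `w = 1/s` the map `w ↦ w/(1+w)` is the shift `s ↦ s+1`, so this solves a difference equation
up to `O(w^(N+2))`. Since `w^(N+1) - (w/(1+w))^(N+1) = (N+1) w^(N+2) + ⋯`, adding a multiple of
`w^(N+1)` to `g` removes the leading term of the error. The Bernoulli numbers of Stirling's series
are never needed. -/
theorem exists_telescoping {φ h₀ : ℂ → ℂ} (hh : AnalyticAt ℂ h₀ 0)
    (hφ : ∀ᶠ w in 𝓝 (0 : ℂ), φ w = w ^ 2 * h₀ w) (N : ℕ) :
    ∃ g h : ℂ → ℂ, AnalyticAt ℂ g 0 ∧ AnalyticAt ℂ h 0 ∧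
      ∀ᶠ w in 𝓝 (0 : ℂ), φ w - (g w - g (w / (1 + w))) = w ^ (N + 2) * h w := by
  induction N with
  | zero => exact ⟨fun _ => 0, h₀, analyticAt_const, hh, by simpa using hφ⟩
  | succ N ih =>
    obtain ⟨g, h, hg, hh, he⟩ := ih
    set q : ℂ → ℂ := fun w => 1 - ((1 + w) ^ (N + 1))⁻¹ with hq
    have hqa : AnalyticAt ℂ q 0 := by
      refine analyticAt_const.sub (AnalyticAt.inv (by fun_prop) (by simp))
    have hq' : dslope q 0 0 = N + 1 := by
      rw [dslope_same]
      have h1 : HasDerivAt (fun w : ℂ => (1 + w) ^ (N + 1)) (N + 1) 0 := by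
        have := ((hasDerivAt_id (0 : ℂ)).const_add 1).fun_pow (N + 1)
        simpa using this
      have h2 : HasDerivAt q _ 0 := (h1.fun_inv (by simp)).const_sub 1
      rw [h2.deriv]
      simp
    have hN : (N + 1 : ℂ) ≠ 0 := by exact_mod_cast N.succ_ne_zero
    refine ⟨fun w => g w + h 0 / (N + 1) * w ^ (N + 1),
      fun w => dslope h 0 w - h 0 / (N + 1) * dslope (dslope q 0) 0 w,
      hg.add (by fun_prop), (analyticAt_dslope hh).sub
        (analyticAt_const.mul (analyticAt_dslope (analyticAt_dslope hqa))), ?_⟩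
    filter_upwards [he] with w hw
    have e1 := eq_add_mul_dslope h w
    have e2 := eq_add_mul_dslope (dslope q 0) w
    have e3 := eq_add_mul_dslope q w
    rw [hq'] at e2
    have e4 : q 0 = 0 := by simp [hq]
    have e5 : w ^ (N + 1) - (w / (1 + w)) ^ (N + 1) = w ^ (N + 1) * q w := by
      rw [hq, div_pow]; ring
    calc φ w - (g w + h 0 / (N + 1) * w ^ (N + 1)
          - (g (w / (1 + w)) + h 0 / (N + 1) * (w / (1 + w)) ^ (N + 1)))
        = (φ w - (g w - g (w / (1 + w))))
          - h 0 / (N + 1) * (w ^ (N + 1) - (w / (1 + w)) ^ (N + 1)) := by ring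
      _ = _ := by
        rw [hw, e5, e3, e4, e2, e1]
        field_simp
        ring

/-- `(s - 1/2) log s - s`, the main part of `log Γ(s) - log √(2π)`. -/
def stirlingMain (s : ℂ) : ℂ := (s - 1 / 2) * Complex.log s - s

/-- The difference `stirlingMain (s + 1) - stirlingMain s - log s`. -/
def binetTerm (s : ℂ) : ℂ := stirlingMain (s + 1) - stirlingMain s - Complex.log s

/-- The remainder of Stirling's formula, as a series of Gudermann. -/
def binet (s : ℂ) : ℂ := ∑' n : ℕ, binetTerm (s + n)

theorem analyticAt_log_one_add : AnalyticAt ℂ (fun w : ℂ => Complex.log (1 + w)) 0 := by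
  refine AnalyticAt.clog (by fun_prop) ?_
  simp

theorem hasDerivAt_log_one_add {w : ℂ} (hw : 1 + w ∈ Complex.slitPlane) :
    HasDerivAt (fun w : ℂ => Complex.log (1 + w)) (1 + w)⁻¹ w := by
  simpa using ((hasDerivAt_id w).const_add 1).clog hw

theorem iteratedDeriv_two_log_one_add :
    iteratedDeriv 2 (fun w : ℂ => Complex.log (1 + w)) 0 = -1 := by
  rw [iteratedDeriv_succ, iteratedDeriv_one]
  have h1 : deriv (fun w : ℂ => Complex.log (1 + w)) =ᶠ[𝓝 0] fun w => (1 + w)⁻¹ := by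
    have : ∀ᶠ w in 𝓝 (0 : ℂ), 1 + w ∈ Complex.slitPlane := by
      have hc : ContinuousAt (fun w : ℂ => 1 + w) 0 := by fun_prop
      exact hc.eventually_mem (Complex.isOpen_slitPlane.mem_nhds (by simp))
    filter_upwards [this] with w hw
    exact (hasDerivAt_log_one_add hw).deriv
  rw [h1.deriv_eq]
  have h2 := ((hasDerivAt_id (0 : ℂ)).const_add 1).fun_inv (by simp)
  simpa using h2.deriv

/-- In `w = 1/s` the term is `(1/w + 1/2) log(1+w) - 1`. Two divided slopes of `log(1+w)` write it
as `w k(w)`, and `k(0) = -1/2 + 1/2 = 0`; this cancellation is what makes the series of Gudermann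
converge. -/
theorem exists_binetTerm_eq :
    ∃ φ h₀ : ℂ → ℂ, AnalyticAt ℂ h₀ 0 ∧ (∀ᶠ w in 𝓝 (0 : ℂ), φ w = w ^ 2 * h₀ w) ∧
      ∀ η : ℝ, 0 < η → ∀ᶠ s in sectorAtTop η, binetTerm s = φ s⁻¹ := by
  set l : ℂ → ℂ := fun w => Complex.log (1 + w) with hl
  have hla : AnalyticAt ℂ l 0 := analyticAt_log_one_add
  set l₁ := dslope l 0 with hl₁
  set l₂ := dslope l₁ 0 with hl₂
  have h1a : AnalyticAt ℂ l₁ 0 := analyticAt_dslope hla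
  have h2a : AnalyticAt ℂ l₂ 0 := analyticAt_dslope h1a
  have v0 : l 0 = 0 := by simp [hl]
  have v1 : l₁ 0 = 1 := by
    rw [hl₁, dslope_same]
    simpa using (hasDerivAt_log_one_add (w := 0) (by simp)).deriv
  have v2 : l₂ 0 = -1 / 2 := by
    rw [hl₂, hl₁, dslope_dslope_same hla, iteratedDeriv_two_log_one_add]
  set k : ℂ → ℂ := fun w => l₂ w + l₁ w / 2 with hk
  have hka : AnalyticAt ℂ k 0 := h2a.add (h1a.div_const)
  have k0 : k 0 = 0 := by simp only [hk, v1, v2]; norm_num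
  refine ⟨fun w => w * k w, dslope k 0, analyticAt_dslope hka,
    Eventually.of_forall fun w => ?_, fun η hη => ?_⟩
  · have := eq_add_mul_dslope k w
    rw [k0, zero_add] at this
    simp only [this]; ring
  · filter_upwards [log_mul_one_add_sectorAtTop hη (tendsto_inv_sectorAtTop η),
      eventually_ne_zero_sectorAtTop η] with s hs h0
    have e : s + 1 = s * (1 + s⁻¹) := by field_simp
    have e0 := eq_add_mul_dslope l s⁻¹
    have e1 := eq_add_mul_dslope l₁ s⁻¹
    rw [v0, zero_add] at e0
    rw [v1] at e1
    change l s⁻¹ = s⁻¹ * l₁ s⁻¹ at e0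
    change l₁ s⁻¹ = 1 + s⁻¹ * l₂ s⁻¹ at e1
    have e2 : Complex.log (s + 1) = Complex.log s + l s⁻¹ := by rw [e, hs]
    rw [binetTerm, stirlingMain, stirlingMain, e2, e0]
    simp only [hk]
    have e3 : l₂ s⁻¹ = s * (l₁ s⁻¹ - 1) := by rw [e1]; field_simp; ring
    rw [e3]
    field_simp
    ring

/-- A shift to the right turns the argument towards `0`. If `Re(s+n)` is still negative, its modulus
has decreased while the imaginary part is unchanged. -/
theorem add_natCast_mem_sector {η : ℝ} (hη : 0 < η) (hη1 : η ≤ 1) {s : ℂ}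
    (hs : s ∈ sector η) (n : ℕ) : s + n ∈ sector η := by
  simp only [sector, Set.mem_ofPred_eq] at hs ⊢
  have hn : (0 : ℝ) ≤ n := n.cast_nonneg
  have e : (s + n).re = s.re + n := by simp
  have ei : (s + n).im = s.im := by simp
  rw [e]
  rcases le_total 0 (s.re + n) with h | h
  · nlinarith [norm_nonneg (s + n)]
  have q1 : s.re ^ 2 + s.im ^ 2 = ‖s‖ ^ 2 := by
    rw [Complex.sq_norm, Complex.normSq_apply]; ring
  have q2 : (s.re + n) ^ 2 + s.im ^ 2 = ‖s + n‖ ^ 2 := by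
    rw [Complex.sq_norm, Complex.normSq_apply, e, ei]; ring
  have h1 : (s.re) ^ 2 ≤ (1 - η) ^ 2 * ‖s‖ ^ 2 := by
    rw [← mul_pow]
    apply sq_le_sq'
    · linarith
    · nlinarith [norm_nonneg s]
  have h2 : (s.re + n) ^ 2 ≤ s.re ^ 2 := by nlinarith
  have h3 : (s.re + n) ^ 2 ≤ ((1 - η) * ‖s + n‖) ^ 2 := by
    rw [mul_pow, ← q2]
    rw [← q1] at h1
    nlinarith [mul_nonneg hη.le (sub_nonneg.mpr hη1)]
  have := (abs_le_of_sq_le_sq' h3 (mul_nonneg (by linarith) (norm_nonneg _))).1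
  linarith

theorem eventually_forall_add_natCast {η : ℝ} (hη : 0 < η) (hη1 : η ≤ 1) {P : ℂ → Prop}
    (h : ∀ᶠ s in sectorAtTop η, P s) : ∀ᶠ s in sectorAtTop η, ∀ n : ℕ, P (s + n) := by
  have h1 : ∃ R : ℝ, ∀ s ∈ sector η, R ≤ ‖s‖ → P s := by
    rw [sectorAtTop, eventually_inf_principal, ← comap_norm_atTop, eventually_comap,
      eventually_atTop] at h
    obtain ⟨R, hR⟩ := h
    exact ⟨R, fun s hs hn => hR _ hn s rfl hs⟩
  obtain ⟨R, hR⟩ := h1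
  filter_upwards [eventually_mem_sector η,
    (tendsto_norm_sectorAtTop η).eventually_ge_atTop (R / (η / 2))] with s hs hn n
  refine hR _ (add_natCast_mem_sector hη hη1 hs n) ?_
  refine le_trans ?_ (norm_add_natCast_ge_of_mem_sector hη hη1 hs n)
  rw [div_le_iff₀ (by positivity)] at hn
  have : (0 : ℝ) ≤ n := n.cast_nonneg
  nlinarith

theorem summable_inv_one_add_sq : Summable fun n : ℕ => ((1 + n : ℝ) ^ 2)⁻¹ := by
  have := (summable_nat_add_iff 1).mpr (Real.summable_nat_pow_inv.mpr (by norm_num : 1 < 2))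
  refine this.congr fun n => ?_
  push_cast; rw [add_comm]

/-- Of the `N + 2` powers of `1/(|s|+n)`, two pay for a convergent sum over `n` and `N` remain as
decay in `s`. -/
theorem isBigO_inv_pow_add_natCast {η : ℝ} (hη : 0 < η) (hη1 : η ≤ 1) {F h : ℂ → ℂ} {N : ℕ}
    (hh : AnalyticAt ℂ h 0)
    (hF : ∀ᶠ s in sectorAtTop η, F s = s⁻¹ ^ (N + 2) * h s⁻¹) :
    ∃ C : ℝ, 0 ≤ C ∧ ∀ᶠ s in sectorAtTop η, ∀ n : ℕ,
      ‖F (s + n)‖ ≤ C * ‖s⁻¹ ^ N‖ * ((1 + n : ℝ) ^ 2)⁻¹ := by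
  have hb : ∀ᶠ s in sectorAtTop η, ‖h s⁻¹‖ ≤ ‖h 0‖ + 1 := by
    have := (AnalyticAt.tendsto_comp_inv hh η).norm
    exact this.eventually_le_const (by linarith)
  refine ⟨((2 / η) ^ (N + 2)) * (‖h 0‖ + 1), by positivity, ?_⟩
  filter_upwards [eventually_forall_add_natCast hη hη1 (hF.and hb), eventually_mem_sector η,
    (tendsto_norm_sectorAtTop η).eventually_ge_atTop 1] with s hs hsec h1 n
  rw [(hs n).1, norm_mul]
  have h2 := norm_add_natCast_ge_of_mem_sector hη hη1 hsec n
  have hn : (0 : ℝ) ≤ n := n.cast_nonneg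
  have h3 : ‖(s + n)⁻¹ ^ (N + 2)‖ ≤ (2 / η) ^ (N + 2) * (‖s⁻¹ ^ N‖ * ((1 + n : ℝ) ^ 2)⁻¹) := by
    have hp : 0 < η / 2 * (‖s‖ + n) := by positivity
    calc ‖(s + n)⁻¹ ^ (N + 2)‖ = (‖s + n‖⁻¹) ^ (N + 2) := by rw [norm_pow, norm_inv]
      _ ≤ ((η / 2 * (‖s‖ + n))⁻¹) ^ (N + 2) := by gcongr
      _ = (2 / η) ^ (N + 2) * (((‖s‖ + n)⁻¹) ^ N * ((‖s‖ + n) ^ 2)⁻¹) := by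
        rw [mul_inv, mul_pow, inv_div, pow_add (‖s‖ + ↑n)⁻¹, inv_pow _ 2]
      _ ≤ (2 / η) ^ (N + 2) * ((‖s‖⁻¹) ^ N * ((1 + n : ℝ) ^ 2)⁻¹) := by
        gcongr
        linarith
      _ = _ := by rw [norm_pow, norm_inv]
  calc _ ≤ (2 / η) ^ (N + 2) * (‖s⁻¹ ^ N‖ * ((1 + n : ℝ) ^ 2)⁻¹) * (‖h 0‖ + 1) := by
        gcongr
        exact (hs n).2
    _ = _ := by ring

theorem eventually_summable_binetTerm {η : ℝ} (hη : 0 < η) :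
    ∀ᶠ s in sectorAtTop η, Summable fun n : ℕ => binetTerm (s + n) := by
  suffices ∀ η : ℝ, 0 < η → η ≤ 1 →
      ∀ᶠ s in sectorAtTop η, Summable fun n : ℕ => binetTerm (s + n) from
    sectorAtTop_anti (min_le_left η 1) (this _ (lt_min hη one_pos) (min_le_right _ _))
  intro η hη hη1
  obtain ⟨φ, h₀, hh, hφ, hb⟩ := exists_binetTerm_eq
  have h1 : ∀ᶠ s in sectorAtTop η, binetTerm s = s⁻¹ ^ (0 + 2) * h₀ s⁻¹ := by
    filter_upwards [hb η hη, (tendsto_inv_sectorAtTop η).eventually hφ] with s e1 e2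
    rw [e1, e2]
  obtain ⟨C, -, hC⟩ := isBigO_inv_pow_add_natCast hη hη1 hh h1
  filter_upwards [hC] with s hs
  exact Summable.of_norm_bounded (summable_inv_one_add_sq.mul_left _) hs

/-- Summing the approximate telescoping identity over `s + n` leaves `g(1/s) - g(0)`, since
`g(1/(s+K)) → g(0)`, and a remainder that is summable uniformly in the sector. -/
theorem hasInvExpansion_binet : HasInvExpansion binet := by
  obtain ⟨φ, h₀, hh₀, hφ, hb⟩ := exists_binetTerm_eq
  intro N
  obtain ⟨g, h, hg, hh, he⟩ := exists_telescoping hh₀ hφ N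
  refine ⟨fun w => g w - g 0, hg.sub analyticAt_const, ?_⟩
  suffices ∀ η : ℝ, 0 < η → η ≤ 1 →
      (fun s => binet s - (g s⁻¹ - g 0)) =O[sectorAtTop η] (fun s => s⁻¹ ^ N) from
    fun η hη => (this _ (lt_min hη one_pos) (min_le_right _ _)).mono
      (sectorAtTop_anti (min_le_left η 1))
  intro η hη hη1
  have h1 : ∀ᶠ s in sectorAtTop η,
      binetTerm s - (g s⁻¹ - g (s + 1)⁻¹) = s⁻¹ ^ (N + 2) * h s⁻¹ := by
    filter_upwards [hb η hη, (tendsto_inv_sectorAtTop η).eventually he,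
      eventually_ne_zero_sectorAtTop η] with s e1 e2 e3
    rw [e1, ← e2]
    congr 4
    field_simp
  obtain ⟨C, hC0, hC⟩ := isBigO_inv_pow_add_natCast hη hη1 hh h1
  refine IsBigO.of_bound (C * ∑' n : ℕ, ((1 + n : ℝ) ^ 2)⁻¹) ?_
  filter_upwards [hC, eventually_summable_binetTerm hη, eventually_mem_sector η] with s hs hsum hsec
  have ht : Tendsto (fun K : ℕ => ∑ n ∈ Finset.range K, binetTerm (s + n)
      - (g s⁻¹ - g (s + K)⁻¹)) atTop (𝓝 (binet s - (g s⁻¹ - g 0))) := by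
    refine hsum.hasSum.tendsto_sum_nat.sub (tendsto_const_nhds.sub ?_)
    refine hg.continuousAt.tendsto.comp ?_
    refine tendsto_inv₀_cobounded.comp ?_
    rw [← tendsto_norm_atTop_iff_cobounded]
    refine tendsto_atTop_mono (fun n => norm_add_natCast_ge_of_mem_sector hη hη1 hsec n) ?_
    exact (tendsto_atTop_add_const_left _ _ tendsto_natCast_atTop_atTop).const_mul_atTop
      (by positivity)
  refine le_of_tendsto ht.norm (Eventually.of_forall fun K => ?_)
  have e : ∑ n ∈ Finset.range K, binetTerm (s + n) - (g s⁻¹ - g (s + K)⁻¹)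
      = ∑ n ∈ Finset.range K, (binetTerm (s + n) - (g (s + n)⁻¹ - g (s + n + 1)⁻¹)) := by
    rw [Finset.sum_sub_distrib]
    congr 1
    have := Finset.sum_range_sub' (fun n : ℕ => g (s + n)⁻¹) K
    simp only [Nat.cast_zero, add_zero, Nat.cast_add, Nat.cast_one, ← add_assoc] at this
    exact this.symm
  rw [e]
  calc _ ≤ ∑ n ∈ Finset.range K, C * ‖s⁻¹ ^ N‖ * ((1 + n : ℝ) ^ 2)⁻¹ :=
        norm_sum_le_of_le _ fun n _ => hs n
    _ = C * ‖s⁻¹ ^ N‖ * ∑ n ∈ Finset.range K, ((1 + n : ℝ) ^ 2)⁻¹ := by rw [Finset.mul_sum]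
    _ ≤ C * ‖s⁻¹ ^ N‖ * ∑' n : ℕ, ((1 + n : ℝ) ^ 2)⁻¹ := by
        gcongr
        exact summable_inv_one_add_sq.sum_le_tsum _ fun n _ => by positivity
    _ = _ := by ring

theorem tendsto_natCast_mul_log_one_add_div (t : ℂ) :
    Tendsto (fun n : ℕ => (n : ℂ) * Complex.log (1 + t / n)) atTop (𝓝 t) := by
  refine Complex.tendsto_nat_mul_log_one_add_of_tendsto ?_
  refine tendsto_const_nhds.congr' ?_
  filter_upwards [eventually_ne_atTop 0] with n hn
  field_simp

/-- Supplies the boundary term at `s + n + 1` of the telescoped series; Stirling's formula for `n!`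
is what fixes the constant `√(2π)`. -/
theorem tendsto_exp_stirlingMain_div (s : ℂ) :
    Tendsto (fun n : ℕ => Complex.exp (stirlingMain (s + n + 1)) / ((n : ℂ) ^ s * n.factorial))
      atTop (𝓝 (((√(2 * Real.pi) : ℝ) : ℂ)⁻¹)) := by
  have h0 : Tendsto (fun n : ℕ => (s + 1) / (n : ℂ)) atTop (𝓝 0) :=
    tendsto_const_div_atTop_nhds_zero_nat _
  have h1 : Tendsto (fun n : ℕ => (s + n + 1 / 2) * Complex.log (1 + (s + 1) / n) - s - 1) atTop
      (𝓝 0) := by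
    have a := tendsto_natCast_mul_log_one_add_div (s + 1)
    have b : Tendsto (fun n : ℕ => Complex.log (1 + (s + 1) / n)) atTop (𝓝 0) := by
      have hc : ContinuousAt (fun w : ℂ => Complex.log (1 + w)) 0 :=
        analyticAt_log_one_add.continuousAt
      simpa [Function.comp_def] using hc.tendsto.comp h0
    have c := ((b.const_mul (s + 1 / 2)).add a).sub_const (s + 1)
    simp only [mul_zero, zero_add, sub_self] at c
    refine c.congr fun n => ?_
    ring
  have h2 : Tendsto (fun n : ℕ => (((Stirling.stirlingSeq n * √2 : ℝ) : ℂ)⁻¹)) atTop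
      (𝓝 (((√(2 * Real.pi) : ℝ) : ℂ)⁻¹)) := by
    have := (Stirling.tendsto_stirlingSeq_sqrt_pi.mul_const √2)
    rw [← Real.sqrt_mul Real.pi_pos.le, mul_comm Real.pi] at this
    refine ((Complex.continuous_ofReal.tendsto _).comp this).inv₀ ?_
    have : √(2 * Real.pi) ≠ 0 := by positivity
    exact_mod_cast this
  have h3 := ((Complex.continuous_exp.tendsto _).comp h1).mul h2
  rw [Complex.exp_zero, one_mul] at h3
  refine h3.congr' ?_
  filter_upwards [eventually_gt_atTop 0, h0.eventually_ne (by simp : (0 : ℂ) ≠ -1)] with n hn hne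
  have hn' : (0 : ℝ) < n := by exact_mod_cast hn
  have hnc : (n : ℂ) ≠ 0 := by exact_mod_cast hn.ne'
  have hlog : Complex.log (s + n + 1) = Real.log n + Complex.log (1 + (s + 1) / n) := by
    have : s + n + 1 = ((n : ℝ) : ℂ) * (1 + (s + 1) / n) := by
      push_cast; field_simp; ring
    rw [this, Complex.log_ofReal_mul hn']
    intro h; apply hne; linear_combination h
  have hfac : (n.factorial : ℂ)
      = ((Stirling.stirlingSeq n * √2 : ℝ) : ℂ) * Complex.exp ((n + 1 / 2) * Real.log n - n) := by
    have : (n.factorial : ℝ)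
        = (Stirling.stirlingSeq n * √2) * Real.exp ((n + 1 / 2) * Real.log n - n) := by
      have e1 : Real.exp ((n + 1 / 2) * Real.log n - n) = √n * (n / Real.exp 1) ^ n := by
        have : ((n + 1 / 2) * Real.log n - n) = Real.log n * (1 / 2) + n * (Real.log n - 1) := by
          ring
        rw [this, Real.exp_add, Real.sqrt_eq_rpow, Real.rpow_def_of_pos hn', Real.exp_nat_mul,
          Real.exp_sub, Real.exp_log hn']
      rw [e1, Stirling.stirlingSeq, Real.sqrt_mul zero_le_two]
      field_simp
    rw [← Complex.ofReal_natCast, this]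
    push_cast
    rfl
  have hpow : (n : ℂ) ^ s = Complex.exp (Real.log n * s) := by
    rw [Complex.cpow_def_of_ne_zero hnc, Complex.ofReal_log hn'.le, Complex.ofReal_natCast]
  rw [hfac, hpow, stirlingMain, hlog, Function.comp_apply]
  rw [mul_left_comm, ← Complex.exp_add, div_mul_eq_div_div_swap, ← Complex.exp_sub, div_eq_mul_inv]
  congr 2
  ring

/-- The main parts telescope in the partial sums of `binet`, and the remaining logarithms multiply
to `s(s+1)⋯(s+n)`. The exponential of a partial sum is therefore Euler's `GammaSeq` times boundary
factors whose limits are known. -/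
theorem Gamma_eq_exp_stirlingMain_add_binet {η : ℝ} (hη : 0 < η) :
    ∀ᶠ s in sectorAtTop η,
      Complex.Gamma s = ((√(2 * Real.pi) : ℝ) : ℂ) * Complex.exp (stirlingMain s + binet s) := by
  suffices ∀ η : ℝ, 0 < η → η ≤ 1 → ∀ᶠ s in sectorAtTop η,
      Complex.Gamma s = ((√(2 * Real.pi) : ℝ) : ℂ) * Complex.exp (stirlingMain s + binet s) from
    sectorAtTop_anti (min_le_left η 1) (this _ (lt_min hη one_pos) (min_le_right _ _))
  intro η hη hη1
  filter_upwards [eventually_summable_binetTerm hη,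
    eventually_forall_add_natCast hη hη1 (eventually_ne_zero_sectorAtTop η)] with s hsum hne
  have h1 : Tendsto (fun n : ℕ => Complex.exp (∑ j ∈ Finset.range (n + 1), binetTerm (s + j)))
      atTop (𝓝 (Complex.exp (binet s))) :=
    (Complex.continuous_exp.tendsto _).comp
      (hsum.hasSum.tendsto_sum_nat.comp (tendsto_add_atTop_nat 1))
  have h2 := ((Complex.GammaSeq_tendsto_Gamma s).mul_const (Complex.exp (-stirlingMain s))).mul
    (tendsto_exp_stirlingMain_div s)
  have hprod : ∀ K : ℕ, Complex.exp (∑ j ∈ Finset.range K, Complex.log (s + j))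
      = ∏ j ∈ Finset.range K, (s + j) := fun K => by
    rw [Complex.exp_sum]
    exact Finset.prod_congr rfl fun j _ => Complex.exp_log (hne j)
  have h3 : ∀ n : ℕ, 0 < n →
      Complex.exp (∑ j ∈ Finset.range (n + 1), binetTerm (s + j))
      = Complex.GammaSeq s n * Complex.exp (-stirlingMain s)
        * (Complex.exp (stirlingMain (s + n + 1)) / ((n : ℂ) ^ s * n.factorial)) := by
    intro n hn
    have e1 : ∑ j ∈ Finset.range (n + 1), binetTerm (s + j)
        = stirlingMain (s + n + 1) - stirlingMain s
          - ∑ j ∈ Finset.range (n + 1), Complex.log (s + j) := by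
      simp only [binetTerm]
      rw [Finset.sum_sub_distrib]
      congr 1
      have := Finset.sum_range_sub (fun j : ℕ => stirlingMain (s + j)) (n + 1)
      simp only [Nat.cast_zero, add_zero, Nat.cast_add, Nat.cast_one, ← add_assoc] at this
      exact this
    rw [e1, Complex.exp_sub, hprod, Complex.GammaSeq, sub_eq_add_neg, Complex.exp_add]
    have hnc : (n : ℂ) ≠ 0 := by exact_mod_cast hn.ne'
    have hf : (n.factorial : ℂ) ≠ 0 := by exact_mod_cast n.factorial_ne_zero
    have hns : (n : ℂ) ^ s ≠ 0 := by simp [Complex.cpow_eq_zero_iff, hnc]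
    have hp : ∏ j ∈ Finset.range (n + 1), (s + j) ≠ 0 := Finset.prod_ne_zero_iff.mpr fun j _ => hne j
    field_simp
  have h4 := tendsto_nhds_unique h1 (h2.congr' (by
    filter_upwards [eventually_gt_atTop 0] with n hn
    exact (h3 n hn).symm))
  have hpi : ((√(2 * Real.pi) : ℝ) : ℂ) ≠ 0 := by
    have : √(2 * Real.pi) ≠ 0 := by positivity
    exact_mod_cast this
  rw [Complex.exp_add, h4, Complex.exp_neg]
  field_simp

theorem HasInvExpansion.exists_sub_mul_affine {f : ℂ → ℂ} (hf : HasInvExpansion f) (a b : ℂ) :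
    ∃ L : ℂ, HasInvExpansion fun s => (f s - L) * (a * s + b) := by
  obtain ⟨L, hL⟩ := hf.exists_sub_mul
  refine ⟨L, ?_⟩
  have h1 := ((hasInvExpansion_const a).mul hL).add
    ((hasInvExpansion_const b).mul (hf.add (hasInvExpansion_const (-L))))
  refine h1.congr fun η _ => Eventually.of_forall fun s => ?_
  ring

/-- Expand `log(αs+β) = log α + log s + log(1 + c/s)` with `c = β/α`. The last logarithm times `αs +
β - 1/2` is analytic in `1/s` and joins the Binet remainder in `m`. -/
theorem exists_Gamma_affine_eq {α : ℝ} (hα : 0 < α) (β : ℂ) :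
    ∃ m : ℂ → ℂ, HasInvExpansion m ∧ ∀ η : ℝ, 0 < η → ∀ᶠ s in sectorAtTop η,
      Complex.Gamma (α * s + β) = ((√(2 * Real.pi) : ℝ) : ℂ)
        * Complex.exp ((α * s + β - 1 / 2) * (Complex.log s + Real.log α) - α * s + m s) := by
  have hα' : (α : ℂ) ≠ 0 := by exact_mod_cast hα.ne'
  set l : ℂ → ℂ := fun w => Complex.log (1 + w) with hl
  set c : ℂ := β / α with hc
  have hg : AnalyticAt ℂ (fun w : ℂ => (α + (β - 1 / 2) * w) * (c * dslope l 0 (c * w)) - β) 0 := by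
    have h1 : AnalyticAt ℂ (fun w : ℂ => dslope l 0 (c * w)) 0 := by
      refine AnalyticAt.fun_comp (g := dslope l 0) (f := fun w => c * w) ?_ (by fun_prop)
      simpa using analyticAt_dslope analyticAt_log_one_add
    fun_prop
  have hm1 : HasInvExpansion fun s => (α * s + β - 1 / 2) * l (c * s⁻¹) - β := by
    refine hasInvExpansion_of_analyticAt hg fun η hη => ?_
    filter_upwards [eventually_ne_zero_sectorAtTop η] with s hs
    have := eq_add_mul_dslope l (c * s⁻¹)
    have h0 : l 0 = 0 := by simp [hl]
    rw [this, h0]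
    field_simp
    ring
  refine ⟨_, hm1.add (hasInvExpansion_binet.comp_affine hα β), fun η hη => ?_⟩
  have ht := tendsto_affine_sectorAtTop hη hα β
  have hu : Tendsto (fun s : ℂ => c * s⁻¹) (sectorAtTop η) (𝓝 0) := by
    simpa using (tendsto_inv_sectorAtTop η).const_mul c
  filter_upwards [ht.eventually (Gamma_eq_exp_stirlingMain_add_binet (by positivity)),
    log_mul_one_add_sectorAtTop hη hu, eventually_ne_zero_sectorAtTop η,
    ht.eventually (eventually_ne_zero_sectorAtTop _)] with s h1 h2 h3 h4
  rw [h1]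
  have e : (α : ℂ) * s + β = (α : ℂ) * (s * (1 + c * s⁻¹)) := by
    rw [hc]; field_simp
  have e2 : Complex.log (α * s + β) = Real.log α + (Complex.log s + l (c * s⁻¹)) := by
    rw [e, Complex.log_ofReal_mul hα, h2]
    intro h
    apply h4
    rw [e, h, mul_zero]
  rw [stirlingMain, e2]
  congr 2
  ring

/-! ### The Gamma product and the existence of the inverse factorial expansion. -/

variable {p : ℝ}

theorem kappa_pos (hp : 0 < p) : 0 < kappa p := by unfold kappa; positivity

theorem h_pos (hp : 0 < p) : 0 < h p := by unfold h; positivity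

theorem A0_ne_zero (hp : 0 < p) (ν : ℂ) : A0 p ν ≠ 0 := by
  have h1 : (kappa p : ℂ) ≠ 0 := by exact_mod_cast (kappa_pos hp).ne'
  have h2 : (p : ℂ) ≠ 0 := by exact_mod_cast hp.ne'
  have h3 : ((2 * Real.pi) ^ (-(1 / 2) : ℝ) : ℝ) ≠ 0 := by positivity
  unfold A0
  refine mul_ne_zero (mul_ne_zero (by exact_mod_cast h3) ?_) ?_ <;>
  simp [Complex.cpow_eq_zero_iff, h1, h2]

/-- The base `h κ^κ` of the inverse factorial expansion. -/
def expBase (p : ℝ) : ℝ := h p * kappa p ^ kappa p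

theorem expBase_pos (hp : 0 < p) : 0 < expBase p := by
  have := h_pos hp
  have := kappa_pos hp
  unfold expBase; positivity

theorem log_expBase (hp : 0 < p) :
    Real.log (expBase p) = Real.log p / p + kappa p * Real.log (kappa p) := by
  have h1 := h_pos hp
  have h2 := kappa_pos hp
  rw [expBase, Real.log_mul h1.ne' (by positivity), Real.log_rpow h2, h, Real.log_rpow hp]
  ring

/-- The terms in `s log s` and `log s` cancel against those of `Γ(κs+ϑ)`, because `1 + 1/p = κ` and
`-1/2 + (ν/p - 1/2) = ϑ - 1/2`. The linear terms leave exactly `-s log(h κ^κ)`, and the rest is the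
exponential of an expansion in `1/s`. -/
theorem exists_Gamma_mul_Gamma_eq (hp : 0 < p) (ν : ℂ) :
    ∃ f : ℂ → ℂ, HasInvExpansion f ∧ ∀ η : ℝ, 0 < η → ∀ᶠ s in sectorAtTop η,
      Complex.Gamma s * Complex.Gamma ((s + ν) / p)
        = 2 * Real.pi * A0 p ν * (expBase p : ℂ) ^ (-s)
          * (f s * Complex.Gamma (kappa p * s + theta p ν)) := by
  obtain ⟨m₁, hm₁, h₁⟩ := exists_Gamma_affine_eq one_pos 0
  obtain ⟨m₂, hm₂, h₂⟩ := exists_Gamma_affine_eq (one_div_pos.mpr hp) (ν / p)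
  obtain ⟨m₃, hm₃, h₃⟩ := exists_Gamma_affine_eq (kappa_pos hp) (theta p ν)
  have hA : 2 * (Real.pi : ℂ) * A0 p ν ≠ 0 := by
    have : (Real.pi : ℂ) ≠ 0 := by exact_mod_cast Real.pi_ne_zero
    exact mul_ne_zero (mul_ne_zero two_ne_zero this) (A0_ne_zero hp ν)
  have hpc : (p : ℂ) ≠ 0 := by exact_mod_cast hp.ne'
  have hK : ((expBase p : ℝ) : ℂ) ≠ 0 := by exact_mod_cast (expBase_pos hp).ne'
  set lp : ℂ := (Real.log p : ℂ) with hlp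
  set lk : ℂ := (Real.log (kappa p) : ℂ) with hlk
  -- The part of the exponents that does not depend on `s`: the logarithm of `p^(-ϑ) κ^(1/2-ϑ)`.
  set C : ℂ := -(ν / p - 1 / 2) * lp - (theta p ν - 1 / 2) * lk with hC
  refine ⟨fun s => ((√(2 * Real.pi) : ℝ) : ℂ) / (2 * Real.pi * A0 p ν)
      * Complex.exp (m₁ s + (m₂ s + (-1 * m₃ s + C))),
    (hasInvExpansion_const _).mul (hm₁.add (hm₂.add
      (((hasInvExpansion_const _).mul hm₃).add (hasInvExpansion_const C)))).exp,
    fun η hη => ?_⟩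
  filter_upwards [h₁ η hη, h₂ η hη, h₃ η hη] with s e1 e2 e3
  have a1 : ((1 : ℝ) : ℂ) * s + 0 = s := by simp
  have a2 : ((1 / p : ℝ) : ℂ) * s + ν / p = (s + ν) / p := by push_cast; ring
  rw [a1] at e1
  rw [a2] at e2
  rw [e1, e2, e3]
  have hpow : (expBase p : ℂ) ^ (-s) = Complex.exp (-(lp / p + kappa p * lk) * s) := by
    rw [Complex.cpow_def_of_ne_zero hK, ← Complex.ofReal_log (expBase_pos hp).le, log_expBase hp]
    congr 1
    push_cast
    ring
  rw [hpow]
  have l1 : (Real.log (1 / p) : ℂ) = -lp := by rw [one_div, Real.log_inv]; push_cast; rfl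
  rw [l1]
  have e4 : ∀ a b c d x y z w : ℂ, a ≠ 0 → z + w = x + y + d →
      (b * Complex.exp z) * (b * Complex.exp w)
        = a * Complex.exp x * ((b / a * Complex.exp y) * (b * Complex.exp d)) := by
    intro a b c d x y z w ha hz
    have := congrArg Complex.exp hz
    rw [Complex.exp_add, Complex.exp_add, Complex.exp_add] at this
    field_simp
    linear_combination (b ^ 2) * this
  refine e4 _ _ 0 _ _ _ _ _ hA ?_
  have hk : (kappa p : ℂ) = 1 + 1 / p := by
    rw [kappa]; push_cast; field_simp
  simp only [hC, hk, theta, Real.log_one]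
  push_cast
  ring

/-- Put `z = κs + ϑ`. Since `Γ(z-j) = (z-j-1) Γ(z-j-1)`, one has `G_j Γ(z-j) = L_j Γ(z-j) + G_(j+1)
Γ(z-j-1)` with `G_(j+1) = (G_j - L_j)(z-j-1)`. Each `G_M` again has an expansion in `1/s`, hence is
bounded, and this is the `O(1)` of the remainder. -/
theorem exists_isInverseFactorialExpansion (hp : 0 < p) (ν : ℂ) :
    ∃ c : ℕ → ℂ, IsInverseFactorialExpansion p ν c := by
  obtain ⟨f, hf, hfe⟩ := exists_Gamma_mul_Gamma_eq hp ν
  have step : ∀ (g : {g : ℂ → ℂ // HasInvExpansion g}) (j : ℕ), ∃ L : ℂ,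
      HasInvExpansion fun s => (g.1 s - L) * (kappa p * s + (theta p ν - j - 1)) :=
    fun g j => g.2.exists_sub_mul_affine _ _
  choose L hL using step
  set G : ℕ → {g : ℂ → ℂ // HasInvExpansion g} :=
    fun j => Nat.rec ⟨f, hf⟩ (fun j g => ⟨_, hL g j⟩) j with hG
  have hG0 : (G 0).1 = f := rfl
  have hGs : ∀ j s, (G (j + 1)).1 s
      = ((G j).1 s - L (G j) j) * (kappa p * s + (theta p ν - j - 1)) := fun j s => rfl
  have hne : ∀ η : ℝ, 0 < η → ∀ j : ℕ,
      ∀ᶠ s in sectorAtTop η, kappa p * s + theta p ν - j - 1 ≠ 0 := fun η hη j => by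
    filter_upwards [(tendsto_affine_sectorAtTop hη (kappa_pos hp) (theta p ν - j - 1)).eventually
      (eventually_ne_zero_sectorAtTop _)] with s hs h
    apply hs
    rw [← h]; ring
  have key : ∀ η : ℝ, 0 < η → ∀ M : ℕ, ∀ᶠ s in sectorAtTop η,
      f s * Complex.Gamma (kappa p * s + theta p ν)
        = ∑ j ∈ Finset.range M, L (G j) j * Complex.Gamma (kappa p * s + theta p ν - j)
          + (G M).1 s * Complex.Gamma (kappa p * s + theta p ν - M) := fun η hη M => by
    induction M with
    | zero => exact Eventually.of_forall fun s => by simp [hG0]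
    | succ M ih =>
      filter_upwards [ih, hne η hη M] with s h1 h2
      rw [h1, Finset.sum_range_succ, hGs, add_assoc]
      congr 1
      have h3 := Complex.Gamma_add_one _ h2
      rw [sub_add_cancel] at h3
      have e : kappa p * s + theta p ν - ((M + 1 : ℕ) : ℂ) = kappa p * s + theta p ν - M - 1 := by
        push_cast; ring
      rw [e, h3]
      ring
  refine ⟨fun j => (-1) ^ j * L (G j) j, fun M δ hδ => ?_⟩
  obtain ⟨η, hη, hle⟩ := abs_arg_le_subset_sector hδ
  refine IsBigO.mono ?_ hle
  have h1 := (isBigO_refl (fun s : ℂ => 2 * (Real.pi : ℂ) * A0 p ν * (expBase p : ℂ) ^ (-s)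
    * Complex.Gamma (kappa p * s + theta p ν - M)) (sectorAtTop η)).mul ((G M).2.isBigO_one hη)
  simp only [mul_one] at h1
  refine h1.congr' ?_ EventuallyEq.rfl
  filter_upwards [hfe η hη, key η hη M] with s e1 e2
  rw [e1, e2]
  have : ∀ j : ℕ, (-1 : ℂ) ^ j * ((-1) ^ j * L (G j) j) = L (G j) j := fun j => by
    rw [← mul_assoc, ← mul_pow]; simp
  simp only [this]
  rw [expBase]
  ring

/-! ### The saddle point -/

theorem hasDerivAt_psi (hp : 0 < p) {t : ℂ} (ht : t ∈ Complex.slitPlane) :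
    HasDerivAt (psi p) (t ^ ((p : ℂ) - 1) - (t ^ 2)⁻¹) t := by
  have hpc : (p : ℂ) ≠ 0 := by exact_mod_cast hp.ne'
  have h0 := Complex.slitPlane_ne_zero ht
  have h1 := (((hasDerivAt_id t).cpow_const (c := (p : ℂ)) ht).div_const (p : ℂ)).add
    (hasDerivAt_inv h0)
  have e : psi p = (fun x => id x ^ (p : ℂ) / (p : ℂ)) + Inv.inv := by
    ext x; simp [psi]
  rw [e]
  convert! h1 using 1
  simp only [id]
  field_simp
  ring

theorem analyticAt_psi {t : ℂ} (ht : t ∈ Complex.slitPlane) : AnalyticAt ℂ (psi p) t := by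
  have h0 := Complex.slitPlane_ne_zero ht
  unfold psi
  exact ((analyticAt_id.cpow analyticAt_const ht).div_const).add
    (analyticAt_const.div analyticAt_id h0)

theorem deriv_psi_one (hp : 0 < p) : deriv (psi p) 1 = 0 := by
  rw [(hasDerivAt_psi hp (by simp)).deriv]
  simp

theorem iteratedDeriv_two_psi_one (hp : 0 < p) : iteratedDeriv 2 (psi p) 1 = p + 1 := by
  rw [iteratedDeriv_succ, iteratedDeriv_one]
  have h1 : deriv (psi p) =ᶠ[𝓝 1] fun t => t ^ ((p : ℂ) - 1) - (t ^ 2)⁻¹ := by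
    filter_upwards [Complex.isOpen_slitPlane.mem_nhds (by simp : (1 : ℂ) ∈ Complex.slitPlane)]
      with t ht
    exact (hasDerivAt_psi hp ht).deriv
  rw [h1.deriv_eq]
  have h2 := ((hasDerivAt_id (1 : ℂ)).cpow_const (c := (p : ℂ) - 1) (by simp)).sub
    (((hasDerivAt_id (1 : ℂ)).fun_pow 2).fun_inv (by simp))
  refine h2.deriv.trans ?_
  simp
  ring

theorem psi_one (hp : 0 < p) : psi p 1 = kappa p := by
  have hpc : (p : ℂ) ≠ 0 := by exact_mod_cast hp.ne'
  simp only [psi, kappa, Complex.one_cpow]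
  push_cast
  field_simp
  ring

theorem exists_local_inverse {f : ℂ → ℂ} {a : ℂ} (hf : AnalyticAt ℂ f a) (hf' : deriv f a ≠ 0) :
    ∃ r : ℂ → ℂ, AnalyticAt ℂ r (f a) ∧ r (f a) = a ∧ deriv r (f a) = (deriv f a)⁻¹ ∧
      ∀ᶠ x in 𝓝 (f a), f (r x) = x := by
  refine ⟨hf.hasStrictDerivAt.localInverse _ _ _ hf', hf.analyticAt_localInverse hf',
    HasStrictFDerivAt.localInverse_apply_image .., ?_,
    hf.hasStrictDerivAt.eventually_right_inverse hf'⟩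
  exact (hf.hasStrictDerivAt.to_localInverse hf').hasDerivAt.deriv

/-- `ψ - ψ(1)` has a double zero at `1`, so it is `(t-1)² g(t)/2` with `g` analytic and `g(1) = p+1
> 0`. Then `W = (t-1) √g` satisfies `W²/2 = ψ - ψ(1)` and `W'(1) = √(p+1) ≠ 0`, and `τ` is its local
inverse. -/
theorem exists_isSaddleInverse (hp : 0 < p) : ∃ τ : ℂ → ℂ, IsSaddleInverse p τ := by
  have hψ : AnalyticAt ℂ (psi p) 1 := analyticAt_psi (by simp)
  set g : ℂ → ℂ := fun t => 2 * dslope (dslope (psi p) 1) 1 t with hg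
  have hga : AnalyticAt ℂ g 1 :=
    analyticAt_const.mul (analyticAt_dslope (analyticAt_dslope hψ))
  have hg1 : g 1 = p + 1 := by
    simp only [hg]
    rw [dslope_dslope_same hψ, iteratedDeriv_two_psi_one hp]
    ring
  have hslit : g 1 ∈ Complex.slitPlane := by
    rw [hg1]
    left
    simp only [Complex.add_re, Complex.ofReal_re, Complex.one_re]
    positivity
  have hgψ : ∀ t, (t - 1) ^ 2 * g t = 2 * (psi p t - psi p 1) := fun t => by
    have e1 := sub_smul_dslope (psi p) 1 t
    have e2 := sub_smul_dslope (dslope (psi p) 1) 1 t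
    rw [dslope_same, deriv_psi_one hp, sub_zero] at e2
    simp only [smul_eq_mul] at e1 e2
    rw [← e1, ← e2]
    simp only [hg]; ring
  set W : ℂ → ℂ := fun t => (t - 1) * g t ^ (1 / 2 : ℂ) with hW
  have hsq : AnalyticAt ℂ (fun t => g t ^ (1 / 2 : ℂ)) 1 := hga.cpow analyticAt_const hslit
  have hWa : AnalyticAt ℂ W 1 := by fun_prop
  have hW1 : W 1 = 0 := by simp [hW]
  have hsqrt : g 1 ^ (1 / 2 : ℂ) = ((Real.sqrt (p + 1) : ℝ) : ℂ) := by
    rw [hg1, Real.sqrt_eq_rpow, Complex.ofReal_cpow (by positivity)]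
    push_cast; rfl
  have hWd : deriv W 1 = ((Real.sqrt (p + 1) : ℝ) : ℂ) := by
    have h1 := ((hasDerivAt_id (1 : ℂ)).sub_const 1).mul hsq.differentiableAt.hasDerivAt
    refine h1.deriv.trans ?_
    simp only [id, sub_self, zero_mul, add_zero, one_mul, hsqrt]
  have hne : ((Real.sqrt (p + 1) : ℝ) : ℂ) ≠ 0 := by
    have : Real.sqrt (p + 1) ≠ 0 := by positivity
    exact_mod_cast this
  obtain ⟨τ, h1, h2, h3, h4⟩ := exists_local_inverse hWa (by rwa [hWd])
  rw [hW1] at h1 h2 h3 h4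
  refine ⟨τ, h1, h2, ?_, ?_⟩
  · rw [h3, hWd]; push_cast; rw [one_div]
  · have hτ : Tendsto τ (𝓝 0) (𝓝 1) := by simpa [h2] using h1.continuousAt.tendsto
    filter_upwards [h4] with w hw
    have : w ^ 2 = (τ w - 1) ^ 2 * g (τ w) := by
      conv_lhs => rw [← hw]
      simp only [hW, mul_pow]
      rw [← Complex.cpow_nat_mul]
      norm_num
    rw [this, hgψ]
    ring

/-- The phase on the positive real axis. -/
def realPsi (p t : ℝ) : ℝ := t ^ p / p + 1 / t

theorem psi_ofReal {t : ℝ} (ht : 0 ≤ t) : psi p (t : ℂ) = (realPsi p t : ℂ) := by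
  simp only [psi, realPsi]
  push_cast
  rw [Complex.ofReal_cpow ht]

theorem realPsi_one (hp : 0 < p) : realPsi p 1 = kappa p := by
  simp only [realPsi, kappa, Real.one_rpow]
  field_simp
  ring

theorem hasDerivAt_realPsi (hp : 0 < p) {t : ℝ} (ht : 0 < t) :
    HasDerivAt (realPsi p) (t⁻¹ ^ 2 * (t ^ (p + 1) - 1)) t := by
  have h1 := ((Real.hasDerivAt_rpow_const (p := p) (Or.inl ht.ne')).div_const p).add
    (hasDerivAt_inv ht.ne')
  have e : realPsi p = (fun x => x ^ p / p) + Inv.inv := by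
    ext x; simp [realPsi]
  rw [e]
  convert! h1 using 1
  have : t ^ (p + 1) = t ^ (p - 1) * t ^ 2 := by
    rw [← Real.rpow_natCast, ← Real.rpow_add ht]; congr 1; push_cast; ring
  rw [this]
  field_simp
  ring

theorem strictAntiOn_realPsi (hp : 0 < p) : StrictAntiOn (realPsi p) (Set.Ioc 0 1) := by
  refine strictAntiOn_of_deriv_neg (convex_Ioc 0 1)
    (fun t ht => (hasDerivAt_realPsi hp ht.1).continuousAt.continuousWithinAt) fun t ht => ?_
  rw [interior_Ioc] at ht
  rw [(hasDerivAt_realPsi hp ht.1).deriv]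
  have h1 : t ^ (p + 1) < 1 := Real.rpow_lt_one ht.1.le ht.2 (by linarith)
  have h2 : 0 < t⁻¹ ^ 2 := by have := ht.1; positivity
  nlinarith

theorem strictMonoOn_realPsi (hp : 0 < p) : StrictMonoOn (realPsi p) (Set.Ici 1) := by
  refine strictMonoOn_of_deriv_pos (convex_Ici 1)
    (fun t (ht : 1 ≤ t) => (hasDerivAt_realPsi hp (by linarith)).continuousAt.continuousWithinAt)
    fun t ht => ?_
  rw [interior_Ici] at ht
  have ht : 1 < t := ht
  rw [(hasDerivAt_realPsi hp (by linarith)).deriv]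
  have h1 : 1 < t ^ (p + 1) := Real.one_lt_rpow ht (by linarith)
  have h2 : 0 < t⁻¹ ^ 2 := by positivity
  nlinarith

theorem kappa_le_realPsi (hp : 0 < p) {t : ℝ} (ht : 0 < t) : kappa p ≤ realPsi p t := by
  rw [← realPsi_one hp]
  rcases le_total t 1 with h | h
  · exact (strictAntiOn_realPsi hp).antitoneOn ⟨ht, h⟩ ⟨one_pos, le_rfl⟩ h
  · exact (strictMonoOn_realPsi hp).monotoneOn (Set.mem_Ici.mpr le_rfl) h h

theorem exists_kappa_add_le_realPsi (hp : 0 < p) {ε : ℝ} (hε : 0 < ε) (hε1 : ε < 1) :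
    ∃ d > 0, ∀ t > 0, t ∉ Set.Ioc (1 - ε) (1 + ε) → kappa p + d ≤ realPsi p t := by
  have h1 : kappa p < realPsi p (1 - ε) := by
    rw [← realPsi_one hp]
    exact strictAntiOn_realPsi hp ⟨by linarith, by linarith⟩ ⟨one_pos, le_rfl⟩ (by linarith)
  have h2 : kappa p < realPsi p (1 + ε) := by
    rw [← realPsi_one hp]
    exact strictMonoOn_realPsi hp (Set.mem_Ici.mpr le_rfl) (Set.mem_Ici.mpr (by linarith))
      (by linarith)
  refine ⟨min (realPsi p (1 - ε)) (realPsi p (1 + ε)) - kappa p,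
    sub_pos.mpr (lt_min h1 h2), fun t ht hn => ?_⟩
  rw [add_sub_cancel]
  rw [Set.mem_Ioc, not_and_or, not_lt, not_le] at hn
  rcases hn with hn | hn
  · exact (min_le_left _ _).trans ((strictAntiOn_realPsi hp).antitoneOn ⟨ht, by linarith⟩
      ⟨by linarith, by linarith⟩ hn)
  · exact (min_le_right _ _).trans ((strictMonoOn_realPsi hp).monotoneOn
      (Set.mem_Ici.mpr (by linarith)) (Set.mem_Ici.mpr (by linarith)) hn.le)

/-- Near the saddle, the phase is `κ + v^2/2` for a real change of variable `v` inverse to `τ`. -/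
theorem IsSaddleInverse.exists_real_variable (hp : 0 < p) {τ : ℂ → ℂ} (hτ : IsSaddleInverse p τ)
    {r : ℝ} (hr : 0 < r) :
    ∃ (ε : ℝ) (v v' : ℝ → ℝ), 0 < ε ∧ ε < 1 ∧
      (∀ t ∈ Set.Icc (1 - ε) (1 + ε), HasDerivAt v (v' t) t ∧ τ (v t) = t ∧
        realPsi p t = kappa p + v t ^ 2 / 2 ∧ deriv τ (v t) * v' t = 1) ∧
      ContinuousOn v' (Set.Icc (1 - ε) (1 + ε)) ∧ MonotoneOn v (Set.Icc (1 - ε) (1 + ε)) ∧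
      -r < v (1 - ε) ∧ v (1 - ε) < 0 ∧ 0 < v (1 + ε) ∧ v (1 + ε) < r := by
  have hs : 0 < Real.sqrt (p + 1) := by positivity
  have hne : deriv τ 0 ≠ 0 := by
    rw [hτ.deriv_zero]
    have : 1 / Real.sqrt (p + 1) ≠ 0 := by positivity
    exact_mod_cast this
  obtain ⟨V, hV, hV0, hVd, hVr⟩ := exists_local_inverse hτ.analytic hne
  rw [hτ.map_zero] at hV hV0 hVd hVr
  have hVd' : deriv V 1 = (Real.sqrt (p + 1) : ℝ) := by
    rw [hVd, hτ.deriv_zero]; push_cast; rw [one_div, inv_inv]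
  have hVt : Tendsto V (𝓝 1) (𝓝 0) := by simpa [hV0] using hV.continuousAt.tendsto
  have hof : Tendsto (fun t : ℝ => (t : ℂ)) (𝓝 1) (𝓝 1) := by
    simpa using (Complex.continuous_ofReal.tendsto 1)
  set v : ℝ → ℝ := fun t => (V t).re with hv
  set v' : ℝ → ℝ := fun t => (deriv V t).re with hv'
  have hcd : ContinuousAt (deriv V) 1 := hV.deriv.continuousAt
  have hv'c : ∀ᶠ t : ℝ in 𝓝 1, ContinuousAt v' t ∧ 0 < v' t := by
    have h1 : ∀ᶠ z in 𝓝 (1 : ℂ), ContinuousAt (deriv V) z := by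
      filter_upwards [hV.eventually_analyticAt] with z hz
      exact hz.deriv.continuousAt
    have h2 : Tendsto v' (𝓝 1) (𝓝 (Real.sqrt (p + 1))) := by
      have := (Complex.continuous_re.tendsto _).comp (hcd.tendsto.comp hof)
      rw [hVd'] at this
      simpa [Function.comp_def, hv'] using this
    filter_upwards [hof.eventually h1, h2.eventually_const_lt hs] with t ht1 ht2
    refine ⟨?_, ht2⟩
    exact Complex.continuous_re.continuousAt.comp
      (ht1.comp (f := fun t : ℝ => (t : ℂ)) Complex.continuous_ofReal.continuousAt)
  have hmain : ∀ᶠ t : ℝ in 𝓝 1, HasDerivAt v (v' t) t ∧ τ (v t) = t ∧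
      realPsi p t = kappa p + v t ^ 2 / 2 := by
    filter_upwards [hof.eventually hV.eventually_analyticAt, hof.eventually hVr,
      hof.eventually (hVt.eventually hτ.eqn), eventually_gt_nhds (zero_lt_one)]
      with t h1 h2 h3 h4
    have hd : HasDerivAt v (v' t) t := h1.differentiableAt.hasDerivAt.real_of_complex
    rw [h2, psi_one hp, psi_ofReal h4.le, ← Complex.ofReal_sub] at h3
    have h5 : V t ^ 2 = ((2 * (realPsi p t - kappa p) : ℝ) : ℂ) := by
      rw [Complex.ofReal_mul, ← h3]; push_cast; ring
    -- The square of `V t` is real, and nonnegative because `κ` is the minimum of the phase; so `V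
    -- t` itself is real.
    have him : (V t).im = 0 := by
      have i1 := congrArg Complex.im h5
      have i2 := congrArg Complex.re h5
      rw [Complex.ofReal_im, sq, Complex.mul_im] at i1
      rw [Complex.ofReal_re, sq, Complex.mul_re] at i2
      have i3 := kappa_le_realPsi hp h4
      by_contra h0
      have i4 : (V t).re = 0 := by
        have : (V t).re * (V t).im = 0 := by linarith
        exact (mul_eq_zero.mp this).resolve_right h0
      rw [i4] at i2
      have := mul_self_pos.mpr h0
      nlinarith
    have hreal : (v t : ℂ) = V t := by
      apply Complex.ext <;> simp [hv, him]
    refine ⟨hd, by rw [hreal, h2], ?_⟩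
    have h6 : ((v t ^ 2 : ℝ) : ℂ) = ((2 * (realPsi p t - kappa p) : ℝ) : ℂ) := by
      rw [← h5, ← hreal]; push_cast; rfl
    have h7 : v t ^ 2 = 2 * (realPsi p t - kappa p) := by exact_mod_cast h6
    linarith
  have hv1 : v 1 = 0 := by simp [hv, hV0]
  have hvc : ContinuousAt v 1 := hmain.self_of_nhds.1.continuousAt
  have hvt : Tendsto v (𝓝 1) (𝓝 0) := by simpa [hv1] using hvc.tendsto
  have hder : ∀ᶠ t : ℝ in 𝓝 1, deriv τ (v t) * v' t = 1 := by
    have h1 : ∀ᶠ t : ℝ in 𝓝 1, AnalyticAt ℂ τ (v t : ℂ) := by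
      have h2 : Tendsto (fun t => (v t : ℂ)) (𝓝 1) (𝓝 0) := by
        simpa [Function.comp_def] using (Complex.continuous_ofReal.tendsto 0).comp hvt
      exact h2.eventually hτ.analytic.eventually_analyticAt
    filter_upwards [h1, hmain.eventually_nhds] with t ht1 ht2
    have h3 : HasDerivAt (fun s : ℝ => τ (v s)) (deriv τ (v t) * v' t) t := by
      have := ht2.self_of_nhds.1.ofReal_comp
      exact ht1.differentiableAt.hasDerivAt.comp t this
    have h4 : HasDerivAt (fun s : ℝ => τ (v s)) 1 t := by
      refine (HasDerivAt.ofReal_comp (hasDerivAt_id t)).congr_of_eventuallyEq ?_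
      filter_upwards [ht2] with s hs
      exact hs.2.1
    exact h3.unique h4
  have hsmall : ∀ᶠ t : ℝ in 𝓝 1, -r < v t ∧ v t < r :=
    (hvt.eventually_const_lt (by linarith)).and (hvt.eventually_lt_const hr)
  obtain ⟨ε₀, hε₀, hball⟩ := Metric.eventually_nhds_iff.mp
    (hmain.and (hder.and (hv'c.and hsmall)))
  -- Halving places the closed interval inside the open ball of radius `ε₀` and gives `ε < 1`, so
  -- that the interval stays in `t > 0`.
  set ε := min ε₀ 1 / 2 with hε
  have hεpos : 0 < ε := by positivity
  have hm1 : min ε₀ 1 ≤ 1 := min_le_right _ _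
  have hm2 : min ε₀ 1 ≤ ε₀ := min_le_left _ _
  have hIcc : ∀ t ∈ Set.Icc (1 - ε) (1 + ε), dist t 1 < ε₀ := fun t ht => by
    rw [Real.dist_eq, abs_lt]
    constructor <;> linarith [ht.1, ht.2]
  have hmono : StrictMonoOn v (Set.Icc (1 - ε) (1 + ε)) := by
    refine strictMonoOn_of_deriv_pos (convex_Icc _ _)
      (fun t ht => (hball (hIcc t ht)).1.1.continuousAt.continuousWithinAt) fun t ht => ?_
    have ht' := interior_subset ht
    rw [(hball (hIcc t ht')).1.1.deriv]
    exact (hball (hIcc t ht')).2.2.1.2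
  have m1 : (1 - ε) ∈ Set.Icc (1 - ε) (1 + ε) := ⟨le_rfl, by linarith⟩
  have m2 : (1 + ε) ∈ Set.Icc (1 - ε) (1 + ε) := ⟨by linarith, le_rfl⟩
  have m3 : (1 : ℝ) ∈ Set.Icc (1 - ε) (1 + ε) := ⟨by linarith, by linarith⟩
  refine ⟨ε, v, v', hεpos, by linarith, fun t ht => ?_, fun t ht => ?_, hmono.monotoneOn,
    (hball (hIcc _ m1)).2.2.2.1, ?_, ?_, (hball (hIcc _ m2)).2.2.2.2⟩
  · obtain ⟨⟨a, b, c⟩, d, -⟩ := hball (hIcc t ht)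
    exact ⟨a, b, c, d⟩
  · exact (hball (hIcc t ht)).2.2.1.1.continuousWithinAt
  · rw [← hv1]; exact hmono m1 m3 (by linarith)
  · rw [← hv1]; exact hmono m3 m2 (by linarith)

/-! ### Laplace's method -/

theorem norm_cexp_neg_mul_ofReal (X : ℂ) (r : ℝ) :
    ‖Complex.exp (-X * (r : ℂ))‖ = Real.exp (-X.re * r) := by
  rw [Complex.norm_exp]; simp

/-- The filter of large `X` with `Re X ≥ c |X|`. -/
def coneAtTop (c : ℝ) : Filter ℂ := Bornology.cobounded ℂ ⊓ 𝓟 {X : ℂ | c * ‖X‖ ≤ X.re}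

theorem tendsto_norm_coneAtTop (c : ℝ) : Tendsto (fun X : ℂ => ‖X‖) (coneAtTop c) atTop :=
  tendsto_norm_cobounded_atTop.mono_left inf_le_left

theorem eventually_coneAtTop (c : ℝ) : ∀ᶠ X in coneAtTop c, c * ‖X‖ ≤ X.re :=
  mem_inf_of_right (mem_principal_self _)

theorem tendsto_re_coneAtTop {c : ℝ} (hc : 0 < c) :
    Tendsto (fun X : ℂ => X.re) (coneAtTop c) atTop :=
  tendsto_atTop_mono' _ (eventually_coneAtTop c) ((tendsto_norm_coneAtTop c).const_mul_atTop hc)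

/-- One unit of `Re X` is kept for integrability; the remaining `Re X - 1` yields decay through `φ ≥
d`. -/
theorem norm_setIntegral_mul_cexp_le {f : ℝ → ℂ} {φ : ℝ → ℝ} {S : Set ℝ} (hS : MeasurableSet S)
    {d : ℝ} (hφ : ∀ t ∈ S, d ≤ φ t)
    (hint : IntegrableOn (fun t => ‖f t‖ * Real.exp (-φ t)) S) {X : ℂ} (hX : 1 ≤ X.re) :
    ‖∫ t in S, f t * Complex.exp (-X * (φ t : ℂ))‖
      ≤ (∫ t in S, ‖f t‖ * Real.exp (-φ t)) * Real.exp (-(X.re - 1) * d) := by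
  rw [← integral_mul_const]
  refine norm_integral_le_of_norm_le (hint.mul_const _) ?_
  filter_upwards [ae_restrict_mem hS] with t ht
  rw [norm_mul, norm_cexp_neg_mul_ofReal, mul_assoc, ← Real.exp_add]
  gcongr
  nlinarith [hφ t ht]

theorem setIntegral_mul_cexp_isBigO {f : ℝ → ℂ} {φ : ℝ → ℝ} {S : Set ℝ} (hS : MeasurableSet S)
    {d : ℝ} (hd : 0 < d) (hφ : ∀ t ∈ S, d ≤ φ t)
    (hint : IntegrableOn (fun t => ‖f t‖ * Real.exp (-φ t)) S) {c : ℝ} (hc : 0 < c) (σ : ℝ) :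
    (fun X : ℂ => ∫ t in S, f t * Complex.exp (-X * (φ t : ℂ)))
      =O[coneAtTop c] fun X => ‖X‖ ^ σ := by
  have h1 : (fun X : ℂ => Real.exp (-(d * c) * ‖X‖)) =O[coneAtTop c] fun X => ‖X‖ ^ σ :=
    (isLittleO_exp_neg_mul_rpow_atTop (mul_pos hd hc) σ).isBigO.comp_tendsto
      (tendsto_norm_coneAtTop c)
  refine IsBigO.trans (IsBigO.of_bound
    ((∫ t in S, ‖f t‖ * Real.exp (-φ t)) * Real.exp d) ?_) h1
  filter_upwards [(tendsto_re_coneAtTop hc).eventually_ge_atTop 1, eventually_coneAtTop c]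
    with X hX hX2
  refine (norm_setIntegral_mul_cexp_le hS hφ hint hX).trans ?_
  rw [Real.norm_of_nonneg (Real.exp_pos _).le, mul_assoc, ← Real.exp_add]
  refine mul_le_mul_of_nonneg_left (Real.exp_le_exp.mpr ?_)
    (integral_nonneg fun t => by positivity)
  nlinarith

theorem integrable_pow_mul_gaussian (n : ℕ) {X : ℂ} (hX : 0 < X.re) :
    Integrable fun w : ℝ => (w : ℂ) ^ n * Complex.exp (-X * ((w ^ 2 / 2 : ℝ) : ℂ)) := by
  have h := (integrable_rpow_mul_exp_neg_mul_sq (b := X.re / 2) (by positivity)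
    (s := n) (by have : (0 : ℝ) ≤ n := n.cast_nonneg
                 linarith))
  refine h.mono (Continuous.aestronglyMeasurable (by fun_prop)) (Eventually.of_forall fun w => ?_)
  rw [norm_mul, norm_cexp_neg_mul_ofReal, norm_pow, Complex.norm_real, norm_mul, Real.rpow_natCast,
    norm_pow, Real.norm_of_nonneg (Real.exp_pos _).le]
  refine le_of_eq ?_
  congr 2
  ring

theorem integral_odd_pow_mul_gaussian (k : ℕ) (X : ℂ) :
    ∫ w : ℝ, (w : ℂ) ^ (2 * k + 1) * Complex.exp (-X * ((w ^ 2 / 2 : ℝ) : ℂ)) = 0 := by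
  have h := integral_neg_eq_self
    (fun w : ℝ => (w : ℂ) ^ (2 * k + 1) * Complex.exp (-X * ((w ^ 2 / 2 : ℝ) : ℂ))) volume
  have e : ∀ w : ℝ, (((-w : ℝ)) : ℂ) ^ (2 * k + 1) * Complex.exp (-X * (((-w) ^ 2 / 2 : ℝ) : ℂ))
      = -((w : ℂ) ^ (2 * k + 1) * Complex.exp (-X * ((w ^ 2 / 2 : ℝ) : ℂ))) := fun w => by
    rw [neg_sq]; push_cast
    rw [Odd.neg_pow ⟨k, rfl⟩]; ring
  simp only [e] at h
  rw [integral_neg] at h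
  exact self_eq_neg.mp h.symm

theorem halfPoch_zero : halfPoch 0 = 1 := by simp [halfPoch]

theorem halfPoch_succ (k : ℕ) : halfPoch (k + 1) = halfPoch k * (1 / 2 + k) := by
  simp [halfPoch, ascPochhammer_succ_eval]

/-- Integrating the derivative of `w^(2k+1) e^(-Xw²/2)` gives `(2k+1) I_(2k) = X I_(2k+2)`, whose
factor is `(2/X)(1/2 + k)`. -/
theorem integral_even_pow_mul_gaussian (k : ℕ) {X : ℂ} (hX : 0 < X.re) :
    ∫ w : ℝ, (w : ℂ) ^ (2 * k) * Complex.exp (-X * ((w ^ 2 / 2 : ℝ) : ℂ))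
      = halfPoch k * (2 / X) ^ k * (2 * Real.pi / X) ^ (1 / 2 : ℂ) := by
  have hX0 : X ≠ 0 := by rintro rfl; simp at hX
  induction k with
  | zero =>
    have h := integral_gaussian_complex (b := X / 2) (by simpa using hX)
    simp only [halfPoch_zero, mul_zero, pow_zero, one_mul]
    rw [show (2 * Real.pi / X : ℂ) = Real.pi / (X / 2) by field_simp, ← h]
    refine integral_congr_ae (Eventually.of_forall fun w => ?_)
    simp only
    congr 1
    push_cast; ring
  | succ k ih =>
    have hd : ∀ w : ℝ, HasDerivAt
        (fun w : ℝ => (w : ℂ) ^ (2 * k + 1) * Complex.exp (-X * ((w ^ 2 / 2 : ℝ) : ℂ)))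
        ((2 * k + 1) * ((w : ℂ) ^ (2 * k) * Complex.exp (-X * ((w ^ 2 / 2 : ℝ) : ℂ)))
          - X * ((w : ℂ) ^ (2 * (k + 1)) * Complex.exp (-X * ((w ^ 2 / 2 : ℝ) : ℂ)))) w := fun w => by
      have h1 : HasDerivAt (fun w : ℝ => (w : ℂ) ^ (2 * k + 1)) ((2 * k + 1) * (w : ℂ) ^ (2 * k)) w := by
        have := ((hasDerivAt_id w).ofReal_comp).fun_pow (2 * k + 1)
        simpa using this
      have h2 : HasDerivAt (fun w : ℝ => -X * ((w ^ 2 / 2 : ℝ) : ℂ)) (-X * w) w := by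
        have : HasDerivAt (fun w : ℝ => w ^ 2 / 2) w w := by
          have := ((hasDerivAt_id w).fun_pow 2).div_const 2
          simpa using this
        exact this.ofReal_comp.const_mul (-X)
      refine (h1.mul h2.cexp).congr_deriv ?_
      ring
    have i1 := integrable_pow_mul_gaussian (2 * k) hX
    have i2 := integrable_pow_mul_gaussian (2 * (k + 1)) hX
    have h3 := integral_eq_zero_of_hasDerivAt_of_integrable hd
      ((i1.const_mul _).sub (i2.const_mul _)) (integrable_pow_mul_gaussian (2 * k + 1) hX)
    rw [integral_sub (i1.const_mul _) (i2.const_mul _), integral_const_mul,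
      integral_const_mul, ih] at h3
    have h4 := sub_eq_zero.mp h3
    rw [halfPoch_succ, pow_succ]
    have h5 : ∀ a b : ℂ, a = X * b → b = a / X := fun a b h => by rw [h]; field_simp
    rw [h5 _ _ h4]
    field_simp
    ring

theorem integral_abs_pow_mul_gaussian_isBigO {c : ℝ} (hc : 0 < c) (M : ℕ) :
    (fun X : ℂ => ∫ w : ℝ, |w| ^ (2 * M) * Real.exp (-X.re * (w ^ 2 / 2)))
      =O[coneAtTop c] fun X => ‖X‖ ^ (-(M + 1 / 2) : ℝ) := by
  set D : ℝ := ‖halfPoch M‖ * 2 ^ M * (2 * Real.pi) ^ (1 / 2 : ℝ) with hD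
  refine IsBigO.of_bound (D * c ^ (-(M + 1 / 2) : ℝ)) ?_
  filter_upwards [(tendsto_re_coneAtTop hc).eventually_gt_atTop 0, eventually_coneAtTop c,
    (tendsto_norm_coneAtTop c).eventually_gt_atTop 0] with X hX hX2 hX3
  have h1 := integral_even_pow_mul_gaussian M (X := (X.re : ℂ)) (by simpa using hX)
  have e : ∀ w : ℝ, (w : ℂ) ^ (2 * M) * Complex.exp (-(X.re : ℂ) * ((w ^ 2 / 2 : ℝ) : ℂ))
      = ((|w| ^ (2 * M) * Real.exp (-X.re * (w ^ 2 / 2)) : ℝ) : ℂ) := fun w => by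
    rw [pow_mul |w|, sq_abs, ← pow_mul]; push_cast; rfl
  simp only [e] at h1
  rw [integral_complex_ofReal] at h1
  rw [← Complex.norm_real, h1]
  have e2 : ((2 : ℂ) * Real.pi / X.re) = ((2 * Real.pi / X.re : ℝ) : ℂ) := by push_cast; rfl
  have e3 : ((2 : ℂ) / X.re) = ((2 / X.re : ℝ) : ℂ) := by push_cast; rfl
  rw [norm_mul, norm_mul, norm_pow, e2, e3, Complex.norm_real,
    Complex.norm_cpow_eq_rpow_re_of_pos (by positivity), Real.norm_of_nonneg (by positivity),
    Real.norm_of_nonneg (by positivity)]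
  have e4 : (1 / 2 : ℂ).re = 1 / 2 := by norm_num
  rw [e4, mul_assoc D, ← Real.mul_rpow hc.le hX3.le]
  have h5 : X.re ^ (-(M + 1 / 2) : ℝ) ≤ (c * ‖X‖) ^ (-(M + 1 / 2) : ℝ) :=
    Real.rpow_le_rpow_of_nonpos (by positivity) hX2 (by
      have : (0 : ℝ) ≤ M := M.cast_nonneg
      linarith)
  calc _ = D * X.re ^ (-(M + 1 / 2) : ℝ) := by
        rw [neg_add, Real.rpow_add hX, Real.rpow_neg hX.le, Real.rpow_neg hX.le,
          Real.rpow_natCast, Real.div_rpow (by positivity) hX.le, div_pow]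
        simp only [hD]
        field_simp
    _ ≤ _ := by gcongr

/-- Laplace's method for `∫ H(w) exp (-X w^2/2) dw`. -/
theorem intervalIntegral_mul_gaussian_isBigO {H : ℝ → ℂ} {a : ℕ → ℂ} {A B C : ℝ} {M : ℕ}
    (hA : A < 0) (hB : 0 < B) (hH : ContinuousOn H (Set.Icc A B))
    (hHa : ∀ w ∈ Set.Icc A B, ‖H w - ∑ n ∈ Finset.range (2 * M), a n * (w : ℂ) ^ n‖
      ≤ C * |w| ^ (2 * M)) {c : ℝ} (hc : 0 < c) :
    (fun X : ℂ => (∫ w in A..B, H w * Complex.exp (-X * ((w ^ 2 / 2 : ℝ) : ℂ)))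
        - ∑ k ∈ Finset.range M, a (2 * k) * halfPoch k * (2 / X) ^ k
            * (2 * Real.pi / X) ^ (1 / 2 : ℂ))
      =O[coneAtTop c] fun X => ‖X‖ ^ (-(M + 1 / 2) : ℝ) := by
  have hAB : A ≤ B := by linarith
  -- A lower bound for the phase `w²/2` outside `(A, B]`. Completing the Taylor terms to the whole
  -- line therefore costs only an exponentially small error.
  set d : ℝ := min (A ^ 2 / 2) (B ^ 2 / 2) with hd
  have hdpos : 0 < d := by
    have : A ≠ 0 := hA.ne
    positivity
  have htail : ∀ n : ℕ,
      (fun X : ℂ => ∫ w in (Set.Ioc A B)ᶜ, (w : ℂ) ^ n * Complex.exp (-X * ((w ^ 2 / 2 : ℝ) : ℂ)))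
        =O[coneAtTop c] fun X => ‖X‖ ^ (-(M + 1 / 2) : ℝ) := fun n => by
    refine setIntegral_mul_cexp_isBigO measurableSet_Ioc.compl hdpos (fun w hw => ?_) ?_ hc _
    · rw [Set.mem_compl_iff, Set.mem_Ioc, not_and_or, not_lt, not_le] at hw
      rcases hw with hw | hw
      · exact (min_le_left _ _).trans (by nlinarith)
      · exact (min_le_right _ _).trans (by nlinarith)
    · have := (integrable_pow_mul_gaussian n (X := 1) (by simp)).norm.integrableOn
        (s := (Set.Ioc A B)ᶜ)
      refine this.congr_fun (fun w _ => ?_) measurableSet_Ioc.compl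
      simp only
      rw [norm_mul, norm_cexp_neg_mul_ofReal]
      simp
  have hrem : (fun X : ℂ => ∫ w in Set.Ioc A B,
      (H w - ∑ n ∈ Finset.range (2 * M), a n * (w : ℂ) ^ n)
        * Complex.exp (-X * ((w ^ 2 / 2 : ℝ) : ℂ)))
      =O[coneAtTop c] fun X => ‖X‖ ^ (-(M + 1 / 2) : ℝ) := by
    refine IsBigO.trans ?_ (integral_abs_pow_mul_gaussian_isBigO hc M)
    refine IsBigO.of_bound C ?_
    filter_upwards [(tendsto_re_coneAtTop hc).eventually_gt_atTop 0] with X hX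
    have hC : 0 ≤ C := by
      have := (norm_nonneg _).trans (hHa B ⟨hAB, le_rfl⟩)
      exact nonneg_of_mul_nonneg_left this (by rw [abs_of_pos hB]; positivity)
    have hi : Integrable fun w : ℝ => |w| ^ (2 * M) * Real.exp (-X.re * (w ^ 2 / 2)) := by
      refine (integrable_pow_mul_gaussian (2 * M) hX).norm.congr (Eventually.of_forall fun w => ?_)
      simp only
      rw [norm_mul, norm_cexp_neg_mul_ofReal, norm_pow, Complex.norm_real, Real.norm_eq_abs]
    rw [Real.norm_of_nonneg (integral_nonneg fun w => by positivity), ← integral_const_mul]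
    refine (norm_integral_le_of_norm_le ((hi.const_mul C).integrableOn (s := Set.Ioc A B)) ?_).trans
      (setIntegral_le_integral (hi.const_mul C) (Eventually.of_forall fun w => by positivity))
    filter_upwards [ae_restrict_mem measurableSet_Ioc] with w hw
    rw [norm_mul, norm_cexp_neg_mul_ofReal, ← mul_assoc]
    gcongr
    exact hHa w ⟨hw.1.le, hw.2⟩
  have hsum := hrem.sub (IsBigO.sum (s := Finset.range (2 * M))
    fun n _ => (htail n).const_mul_left (a n))
  refine hsum.congr' ?_ EventuallyEq.rfl
  filter_upwards [(tendsto_re_coneAtTop hc).eventually_gt_atTop 0] with X hX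
  have hcont : Continuous fun w : ℝ => Complex.exp (-X * ((w ^ 2 / 2 : ℝ) : ℂ)) := by fun_prop
  have j1 : IntegrableOn (fun w => H w * Complex.exp (-X * ((w ^ 2 / 2 : ℝ) : ℂ)))
      (Set.Ioc A B) :=
    ((hH.mul hcont.continuousOn).integrableOn_Icc).mono_set Set.Ioc_subset_Icc_self
  have j2 : ∀ n, IntegrableOn
      (fun w : ℝ => (w : ℂ) ^ n * Complex.exp (-X * ((w ^ 2 / 2 : ℝ) : ℂ))) (Set.Ioc A B) :=
    fun n => (integrable_pow_mul_gaussian n hX).integrableOn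
  -- The degrees are taken in pairs `2k`, `2k+1`; the odd moment vanishes by symmetry.
  have hfull : ∀ M : ℕ, ∑ n ∈ Finset.range (2 * M), a n * ∫ w : ℝ, (w : ℂ) ^ n
        * Complex.exp (-X * ((w ^ 2 / 2 : ℝ) : ℂ))
      = ∑ k ∈ Finset.range M, a (2 * k) * halfPoch k * (2 / X) ^ k
            * (2 * Real.pi / X) ^ (1 / 2 : ℂ) := fun M => by
    induction M with
    | zero => simp
    | succ M ih =>
      rw [show 2 * (M + 1) = 2 * M + 1 + 1 by ring, Finset.sum_range_succ, Finset.sum_range_succ,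
        Finset.sum_range_succ, ih, integral_odd_pow_mul_gaussian,
        integral_even_pow_mul_gaussian M hX]
      ring
  have hsplit : ∀ n : ℕ, ∫ w : ℝ, (w : ℂ) ^ n * Complex.exp (-X * ((w ^ 2 / 2 : ℝ) : ℂ))
      = (∫ w in Set.Ioc A B, (w : ℂ) ^ n * Complex.exp (-X * ((w ^ 2 / 2 : ℝ) : ℂ)))
        + ∫ w in (Set.Ioc A B)ᶜ, (w : ℂ) ^ n * Complex.exp (-X * ((w ^ 2 / 2 : ℝ) : ℂ)) :=
    fun n => (integral_add_compl measurableSet_Ioc (integrable_pow_mul_gaussian n hX)).symm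
  rw [Finset.sum_apply, ← hfull M, intervalIntegral.integral_of_le hAB]
  simp only [hsplit, sub_mul, Finset.sum_mul, mul_assoc]
  rw [integral_sub j1 (integrable_finsetSum _ fun n _ => (j2 n).const_mul _),
    integral_finsetSum _ fun n _ => (j2 n).const_mul _]
  simp only [integral_const_mul, mul_add, Finset.sum_add_distrib]
  ring

/-! ### Integrability -/

/-- Any real `σ` is allowed: `e^(-b/t) ≤ n! t^n / b^n` raises the exponent at `0` to `σ + n > -1`.
-/
theorem integrableOn_rpow_mul_exp (hp : 0 < p) (σ : ℝ) {a b : ℝ} (ha : 0 < a) (hb : 0 < b) :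
    IntegrableOn (fun t : ℝ => t ^ σ * Real.exp (-a * t ^ p - b / t)) (Set.Ioi 0) := by
  obtain ⟨n, hn⟩ := exists_nat_gt (-1 - σ)
  have h1 := (integrableOn_rpow_mul_exp_neg_mul_rpow (p := p) (s := σ + n) (b := a)
    (by linarith) hp ha).const_mul (n.factorial / b ^ n)
  refine h1.mono' ?_ ?_
  · refine ContinuousOn.aestronglyMeasurable (fun t ht => ContinuousAt.continuousWithinAt ?_)
      measurableSet_Ioi
    have ht' : t ≠ 0 := (Set.mem_Ioi.mp ht).ne'
    fun_prop (disch := simp [ht'])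
  · filter_upwards [ae_restrict_mem measurableSet_Ioi] with t ht
    have ht : 0 < t := ht
    have h2 := Real.pow_div_factorial_le_exp (b / t) (by positivity) n
    have h3 : Real.exp (-(b / t)) ≤ n.factorial / b ^ n * t ^ n := by
      rw [Real.exp_neg]
      refine (inv_anti₀ (by positivity) h2).trans (le_of_eq ?_)
      rw [div_pow]; field_simp
    rw [Real.norm_of_nonneg (by positivity), sub_eq_add_neg, Real.exp_add, Real.rpow_add ht,
      Real.rpow_natCast]
    calc t ^ σ * (Real.exp (-a * t ^ p) * Real.exp (-(b / t)))
        ≤ t ^ σ * (Real.exp (-a * t ^ p) * (n.factorial / b ^ n * t ^ n)) := by gcongr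
      _ = _ := by ring

theorem continuousOn_cpow_const (ν : ℂ) :
    ContinuousOn (fun t : ℝ => (t : ℂ) ^ ν) (Set.Ioi 0) := fun t ht =>
  (Complex.continuousAt_ofReal_cpow_const t ν (Or.inr (Set.mem_Ioi.mp ht).ne')).continuousWithinAt

theorem continuousOn_realPsi (hp : 0 < p) : ContinuousOn (realPsi p) (Set.Ioi 0) :=
  fun _ ht => (hasDerivAt_realPsi hp ht).continuousAt.continuousWithinAt

theorem integrableOn_norm_cpow_mul_exp_realPsi (hp : 0 < p) (ν : ℂ) {c : ℝ} (hc : 0 < c) :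
    IntegrableOn (fun t : ℝ => ‖(t : ℂ) ^ (ν - 1)‖ * Real.exp (-c * realPsi p t)) (Set.Ioi 0) := by
  refine (integrableOn_rpow_mul_exp hp (ν - 1).re (a := c / p) (b := c) (by positivity) hc).congr_fun
    (fun t ht => ?_) measurableSet_Ioi
  simp only
  rw [Complex.norm_cpow_eq_rpow_re_of_pos ht, realPsi]
  congr 2
  ring

theorem integrableOn_mul_cexp {f : ℝ → ℂ} {φ : ℝ → ℝ} (hf : ContinuousOn f (Set.Ioi 0))
    (hφ : ContinuousOn φ (Set.Ioi 0)) {X : ℂ}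
    (hint : IntegrableOn (fun t => ‖f t‖ * Real.exp (-X.re * φ t)) (Set.Ioi 0)) :
    IntegrableOn (fun t => f t * Complex.exp (-X * (φ t : ℂ))) (Set.Ioi 0) := by
  refine hint.mono' (ContinuousOn.aestronglyMeasurable ?_ measurableSet_Ioi)
    (Eventually.of_forall fun t => ?_)
  · exact hf.mul (Complex.continuous_exp.comp_continuousOn
      (continuousOn_const.mul (Complex.continuous_ofReal.comp_continuousOn hφ)))
  · rw [norm_mul, norm_cexp_neg_mul_ofReal]

theorem differentiableAt_setIntegral_mul_cexp {f : ℝ → ℂ} {φ : ℝ → ℝ}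
    (hf : ContinuousOn f (Set.Ioi 0)) (hφ : ContinuousOn φ (Set.Ioi 0))
    (hφ0 : ∀ t ∈ Set.Ioi (0 : ℝ), 0 ≤ φ t)
    (hint : ∀ c : ℝ, 0 < c →
      IntegrableOn (fun t => ‖f t‖ * Real.exp (-c * φ t)) (Set.Ioi 0)) {X : ℂ} (hX : 0 < X.re) :
    DifferentiableAt ℂ
      (fun X : ℂ => ∫ t in Set.Ioi (0 : ℝ), f t * Complex.exp (-X * (φ t : ℂ))) X := by
  have hφc : ContinuousOn (fun t => (φ t : ℂ)) (Set.Ioi 0) :=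
    Complex.continuous_ofReal.comp_continuousOn hφ
  have hmeas : ∀ Y : ℂ, ContinuousOn (fun t => f t * Complex.exp (-Y * (φ t : ℂ))) (Set.Ioi 0) :=
    fun Y => hf.mul (Complex.continuous_exp.comp_continuousOn (continuousOn_const.mul hφc))
  set S : Set ℂ := {Y : ℂ | X.re / 2 < Y.re} with hS
  have hSn : S ∈ 𝓝 X := (isOpen_lt continuous_const Complex.continuous_re).mem_nhds
    (show X.re / 2 < X.re by linarith)
  have h := hasDerivAt_integral_of_dominated_loc_of_deriv_le (μ := volume.restrict (Set.Ioi (0:ℝ)))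
    (F := fun (X : ℂ) t => f t * Complex.exp (-X * (φ t : ℂ)))
    (F' := fun (X : ℂ) t => f t * Complex.exp (-X * (φ t : ℂ)) * -(φ t : ℂ))
    (bound := fun t => 4 / X.re * (‖f t‖ * Real.exp (-(X.re / 4) * φ t))) (x₀ := X) hSn
    (Eventually.of_forall fun Y => (hmeas Y).aestronglyMeasurable measurableSet_Ioi)
    (integrableOn_mul_cexp hf hφ (hint _ hX))
    (((hmeas X).mul hφc.neg).aestronglyMeasurable measurableSet_Ioi) ?_
    ((hint _ (by positivity)).const_mul _) ?_
  · exact h.2.differentiableAt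
  · filter_upwards [ae_restrict_mem measurableSet_Ioi] with t ht Y hY
    have hY : X.re / 2 < Y.re := hY
    have h0 := hφ0 t ht
    rw [norm_mul, norm_mul, norm_cexp_neg_mul_ofReal, norm_neg, Complex.norm_real,
      Real.norm_of_nonneg h0]
    -- The factor `φ` produced by differentiation is absorbed by a quarter of `Re X`. As `Re Y > Re
    -- X / 2` near `X`, another quarter is left for integrability.
    have h1 : φ t ≤ 4 / X.re * Real.exp (X.re / 4 * φ t) := by
      have := Real.add_one_le_exp (X.re / 4 * φ t)
      calc φ t = 4 / X.re * (X.re / 4 * φ t) := by field_simp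
        _ ≤ _ := by gcongr; linarith
    have h2 : Real.exp (-Y.re * φ t) * Real.exp (X.re / 4 * φ t) ≤ Real.exp (-(X.re / 4) * φ t) := by
      rw [← Real.exp_add]
      apply Real.exp_le_exp.mpr
      nlinarith
    calc ‖f t‖ * Real.exp (-Y.re * φ t) * φ t
        ≤ ‖f t‖ * Real.exp (-Y.re * φ t) * (4 / X.re * Real.exp (X.re / 4 * φ t)) := by gcongr
      _ = 4 / X.re * (‖f t‖ * (Real.exp (-Y.re * φ t) * Real.exp (X.re / 4 * φ t))) := by ring
      _ ≤ _ := by gcongr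
  · refine Eventually.of_forall fun t Y _ => ?_
    have h1 : HasDerivAt (fun Y : ℂ => -Y * (φ t : ℂ)) (-(φ t : ℂ)) Y := by
      simpa using ((hasDerivAt_id Y).neg.mul_const (φ t : ℂ))
    exact (h1.cexp.const_mul (f t)).congr_deriv (by ring)

/-! ### The Laplace integral in `X` and its expansion at the saddle. -/

/-- The integral `∫_0^∞ τ^(ν-1) exp(-X ψ(τ)) dτ`. -/
def saddleIntegral (p : ℝ) (ν X : ℂ) : ℂ :=
  ∫ t in Set.Ioi (0 : ℝ), (t : ℂ) ^ (ν - 1) * Complex.exp (-X * (realPsi p t : ℂ))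

theorem integrableOn_saddleIntegral (hp : 0 < p) (ν : ℂ) {X : ℂ} (hX : 0 < X.re) :
    IntegrableOn (fun t : ℝ => (t : ℂ) ^ (ν - 1) * Complex.exp (-X * (realPsi p t : ℂ)))
      (Set.Ioi 0) :=
  integrableOn_mul_cexp (continuousOn_cpow_const _) (continuousOn_realPsi hp)
    (integrableOn_norm_cpow_mul_exp_realPsi hp ν hX)

theorem differentiableAt_saddleIntegral (hp : 0 < p) (ν : ℂ) {X : ℂ} (hX : 0 < X.re) :
    DifferentiableAt ℂ (saddleIntegral p ν) X :=
  differentiableAt_setIntegral_mul_cexp (continuousOn_cpow_const _) (continuousOn_realPsi hp)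
    (fun _ ht => (kappa_pos hp).le.trans (kappa_le_realPsi hp ht))
    (fun _ hc => integrableOn_norm_cpow_mul_exp_realPsi hp ν hc) hX

/-- The Taylor coefficients of `τ^(ν-1) τ'` at `0`. -/
def saddleCoeff (ν : ℂ) (τ : ℂ → ℂ) (n : ℕ) : ℂ :=
  iteratedDeriv n (fun w : ℂ => τ w ^ (ν - 1) * deriv τ w) 0 / (n.factorial : ℂ)

/-- After multiplication by `e^(κX)` the phase is `ψ - κ`, bounded below by a positive constant away
from `t = 1`. Near `t = 1` the substitution `w = v(t)` makes the phase `w²/2` and the density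
`τ^(ν-1) τ'`, so the Gaussian version of Laplace's method applies to its Taylor polynomial. -/
theorem saddleIntegral_isBigO (hp : 0 < p) (ν : ℂ) {τ : ℂ → ℂ} (hτ : IsSaddleInverse p τ)
    {c : ℝ} (hc : 0 < c) (M : ℕ) :
    (fun X : ℂ => Complex.exp (kappa p * X) * saddleIntegral p ν X
        - ∑ k ∈ Finset.range M, saddleCoeff ν τ (2 * k) * halfPoch k * (2 / X) ^ k
            * (2 * Real.pi / X) ^ (1 / 2 : ℂ))
      =O[coneAtTop c] fun X => ‖X‖ ^ (-(M + 1 / 2) : ℝ) := by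
  set H : ℂ → ℂ := fun w => τ w ^ (ν - 1) * deriv τ w with hH
  have hHa : AnalyticAt ℂ H 0 :=
    (hτ.analytic.cpow analyticAt_const (by rw [hτ.map_zero]; simp)).mul hτ.analytic.deriv
  have hT := hHa.hasFPowerSeriesAt.isBigO_sub_partialSum_pow (2 * M)
  obtain ⟨C, hC⟩ := hT.bound
  obtain ⟨r, hr, hball⟩ := Metric.eventually_nhds_iff.mp (hC.and hHa.eventually_analyticAt)
  obtain ⟨ε, v, v', hε, hε1, hv, hv'c, hmono, hl, hl0, hu0, hu⟩ := hτ.exists_real_variable hp hr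
  have hle : 1 - ε ≤ 1 + ε := by linarith
  have hin : ∀ w ∈ Set.Icc (v (1 - ε)) (v (1 + ε)), dist (w : ℂ) 0 < r := fun w hw => by
    rw [dist_zero_right, Complex.norm_real, Real.norm_eq_abs, abs_lt]
    constructor <;> linarith [hw.1, hw.2]
  have hHc : ContinuousOn (fun w : ℝ => H w) (Set.Icc (v (1 - ε)) (v (1 + ε))) := fun w hw =>
    ((hball (hin w hw)).2.continuousAt.comp (f := fun w : ℝ => (w : ℂ))
      Complex.continuous_ofReal.continuousAt).continuousWithinAt
  have hloc := intervalIntegral_mul_gaussian_isBigO (H := fun w : ℝ => H w)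
    (a := saddleCoeff ν τ) (C := C) (M := M) hl0 hu0 hHc (fun w hw => by
      have := (hball (hin w hw)).1
      rw [zero_add, norm_pow, norm_norm, Complex.norm_real, Real.norm_eq_abs] at this
      refine le_trans (le_of_eq ?_) this
      congr 2
      rw [FormalMultilinearSeries.partialSum]
      refine Finset.sum_congr rfl fun n _ => ?_
      rw [FormalMultilinearSeries.ofScalars_apply_eq, smul_eq_mul]
      rfl) hc
  obtain ⟨d, hd, hgap⟩ := exists_kappa_add_le_realPsi hp hε hε1
  set S : Set ℝ := Set.Ioi 0 \ Set.Ioc (1 - ε) (1 + ε) with hSdef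
  have hSm : MeasurableSet S := measurableSet_Ioi.diff measurableSet_Ioc
  have htail : (fun X : ℂ => ∫ t in S, (t : ℂ) ^ (ν - 1)
      * Complex.exp (-X * ((realPsi p t - kappa p : ℝ) : ℂ)))
      =O[coneAtTop c] fun X => ‖X‖ ^ (-(M + 1 / 2) : ℝ) := by
    refine setIntegral_mul_cexp_isBigO hSm hd (fun t ht => ?_) ?_ hc _
    · linarith [hgap t ht.1 ht.2]
    · have i0 : IntegrableOn (fun t : ℝ => ‖(t : ℂ) ^ (ν - 1)‖ * Real.exp (-1 * realPsi p t)
          * Real.exp (kappa p)) (Set.Ioi 0) :=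
        (integrableOn_norm_cpow_mul_exp_realPsi hp ν one_pos).mul_const _
      refine (i0.mono_set Set.sdiff_subset).congr_fun (fun t _ => ?_) hSm
      simp only
      rw [mul_assoc, ← Real.exp_add]
      congr 2; ring
  refine (htail.add hloc).congr' ?_ EventuallyEq.rfl
  filter_upwards [(tendsto_re_coneAtTop hc).eventually_gt_atTop 0] with X hX
  have e1 : Complex.exp (kappa p * X) * saddleIntegral p ν X
      = ∫ t in Set.Ioi (0 : ℝ), (t : ℂ) ^ (ν - 1)
        * Complex.exp (-X * ((realPsi p t - kappa p : ℝ) : ℂ)) := by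
    rw [saddleIntegral, ← integral_const_mul]
    refine integral_congr_ae (Eventually.of_forall fun t => ?_)
    simp only
    rw [mul_left_comm, ← Complex.exp_add]
    congr 2
    push_cast; ring
  have i1 : IntegrableOn (fun t : ℝ => (t : ℂ) ^ (ν - 1)
        * Complex.exp (-X * ((realPsi p t - kappa p : ℝ) : ℂ))) (Set.Ioi 0) := by
    have i0 : IntegrableOn (fun t : ℝ => Complex.exp (kappa p * X) * ((t : ℂ) ^ (ν - 1)
        * Complex.exp (-X * (realPsi p t : ℂ)))) (Set.Ioi 0) :=
      (integrableOn_saddleIntegral hp ν hX).const_mul _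
    refine i0.congr_fun (fun t _ => ?_) measurableSet_Ioi
    simp only
    rw [mul_left_comm, ← Complex.exp_add]
    congr 2
    push_cast; ring
  have hsub : Set.Ioc (1 - ε) (1 + ε) ⊆ Set.Ioi 0 := fun t ht => lt_trans (by linarith) ht.1
  have e2 : ∫ t in Set.Ioi (0 : ℝ), (t : ℂ) ^ (ν - 1)
        * Complex.exp (-X * ((realPsi p t - kappa p : ℝ) : ℂ))
      = (∫ t in S, (t : ℂ) ^ (ν - 1) * Complex.exp (-X * ((realPsi p t - kappa p : ℝ) : ℂ)))
        + ∫ t in Set.Ioc (1 - ε) (1 + ε), (t : ℂ) ^ (ν - 1)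
        * Complex.exp (-X * ((realPsi p t - kappa p : ℝ) : ℂ)) := by
    rw [← setIntegral_union Set.disjoint_sdiff_left measurableSet_Ioc (i1.mono_set Set.sdiff_subset)
      (i1.mono_set hsub), Set.sdiff_union_of_subset hsub]
  have e3 : ∫ t in Set.Ioc (1 - ε) (1 + ε), (t : ℂ) ^ (ν - 1)
        * Complex.exp (-X * ((realPsi p t - kappa p : ℝ) : ℂ))
      = ∫ w in v (1 - ε)..v (1 + ε), H w * Complex.exp (-X * ((w ^ 2 / 2 : ℝ) : ℂ)) := by
    rw [← intervalIntegral.integral_deriv_smul_comp' (f := v) (f' := v')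
      (g := fun w : ℝ => H w * Complex.exp (-X * ((w ^ 2 / 2 : ℝ) : ℂ))),
      intervalIntegral.integral_of_le hle]
    · refine setIntegral_congr_fun measurableSet_Ioc fun t ht => ?_
      obtain ⟨-, h2, h3, h4⟩ := hv t ⟨ht.1.le, ht.2⟩
      simp only [Function.comp_apply, hH]
      rw [h2, h3, add_sub_cancel_left, Complex.real_smul]
      linear_combination (-((t : ℂ) ^ (ν - 1) * Complex.exp (-X * ((v t ^ 2 / 2 : ℝ) : ℂ)))) * h4
    · rw [Set.uIcc_of_le hle]; exact fun t ht => (hv t ht).1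
    · rwa [Set.uIcc_of_le hle]
    · rw [Set.uIcc_of_le hle]
      refine (hHc.mul (Continuous.continuousOn (by fun_prop))).mono ?_
      rintro _ ⟨t, ht, rfl⟩
      exact ⟨hmono ⟨le_rfl, hle⟩ ht ht.1, hmono ht ⟨hle, le_rfl⟩ ht.2⟩
  rw [e1, e2, e3]
  ring

/-! ### The integral of Krätzel and its continuation -/

theorem XLog_eq_exp (hp : 0 < p) (ζ : ℂ) :
    XLog p ζ = Complex.exp (Real.log p / (p + 1) + p / (p + 1) * ζ) := by
  rw [XLog, Real.rpow_def_of_pos hp, Complex.ofReal_exp, ← Complex.exp_add]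
  congr 1
  push_cast
  ring

theorem ofReal_add_one_ne_zero (hp : 0 < p) : (p : ℂ) + 1 ≠ 0 := by
  have : p + 1 ≠ 0 := by positivity
  exact_mod_cast this

theorem XLog_exponent_im (ζ : ℂ) :
    ((Real.log p : ℂ) / (p + 1) + p / (p + 1) * ζ).im = argX p ζ := by
  have e : (Real.log p : ℂ) / (p + 1) + p / (p + 1) * ζ
      = ((Real.log p / (p + 1) : ℝ) : ℂ) + ((p / (p + 1) : ℝ) : ℂ) * ζ := by push_cast; rfl
  rw [e, Complex.add_im, Complex.ofReal_im, Complex.im_ofReal_mul, argX, zero_add]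

theorem log_XLog (hp : 0 < p) {ζ : ℂ} (hζ : |argX p ζ| < Real.pi / 2) :
    Complex.log (XLog p ζ) = Real.log p / (p + 1) + p / (p + 1) * ζ := by
  have := abs_lt.mp hζ
  rw [XLog_eq_exp hp, Complex.log_exp] <;> rw [XLog_exponent_im] <;> linarith [Real.pi_pos]

theorem XLog_re (hp : 0 < p) (ζ : ℂ) : (XLog p ζ).re = ‖XLog p ζ‖ * Real.cos (argX p ζ) := by
  rw [XLog_eq_exp hp, Complex.norm_exp, Complex.exp_re, XLog_exponent_im]

theorem XLog_ne_zero (hp : 0 < p) (ζ : ℂ) : XLog p ζ ≠ 0 := by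
  rw [XLog_eq_exp hp]; exact Complex.exp_ne_zero _

theorem XLog_re_pos (hp : 0 < p) {ζ : ℂ} (hζ : |argX p ζ| < Real.pi / 2) : 0 < (XLog p ζ).re := by
  rw [XLog_re hp]
  have := abs_lt.mp hζ
  exact mul_pos (norm_pos_iff.mpr (XLog_ne_zero hp ζ))
    (Real.cos_pos_of_mem_Ioo ⟨by linarith, by linarith⟩)

/-- Matches the exponents of the two prefactors: `κX` equals `(p+1)(x/p)^(p/(p+1))`. -/
theorem kappa_mul_XLog (hp : 0 < p) (ζ : ℂ) :
    (kappa p : ℂ) * XLog p ζ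
      = (p + 1) * Complex.exp (((p / (p + 1) : ℝ) : ℂ) * (ζ - (Real.log p : ℂ))) := by
  have hp1 := ofReal_add_one_ne_zero hp
  have hpc : (p : ℂ) ≠ 0 := by exact_mod_cast hp.ne'
  have e : Complex.exp (((p / (p + 1) : ℝ) : ℂ) * (ζ - (Real.log p : ℂ)))
      = Complex.exp (-Real.log p) * XLog p ζ := by
    rw [XLog_eq_exp hp, ← Complex.exp_add]
    congr 1
    push_cast
    field_simp
    ring
  have e2 : Complex.exp (-(Real.log p : ℂ)) = (p : ℂ)⁻¹ := by
    rw [Complex.exp_neg, ← Complex.ofReal_exp, Real.exp_log hp]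
  rw [e, e2, kappa]
  push_cast
  ring

theorem differentiable_XLog : Differentiable ℂ (XLog p) := by
  unfold XLog; fun_prop

theorem contIntegrand_eqOn (ν ζ : ℂ) :
    Set.EqOn (contIntegrand p ν ζ)
      (fun t : ℝ => (t : ℂ) ^ (ν - 1) * Complex.exp (-XLog p ζ * (realPsi p t : ℂ)))
      (Set.Ioi 0) := fun t ht => by
  simp only [contIntegrand]
  rw [psi_ofReal (le_of_lt ht)]

theorem FLog_eq (ν ζ : ℂ) :
    FLog p ν ζ = Complex.exp (ν / ((p : ℂ) + 1) * (ζ - (Real.log p : ℂ)))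
      * saddleIntegral p ν (XLog p ζ) := by
  rw [FLog, saddleIntegral, setIntegral_congr_fun measurableSet_Ioi (contIntegrand_eqOn ν ζ)]

theorem integrableOn_contIntegrand (hp : 0 < p) (ν : ℂ) {ζ : ℂ} (hζ : |argX p ζ| < Real.pi / 2) :
    IntegrableOn (contIntegrand p ν ζ) (Set.Ioi (0 : ℝ)) :=
  (integrableOn_saddleIntegral hp ν (XLog_re_pos hp hζ)).congr_fun
    (contIntegrand_eqOn ν ζ).symm measurableSet_Ioi

theorem differentiableAt_FLog (hp : 0 < p) (ν : ℂ) {ζ : ℂ} (hζ : |argX p ζ| < Real.pi / 2) :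
    DifferentiableAt ℂ (FLog p ν) ζ := by
  rw [funext (FLog_eq (p := p) ν)]
  have h1 : DifferentiableAt ℂ (fun ζ => saddleIntegral p ν (XLog p ζ)) ζ :=
    (differentiableAt_saddleIntegral hp ν (XLog_re_pos hp hζ)).comp ζ differentiable_XLog.differentiableAt
  fun_prop

theorem integrand_eq (ν x : ℂ) (t : ℝ) :
    integrand p ν x t = ((t : ℂ) ^ (ν - 1) * Complex.exp (-((t ^ p : ℝ) : ℂ)))
      * Complex.exp (-x * ((1 / t : ℝ) : ℂ)) := by
  rw [integrand, sub_eq_add_neg (-((t ^ p : ℝ) : ℂ)), Complex.exp_add, mul_assoc]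
  congr 3
  push_cast; ring

theorem continuousOn_integrand_factor (hp : 0 < p) (ν : ℂ) :
    ContinuousOn (fun t : ℝ => (t : ℂ) ^ (ν - 1) * Complex.exp (-((t ^ p : ℝ) : ℂ)))
      (Set.Ioi 0) := by
  refine (continuousOn_cpow_const _).mul (Continuous.continuousOn ?_)
  have : Continuous fun t : ℝ => t ^ p := Real.continuous_rpow_const hp.le
  fun_prop

theorem continuousOn_one_div : ContinuousOn (fun t : ℝ => 1 / t) (Set.Ioi 0) :=
  continuousOn_const.div continuousOn_id fun _ ht => (Set.mem_Ioi.mp ht).ne'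

theorem norm_integrand_factor (ν : ℂ) {t : ℝ} (ht : 0 < t) :
    ‖(t : ℂ) ^ (ν - 1) * Complex.exp (-((t ^ p : ℝ) : ℂ))‖
      = t ^ (ν.re - 1) * Real.exp (-t ^ p) := by
  rw [norm_mul, Complex.norm_cpow_eq_rpow_re_of_pos ht, ← Complex.ofReal_neg,
    Complex.norm_exp_ofReal]
  simp

theorem integrableOn_integrand_factor (hp : 0 < p) (ν : ℂ) {c : ℝ} (hc : 0 < c) :
    IntegrableOn (fun t : ℝ => ‖(t : ℂ) ^ (ν - 1) * Complex.exp (-((t ^ p : ℝ) : ℂ))‖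
      * Real.exp (-c * (1 / t))) (Set.Ioi 0) := by
  refine (integrableOn_rpow_mul_exp hp (ν.re - 1) one_pos hc).congr_fun (fun t ht => ?_)
    measurableSet_Ioi
  simp only
  rw [norm_integrand_factor ν ht, mul_assoc, ← Real.exp_add]
  congr 2
  ring

theorem integrableOn_integrand (hp : 0 < p) (ν : ℂ) {x : ℂ} (hx : 0 < x.re) :
    IntegrableOn (integrand p ν x) (Set.Ioi (0 : ℝ)) := by
  rw [funext (integrand_eq ν x)]
  exact integrableOn_mul_cexp (continuousOn_integrand_factor hp ν) continuousOn_one_div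
    (integrableOn_integrand_factor hp ν hx)

theorem differentiableAt_F (hp : 0 < p) (ν : ℂ) {x : ℂ} (hx : 0 < x.re) :
    DifferentiableAt ℂ (F p ν) x := by
  have e : F p ν = fun x : ℂ => ∫ t in Set.Ioi (0 : ℝ), ((t : ℂ) ^ (ν - 1)
      * Complex.exp (-((t ^ p : ℝ) : ℂ))) * Complex.exp (-x * ((1 / t : ℝ) : ℂ)) := by
    ext x; simp only [F, integrand_eq]
  rw [e]
  exact differentiableAt_setIntegral_mul_cexp (continuousOn_integrand_factor hp ν)
    continuousOn_one_div (fun t ht => one_div_nonneg.mpr (le_of_lt ht))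
    (fun c hc => integrableOn_integrand_factor hp ν hc) hx

/-- The substitution `t = aτ` with `a = (x/p)^(1/(p+1))`, for which `X = p a^p` and `x = p a^(p+1)`.
-/
theorem FLog_ofReal (hp : 0 < p) (ν : ℂ) (y : ℝ) :
    FLog p ν (y : ℂ) = F p ν (Complex.exp y) := by
  have hp1 : p + 1 ≠ 0 := by positivity
  set a : ℝ := Real.exp ((y - Real.log p) / (p + 1)) with ha
  have ha0 : 0 < a := Real.exp_pos _
  have hX : XLog p (y : ℂ) = ((p * a ^ p : ℝ) : ℂ) := by
    have e1 : p * a ^ p = Real.exp (Real.log p / (p + 1) + p / (p + 1) * y) := by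
      rw [ha, ← Real.exp_mul]
      nth_rw 1 [← Real.exp_log hp]
      rw [← Real.exp_add]
      congr 1
      field_simp
      ring
    rw [XLog_eq_exp hp, e1]
    push_cast; rfl
  have hx : Real.exp y = p * a ^ p * a := by
    have e0 : ∀ b : ℝ, p * b = Real.exp (Real.log p) * b := fun b => by rw [Real.exp_log hp]
    rw [ha, ← Real.exp_mul, mul_assoc, e0, ← Real.exp_add, ← Real.exp_add]
    congr 1
    field_simp
    ring
  have hcov := integral_comp_mul_left_Ioi (integrand p ν (Complex.exp y)) 0 ha0
  rw [mul_zero] at hcov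
  rw [F, FLog_eq, saddleIntegral]
  have hF : ∫ t in Set.Ioi (0 : ℝ), integrand p ν (Complex.exp y) t
      = (a : ℂ) * ∫ t in Set.Ioi (0 : ℝ), integrand p ν (Complex.exp y) (a * t) := by
    rw [hcov, Complex.real_smul, ← mul_assoc, ← Complex.ofReal_mul, mul_inv_cancel₀ ha0.ne']
    simp
  have hint : ∀ t ∈ Set.Ioi (0 : ℝ), integrand p ν (Complex.exp y) (a * t)
      = (a : ℂ) ^ (ν - 1)
        * ((t : ℂ) ^ (ν - 1) * Complex.exp (-XLog p y * (realPsi p t : ℂ))) := fun t ht => by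
    have ht : 0 < t := ht
    rw [integrand, Complex.ofReal_mul, Complex.mul_cpow_ofReal_nonneg ha0.le ht.le, mul_assoc, hX,
      ← Complex.ofReal_exp, hx]
    congr 3
    rw [Real.mul_rpow ha0.le ht.le, realPsi]
    have h1 : (a : ℂ) ≠ 0 := by exact_mod_cast ha0.ne'
    have h2 : (t : ℂ) ≠ 0 := by exact_mod_cast ht.ne'
    have h3 : (p : ℂ) ≠ 0 := by exact_mod_cast hp.ne'
    push_cast
    field_simp
    ring
  rw [hF, setIntegral_congr_fun measurableSet_Ioi hint, integral_const_mul, ← mul_assoc]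
  congr 1
  have h1 : (a : ℂ) ≠ 0 := by exact_mod_cast ha0.ne'
  have h2 : (a : ℂ) * (a : ℂ) ^ (ν - 1) = (a : ℂ) ^ ν := by
    rw [Complex.cpow_sub _ _ h1, Complex.cpow_one]; field_simp
  rw [h2, Complex.cpow_def_of_ne_zero h1,
    ← Complex.ofReal_log ha0.le, ha, Real.log_exp]
  congr 1
  push_cast
  ring

theorem abs_argX_lt (hp : 0 < p) {ζ : ℂ} (hζ : |ζ.im| < Real.pi / 2) :
    |argX p ζ| ≤ p / (p + 1) * (Real.pi / 2) := by
  rw [argX, abs_mul, abs_of_pos (by positivity : 0 < p / (p + 1))]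
  gcongr

theorem div_add_one_mul_lt (hp : 0 < p) : p / (p + 1) * (Real.pi / 2) < Real.pi / 2 := by
  have : p / (p + 1) < 1 := by rw [div_lt_one (by positivity)]; linarith
  nlinarith [Real.pi_pos]

/-- Both sides are holomorphic on the strip, which is convex and hence connected, and they agree on
the real axis, which accumulates at `0`. -/
theorem FLog_eq_F (hp : 0 < p) (ν : ℂ) {ζ : ℂ} (hζ : |ζ.im| < Real.pi / 2) :
    FLog p ν ζ = F p ν (Complex.exp ζ) := by
  set U : Set ℂ := {ζ : ℂ | |ζ.im| < Real.pi / 2} with hU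
  have hopen : IsOpen U := isOpen_lt (by fun_prop) continuous_const
  have hconv : Convex ℝ U := by
    have : U = Complex.imLm ⁻¹' Set.Ioo (-(Real.pi / 2)) (Real.pi / 2) := by
      ext z; simp [hU, abs_lt]
    rw [this]
    exact (convex_Ioo _ _).linear_preimage _
  have h1 : DifferentiableOn ℂ (FLog p ν) U := fun z hz =>
    (differentiableAt_FLog hp ν ((abs_argX_lt hp hz).trans_lt
      (div_add_one_mul_lt hp))).differentiableWithinAt
  have h2 : DifferentiableOn ℂ (fun ζ => F p ν (Complex.exp ζ)) U := fun z hz => by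
    refine DifferentiableAt.differentiableWithinAt ?_
    have hz' := abs_lt.mp (show |z.im| < Real.pi / 2 from hz)
    refine (differentiableAt_F hp ν ?_).comp z Complex.differentiable_exp.differentiableAt
    rw [Complex.exp_re]
    exact mul_pos (Real.exp_pos _) (Real.cos_pos_of_mem_Ioo ⟨by linarith, by linarith⟩)
  refine (h1.analyticOnNhd hopen).eqOn_of_preconnected_of_frequently_eq (h2.analyticOnNhd hopen)
    hconv.isPreconnected (z₀ := 0) (by simp [hU, Real.pi_pos]) ?_ hζ
  have ht : Tendsto (fun y : ℝ => (y : ℂ)) (𝓝[≠] 0) (𝓝[≠] 0) := by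
    refine tendsto_nhdsWithin_iff.mpr ⟨?_, ?_⟩
    · simpa using (Complex.continuous_ofReal.tendsto 0).mono_left nhdsWithin_le_nhds
    · filter_upwards [self_mem_nhdsWithin] with y hy
      simpa using hy
  exact ht.frequently (Eventually.of_forall fun y => FLog_ofReal hp ν y).frequently

/-! ### The prefactors -/

theorem ofReal_cpow_eq_exp {a : ℝ} (ha : 0 < a) (z : ℂ) :
    (a : ℂ) ^ z = Complex.exp (Real.log a * z) := by
  have : (a : ℂ) ≠ 0 := by exact_mod_cast ha.ne'
  rw [Complex.cpow_def_of_ne_zero this, Complex.ofReal_log ha.le]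

theorem ofReal_mul_cpow {a : ℝ} (ha : 0 < a) {b : ℂ} (hb : b ≠ 0) (z : ℂ) :
    ((a : ℂ) * b) ^ z = Complex.exp ((Real.log a + Complex.log b) * z) := by
  have : (a : ℂ) * b ≠ 0 := mul_ne_zero (by exact_mod_cast ha.ne') hb
  rw [Complex.cpow_def_of_ne_zero this, Complex.log_ofReal_mul ha hb]

theorem log_inv_of_re_pos {b : ℂ} (hb : 0 < b.re) : Complex.log b⁻¹ = -Complex.log b := by
  refine Complex.log_inv b fun h => ?_
  have := Complex.arg_eq_pi_iff.mp h
  linarith [this.1]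

theorem sqrt_div_eq_exp {a : ℝ} (ha : 0 < a) {b : ℂ} (hb : 0 < b.re) :
    ((a : ℂ) / b) ^ (1 / 2 : ℂ) = Complex.exp ((Real.log a - Complex.log b) * (1 / 2)) := by
  have hb0 : b ≠ 0 := by rintro rfl; simp at hb
  rw [div_eq_mul_inv, ofReal_mul_cpow ha (inv_ne_zero hb0), log_inv_of_re_pos hb, sub_eq_add_neg]

theorem log_kappa (hp : 0 < p) : Real.log (kappa p) = Real.log (p + 1) - Real.log p := by
  rw [kappa, Real.log_div (by positivity) hp.ne']

theorem two_pi_div_eq (hp : 0 < p) (Y : ℂ) :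
    2 * (Real.pi : ℂ) / (((p : ℂ) + 1) * Y) = ((2 * Real.pi / (p + 1) : ℝ) : ℂ) / Y := by
  have hp1 := ofReal_add_one_ne_zero hp
  push_cast
  rw [div_div]

/-- For `|arg X| < π/2` the principal logarithm of `X` is affine in `ζ`. Both sides then become
single exponentials, whose exponents agree as expressions in `ζ`, `log p`, `log (p+1)` and `log 2π`.
-/
theorem mellinPrefactor_XLog (hp : 0 < p) (ν : ℂ) {ζ : ℂ} (hζ : |argX p ζ| < Real.pi / 2) :
    mellinPrefactor p ν (XLog p ζ) = prefactorLog p ν ζ := by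
  have hre := XLog_re_pos hp hζ
  have hp1 := ofReal_add_one_ne_zero hp
  have hpc : (p : ℂ) ≠ 0 := by exact_mod_cast hp.ne'
  have hκ := kappa_pos hp
  rw [mellinPrefactor, prefactorLog, two_pi_div_eq hp, sqrt_div_eq_exp (by positivity) hre,
    ofReal_mul_cpow hκ (XLog_ne_zero hp ζ), log_XLog hp hζ, neg_mul (kappa p : ℂ),
    kappa_mul_XLog hp, A0, ofReal_cpow_eq_exp hκ, ofReal_cpow_eq_exp hp,
    Real.log_div (by positivity) (by positivity)]
  have e1 : (kappa p : ℂ) * p = Complex.exp (Real.log (p + 1)) := by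
    rw [← Complex.ofReal_exp, Real.exp_log (by positivity), kappa]
    push_cast; field_simp
  have e2 : 2 * (Real.pi : ℂ) = Complex.exp (Real.log (2 * Real.pi)) := by
    rw [← Complex.ofReal_exp, Real.exp_log (by positivity)]; push_cast; rfl
  have e3 : (((2 * Real.pi) ^ (-(1 / 2) : ℝ) : ℝ) : ℂ)
      = Complex.exp (Real.log (2 * Real.pi) * (-(1 / 2))) := by
    rw [Real.rpow_def_of_pos (by positivity)]; push_cast; rfl
  rw [e1, e2, e3, div_eq_mul_inv, ← Complex.exp_neg, log_kappa hp]
  simp only [← Complex.exp_add, neg_mul]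
  congr 1
  simp only [theta]
  push_cast
  field_simp
  ring

theorem log_div_ofReal (hp : 0 < p) {x : ℂ} (hx : x ≠ 0) :
    Complex.log (x / p) = Complex.log x - Real.log p := by
  have : x / p = ((p⁻¹ : ℝ) : ℂ) * x := by push_cast; ring
  rw [this, Complex.log_ofReal_mul (by positivity) hx, Real.log_inv]
  push_cast; ring

theorem X_eq_XLog {x : ℂ} (hx : x ≠ 0) : X p x = XLog p (Complex.log x) := by
  rw [X, XLog, Complex.cpow_def_of_ne_zero hx, mul_comm (Complex.log x)]

theorem prefactor_eq_prefactorLog (hp : 0 < p) (ν : ℂ) {x : ℂ} (hx : x ≠ 0) :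
    prefactor p ν x = prefactorLog p ν (Complex.log x) := by
  have h0 : x / p ≠ 0 := div_ne_zero hx (by exact_mod_cast hp.ne')
  rw [prefactor, prefactorLog, X_eq_XLog hx, Complex.cpow_def_of_ne_zero h0 (ν / _),
    Complex.cpow_def_of_ne_zero h0 (((p / (p + 1) : ℝ) : ℂ)), log_div_ofReal hp hx,
    mul_comm _ (ν / _), mul_comm (Complex.log x - _) (((p / (p + 1) : ℝ) : ℂ))]

theorem abs_argX_log_lt (hp : 0 < p) {x : ℂ} (hx : |x.arg| < Real.pi / 2) :
    |argX p (Complex.log x)| < Real.pi / 2 :=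
  (abs_argX_lt hp (by rwa [Complex.log_im])).trans_lt (div_add_one_mul_lt hp)

/-! ### The saddle point expansion -/

theorem tendsto_XLog_coneAtTop (hp : 0 < p) {δ : ℝ} (hδ : 0 < δ) :
    ∃ c > 0, Tendsto (XLog p) (comap (fun ζ : ℂ => ‖XLog p ζ‖) atTop
      ⊓ 𝓟 {ζ : ℂ | |argX p ζ| ≤ Real.pi / 2 - δ}) (coneAtTop c) := by
  by_cases hδ' : δ ≤ Real.pi / 2
  · refine ⟨Real.sin δ, Real.sin_pos_of_pos_of_lt_pi hδ (by linarith [Real.pi_pos]),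
      tendsto_inf.mpr ⟨?_, tendsto_principal.mpr ?_⟩⟩
    · rw [← tendsto_norm_atTop_iff_cobounded]
      exact tendsto_comap.mono_left inf_le_left
    · filter_upwards [mem_inf_of_right (mem_principal_self _)] with ζ hζ
      have h1 := Real.cos_le_cos_of_nonneg_of_le_pi (abs_nonneg (argX p ζ))
        (by linarith [Real.pi_pos] : Real.pi / 2 - δ ≤ Real.pi) hζ
      rw [Real.cos_abs, Real.cos_pi_div_two_sub] at h1
      change Real.sin δ * ‖XLog p ζ‖ ≤ (XLog p ζ).re
      rw [XLog_re hp, mul_comm]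
      gcongr
  · refine ⟨1, one_pos, ?_⟩
    have : {ζ : ℂ | |argX p ζ| ≤ Real.pi / 2 - δ} = ∅ := by
      ext s; simp only [Set.mem_ofPred_eq, Set.mem_empty_iff_false, iff_false, not_le]
      exact lt_of_lt_of_le (by linarith) (abs_nonneg _)
    rw [this]; simp

theorem B_eq_saddleCoeff (ν : ℂ) (τ : ℂ → ℂ) (k : ℕ) :
    B p ν τ k = ((Real.sqrt (p + 1) : ℝ) : ℂ) * saddleCoeff ν τ (2 * k) := rfl

theorem sqrt_prefactor_eq (hp : 0 < p) {Y : ℂ} (hY : 0 < Y.re) :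
    (2 * (Real.pi : ℂ) / Y) ^ (1 / 2 : ℂ)
      = ((Real.sqrt (p + 1) : ℝ) : ℂ) * (2 * (Real.pi : ℂ) / (((p : ℂ) + 1) * Y)) ^ (1 / 2 : ℂ) := by
  have e : 2 * (Real.pi : ℂ) / Y = ((2 * Real.pi : ℝ) : ℂ) / Y := by push_cast; rfl
  rw [two_pi_div_eq hp, e, sqrt_div_eq_exp (by positivity) hY, sqrt_div_eq_exp (by positivity) hY,
    Real.sqrt_eq_rpow, Real.rpow_def_of_pos (by positivity), Complex.ofReal_exp, ← Complex.exp_add,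
    Real.log_div (by positivity) (by positivity)]
  congr 1
  push_cast
  ring

/-- The factors `e^(-κX)` and `(x/p)^(ν/(p+1))` cancel exactly. Division by the square root, of size
`|X|^(-1/2)`, turns the error `|X|^(-M-1/2)` into `|X|^(-M)`, and its constant accounts for the
`√(p+1)` in `B`. -/
theorem FLog_div_prefactorLog_isBigO (hp : 0 < p) (ν : ℂ) {τ : ℂ → ℂ} (hτ : IsSaddleInverse p τ)
    (M : ℕ) {δ : ℝ} (hδ : 0 < δ) :
    (fun ζ : ℂ => FLog p ν ζ / prefactorLog p ν ζ
        - ∑ k ∈ Finset.range M, halfPoch k * B p ν τ k / (XLog p ζ / 2) ^ k)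
      =O[comap (fun ζ : ℂ => ‖XLog p ζ‖) atTop ⊓ 𝓟 {ζ : ℂ | |argX p ζ| ≤ Real.pi / 2 - δ}]
    (fun ζ : ℂ => 1 / XLog p ζ ^ M) := by
  obtain ⟨c, hc, ht⟩ := tendsto_XLog_coneAtTop hp hδ
  set l := comap (fun ζ : ℂ => ‖XLog p ζ‖) atTop ⊓ 𝓟 {ζ : ℂ | |argX p ζ| ≤ Real.pi / 2 - δ}
  set Q : ℂ → ℂ := fun Y => (2 * (Real.pi : ℂ) / (((p : ℂ) + 1) * Y)) ^ (1 / 2 : ℂ) with hQ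
  have hQnorm : ∀ Y : ℂ, Y ≠ 0 → ‖Q Y‖ = (2 * Real.pi / (p + 1)) ^ (1 / 2 : ℝ) * ‖Y‖ ^ (-(1 / 2) : ℝ) := by
    intro Y hY
    have e : (1 / 2 : ℂ) = ((1 / 2 : ℝ) : ℂ) := by push_cast; rfl
    have h2 : 0 < 2 * Real.pi / (p + 1) := by positivity
    simp only [hQ]
    rw [two_pi_div_eq hp, e, Complex.norm_cpow_real, norm_div, Complex.norm_real,
      Real.norm_of_nonneg h2.le, Real.div_rpow h2.le (norm_nonneg _), Real.rpow_neg (norm_nonneg _),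
      div_eq_mul_inv]
  have hne : ∀ᶠ Y in coneAtTop c, 0 < Y.re ∧ Y ≠ 0 := by
    filter_upwards [(tendsto_re_coneAtTop hc).eventually_gt_atTop 0] with Y hY
    exact ⟨hY, by rintro rfl; simp at hY⟩
  have h1 := (saddleIntegral_isBigO hp ν hτ hc M).mul
    (isBigO_refl (fun Y => (Q Y)⁻¹) (coneAtTop c)).norm_right
  have h2 : (fun Y : ℂ => ‖Y‖ ^ (-(M + 1 / 2) : ℝ) * ‖(Q Y)⁻¹‖) =O[coneAtTop c]
      fun Y => 1 / Y ^ M := by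
    refine IsBigO.of_bound (((2 * Real.pi / (p + 1)) ^ (1 / 2 : ℝ))⁻¹) ?_
    filter_upwards [hne] with Y hY
    have hY0 : 0 < ‖Y‖ := norm_pos_iff.mpr hY.2
    rw [norm_inv, hQnorm Y hY.2, norm_div, norm_pow, norm_one, Real.norm_of_nonneg (by positivity),
      neg_add, Real.rpow_add hY0, Real.rpow_neg (norm_nonneg Y) M, Real.rpow_natCast]
    refine le_of_eq ?_
    have : ‖Y‖ ^ (-(1 / 2) : ℝ) ≠ 0 := (Real.rpow_pos_of_pos hY0 _).ne'
    field_simp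
  have h3 := (h1.trans h2).comp_tendsto ht
  refine h3.congr' ?_ EventuallyEq.rfl
  filter_upwards [ht.eventually hne] with ζ hζ
  have hQ0 : Q (XLog p ζ) ≠ 0 := by
    rw [← norm_pos_iff, hQnorm _ hζ.2]
    have := norm_pos_iff.mpr hζ.2
    positivity
  simp only [Function.comp_apply]
  rw [sub_mul, Finset.sum_mul]
  congr 1
  · rw [FLog_eq, prefactorLog]
    have e1 : -((p : ℂ) + 1) * Complex.exp (((p / (p + 1) : ℝ) : ℂ) * (ζ - (Real.log p : ℂ)))
        = -(kappa p * XLog p ζ) := by rw [kappa_mul_XLog hp]; ring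
    rw [e1, Complex.exp_neg]
    change _ = _ / (Q (XLog p ζ) * _ * _)
    have h4 := Complex.exp_ne_zero (ν / ((p : ℂ) + 1) * (ζ - (Real.log p : ℂ)))
    have h5 := Complex.exp_ne_zero (kappa p * XLog p ζ)
    field_simp
  · refine Finset.sum_congr rfl fun k _ => ?_
    rw [sqrt_prefactor_eq hp hζ.1, B_eq_saddleCoeff]
    change _ * _ * _ * (_ * Q (XLog p ζ)) * (Q (XLog p ζ))⁻¹ = _
    have h6 := hζ.2
    rw [div_pow, div_pow]
    field_simp

theorem F_div_prefactor_isBigO (hp : 0 < p) (ν : ℂ) {τ : ℂ → ℂ} (hτ : IsSaddleInverse p τ)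
    (M : ℕ) :
    (fun x : ℂ => F p ν x / prefactor p ν x
        - ∑ k ∈ Finset.range M, halfPoch k * B p ν τ k / (X p x / 2) ^ k)
      =O[Bornology.cobounded ℂ ⊓ 𝓟 {x : ℂ | |x.arg| < Real.pi / 2}]
    (fun x : ℂ => 1 / X p x ^ M) := by
  -- The factor `p/(p+1) < 1` maps the whole open half plane of `x` into one closed subsector for
  -- `X`.
  set δ : ℝ := Real.pi / 2 - p / (p + 1) * (Real.pi / 2) with hδ
  have hδ0 : 0 < δ := sub_pos.mpr (div_add_one_mul_lt hp)
  have hlim : Tendsto (fun x : ℂ => ‖x‖)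
      (Bornology.cobounded ℂ ⊓ 𝓟 {x : ℂ | |x.arg| < Real.pi / 2}) atTop :=
    tendsto_norm_cobounded_atTop.mono_left inf_le_left
  have hmem : ∀ᶠ x in Bornology.cobounded ℂ ⊓ 𝓟 {x : ℂ | |x.arg| < Real.pi / 2},
      |x.arg| < Real.pi / 2 := mem_inf_of_right (mem_principal_self _)
  have hne : ∀ᶠ x in Bornology.cobounded ℂ ⊓ 𝓟 {x : ℂ | |x.arg| < Real.pi / 2}, x ≠ 0 := by
    filter_upwards [hlim.eventually_gt_atTop 0] with x hx
    exact norm_pos_iff.mp hx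
  have ht : Tendsto Complex.log (Bornology.cobounded ℂ ⊓ 𝓟 {x : ℂ | |x.arg| < Real.pi / 2})
      (comap (fun ζ : ℂ => ‖XLog p ζ‖) atTop ⊓ 𝓟 {ζ : ℂ | |argX p ζ| ≤ Real.pi / 2 - δ}) := by
    refine tendsto_inf.mpr ⟨tendsto_comap_iff.mpr ?_, tendsto_principal.mpr ?_⟩
    · have h1 : Tendsto (fun x : ℂ => p ^ (1 / (p + 1)) * ‖x‖ ^ (p / (p + 1)))
          (Bornology.cobounded ℂ ⊓ 𝓟 {x : ℂ | |x.arg| < Real.pi / 2}) atTop :=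
        ((tendsto_rpow_atTop (by positivity)).comp hlim).const_mul_atTop (by positivity)
      refine h1.congr' ?_
      filter_upwards [hne] with x hx
      rw [Function.comp_apply, ← X_eq_XLog hx, X, norm_mul, Complex.norm_cpow_real,
        Complex.norm_real, Real.norm_of_nonneg (by positivity)]
    · filter_upwards [hmem] with x hx
      have := abs_argX_lt hp (ζ := Complex.log x) (by rwa [Complex.log_im])
      change _ ≤ _
      rw [hδ]; linarith
  have h := (FLog_div_prefactorLog_isBigO hp ν hτ M hδ0).comp_tendsto ht
  refine h.congr' ?_ ?_
  · filter_upwards [hne, hmem] with x hx hx2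
    simp only [Function.comp_apply]
    rw [FLog_eq_F hp ν (by rwa [Complex.log_im]), Complex.exp_log hx,
      prefactor_eq_prefactorLog hp ν hx, X_eq_XLog hx]
  · filter_upwards [hne] with x hx
    simp only [Function.comp_apply]
    rw [X_eq_XLog hx]

/-! ### The Mellin transform -/

theorem ofReal_rpow_eq_exp {a : ℝ} (ha : 0 < a) (r : ℝ) :
    ((a ^ r : ℝ) : ℂ) = Complex.exp (Real.log a * r) := by
  rw [Real.rpow_def_of_pos ha]; push_cast; rfl

theorem integral_cpow_mul_exp_neg_mul_rpow {q b : ℝ} (hq : 0 < q) (hb : 0 < b) {z : ℂ}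
    (hz : 0 < z.re) :
    ∫ t in Set.Ioi (0 : ℝ), (t : ℂ) ^ (z - 1) * Complex.exp (-((b * t ^ q : ℝ) : ℂ))
      = (1 / q) * ((1 / b) ^ (z / q) * Complex.Gamma (z / q)) := by
  have hqc : (q : ℂ) ≠ 0 := by exact_mod_cast hq.ne'
  have hzq : 0 < (z / (q : ℂ)).re := by
    rw [Complex.div_ofReal_re]; positivity
  rw [← Complex.integral_cpow_mul_exp_neg_mul_Ioi hzq hb,
    ← integral_const_mul,
    ← integral_comp_rpow_Ioi (fun t : ℝ => (1 / (q : ℂ))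
      * ((t : ℂ) ^ (z / q - 1) * Complex.exp (-(b * (t : ℂ))))) hq.ne']
  refine setIntegral_congr_fun measurableSet_Ioi fun t ht => ?_
  have ht : 0 < t := ht
  have e : (t : ℂ) ^ (z - 1) = ((t ^ (q - 1) : ℝ) : ℂ) * ((t ^ q : ℝ) : ℂ) ^ (z / q - 1) := by
    rw [ofReal_cpow_eq_exp (Real.rpow_pos_of_pos ht q), Real.log_rpow ht, ofReal_rpow_eq_exp ht,
      ofReal_cpow_eq_exp ht, ← Complex.exp_add]
    congr 1
    push_cast
    field_simp
    ring
  rw [Complex.real_smul, abs_of_pos hq, e]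
  push_cast
  field_simp

theorem rpow_mul_affine_exp {q b : ℝ} (hb : 0 < b) (s : ℝ) (z : ℂ) {x : ℝ} (hx : 0 < x) :
    ((x ^ (s - 1) : ℝ) : ℂ) * (((b * x ^ q : ℝ) : ℂ) ^ z * Complex.exp (-((b * x ^ q : ℝ) : ℂ)))
      = (b : ℂ) ^ z * ((x : ℂ) ^ (s + q * z - 1) * Complex.exp (-((b * x ^ q : ℝ) : ℂ))) := by
  have e : ((x ^ (s - 1) : ℝ) : ℂ) * ((b * x ^ q : ℝ) : ℂ) ^ z
      = (b : ℂ) ^ z * (x : ℂ) ^ (s + q * z - 1) := by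
    rw [ofReal_cpow_eq_exp (by positivity), ofReal_cpow_eq_exp hb, ofReal_cpow_eq_exp hx,
      ofReal_rpow_eq_exp hx, Real.log_mul hb.ne' (Real.rpow_pos_of_pos hx q).ne', Real.log_rpow hx,
      ← Complex.exp_add, ← Complex.exp_add]
    congr 1
    push_cast
    ring
  rw [← mul_assoc, e, mul_assoc]

theorem re_ofReal_add_mul (s q : ℝ) (z : ℂ) : ((s : ℂ) + q * z).re = s + q * z.re := by simp

theorem integral_mellin_cpow_mul_exp {q b : ℝ} (hq : 0 < q) (hb : 0 < b) {s : ℝ} {z : ℂ}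
    (hs : 0 < s + q * z.re) :
    ∫ x in Set.Ioi (0 : ℝ), ((x ^ (s - 1) : ℝ) : ℂ)
        * (((b * x ^ q : ℝ) : ℂ) ^ z * Complex.exp (-((b * x ^ q : ℝ) : ℂ)))
      = (1 / q) * (b : ℂ) ^ (-(s / q : ℂ)) * Complex.Gamma (s / q + z) := by
  have hqc : (q : ℂ) ≠ 0 := by exact_mod_cast hq.ne'
  have hbc : (b : ℂ) ≠ 0 := by exact_mod_cast hb.ne'
  rw [setIntegral_congr_fun measurableSet_Ioi fun x hx => rpow_mul_affine_exp hb s z hx,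
    integral_const_mul, integral_cpow_mul_exp_neg_mul_rpow hq hb (by rwa [re_ofReal_add_mul])]
  have e1 : ((s : ℂ) + q * z) / q = s / q + z := by field_simp
  have e2 : (1 / (b : ℂ)) ^ ((s : ℂ) / q + z) = (b : ℂ) ^ (-((s : ℂ) / q + z)) := by
    have : (1 / (b : ℂ)) = ((b⁻¹ : ℝ) : ℂ) := by push_cast; rw [one_div]
    rw [this, ofReal_cpow_eq_exp (by positivity), ofReal_cpow_eq_exp hb, Real.log_inv]
    congr 1
    push_cast; ring
  have e3 : (b : ℂ) ^ (-(s / q : ℂ)) = (b : ℂ) ^ z * (b : ℂ) ^ (-((s : ℂ) / q + z)) := by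
    rw [← Complex.cpow_add _ _ hbc]; congr 1; ring
  rw [e1, e2, e3]
  ring

theorem integrableOn_mellin_cpow_mul_exp {q b : ℝ} (hq : 0 < q) (hb : 0 < b) {s : ℝ} {z : ℂ}
    (hs : 0 < s + q * z.re) :
    IntegrableOn (fun x : ℝ => ((x ^ (s - 1) : ℝ) : ℂ)
        * (((b * x ^ q : ℝ) : ℂ) ^ z * Complex.exp (-((b * x ^ q : ℝ) : ℂ)))) (Set.Ioi 0) := by
  have h1 := (integrableOn_rpow_mul_exp_neg_mul_rpow (p := q) (s := s + q * z.re - 1) (b := b)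
    (by linarith) hq hb).const_mul (b ^ z.re)
  refine h1.mono' (Measurable.aestronglyMeasurable (by fun_prop)) ?_
  filter_upwards [ae_restrict_mem measurableSet_Ioi] with x hx
  have hx : 0 < x := hx
  rw [rpow_mul_affine_exp hb s z hx, norm_mul, norm_mul, Complex.norm_cpow_eq_rpow_re_of_pos hb,
    Complex.norm_cpow_eq_rpow_re_of_pos hx, ← Complex.ofReal_neg, Complex.norm_exp_ofReal]
  refine le_of_eq ?_
  have : ((s : ℂ) + q * z - 1).re = s + q * z.re - 1 := by simp
  rw [this, neg_mul]

theorem integral_rpow_mul_exp_neg_div {s t : ℝ} (hs : 0 < s) (ht : 0 < t) :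
    ∫ x in Set.Ioi (0 : ℝ), x ^ (s - 1) * Real.exp (-x / t) = t ^ s * Real.Gamma s := by
  have h := Real.integral_rpow_mul_exp_neg_mul_Ioi hs (inv_pos.mpr ht)
  rw [one_div, inv_inv] at h
  rw [← h]
  refine setIntegral_congr_fun measurableSet_Ioi fun x _ => ?_
  congr 2
  ring

theorem integrableOn_rpow_mul_exp_neg_div {s t : ℝ} (hs : 0 < s) (ht : 0 < t) :
    IntegrableOn (fun x : ℝ => x ^ (s - 1) * Real.exp (-x / t)) (Set.Ioi 0) := by
  refine (integrableOn_rpow_mul_exp_neg_mul_rpow (p := 1) (s := s - 1) (b := t⁻¹)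
    (by linarith) one_pos (inv_pos.mpr ht)).congr_fun (fun x _ => ?_) measurableSet_Ioi
  simp only
  rw [Real.rpow_one]
  congr 2
  ring

/-- The integrand of the double integral for the Mellin transform. -/
def mellinIntegrand (p : ℝ) (ν : ℂ) (s : ℝ) (z : ℝ × ℝ) : ℂ :=
  ((z.1 ^ (s - 1) : ℝ) : ℂ) * integrand p ν z.1 z.2

theorem mellinIntegrand_eq (ν : ℂ) (s x t : ℝ) :
    mellinIntegrand p ν s (x, t) = ((t : ℂ) ^ (ν - 1) * Complex.exp (-((t ^ p : ℝ) : ℂ)))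
      * ((x ^ (s - 1) * Real.exp (-x / t) : ℝ) : ℂ) := by
  simp only [mellinIntegrand]
  rw [integrand_eq]
  push_cast
  have : -(x : ℂ) * (1 / t) = -x / t := by ring
  rw [this]
  ring

theorem norm_mellinIntegrand (ν : ℂ) (s : ℝ) {x t : ℝ} (hx : 0 < x) (ht : 0 < t) :
    ‖mellinIntegrand p ν s (x, t)‖
      = t ^ (ν.re - 1) * Real.exp (-t ^ p) * (x ^ (s - 1) * Real.exp (-x / t)) := by
  rw [mellinIntegrand_eq, norm_mul, norm_integrand_factor ν ht, Complex.norm_real,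
    Real.norm_of_nonneg (by positivity)]

/-- The inner integral over `x` of the absolute value is `t^s Γ(s)` times the factor in `t`, which
leaves a Gamma-type integral with exponent `s + Re ν - 1 > -1`. -/
theorem integrable_mellinIntegrand (hp : 0 < p) {ν : ℂ} {s : ℝ} (hs : 0 < s)
    (hsν : 0 < s + ν.re) :
    Integrable (mellinIntegrand p ν s)
      ((volume.restrict (Set.Ioi 0)).prod (volume.restrict (Set.Ioi 0))) := by
  have hm : Measurable (mellinIntegrand p ν s) := by
    unfold mellinIntegrand integrand
    fun_prop
  rw [integrable_prod_iff' hm.aestronglyMeasurable]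
  constructor
  · filter_upwards [ae_restrict_mem measurableSet_Ioi] with t ht
    simp only [mellinIntegrand_eq]
    exact ((integrableOn_rpow_mul_exp_neg_div hs ht).ofReal).const_mul _
  · have h1 := (integrableOn_rpow_mul_exp_neg_mul_rpow (p := p) (s := s + ν.re - 1) (b := 1)
      (by linarith) hp one_pos).mul_const (Real.Gamma s)
    refine h1.congr ?_
    filter_upwards [ae_restrict_mem measurableSet_Ioi] with t ht
    have ht : 0 < t := ht
    rw [setIntegral_congr_fun measurableSet_Ioi fun x hx => norm_mellinIntegrand ν s hx ht,
      integral_const_mul, integral_rpow_mul_exp_neg_div hs ht]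
    have : t ^ (s + ν.re - 1) = t ^ (ν.re - 1) * t ^ s := by
      rw [← Real.rpow_add ht]; congr 1; ring
    rw [this]
    simp only [neg_mul, one_mul]
    ring

theorem integrableOn_mellin_F (hp : 0 < p) {ν : ℂ} {s : ℝ} (hs : 0 < s) (hsν : 0 < s + ν.re) :
    IntegrableOn (fun x : ℝ => ((x ^ (s - 1) : ℝ) : ℂ) * F p ν x) (Set.Ioi 0) := by
  have h := (integrable_mellinIntegrand hp hs hsν).integral_prod_left
  refine h.congr (Eventually.of_forall fun x => ?_)
  simp only [mellinIntegrand, F]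
  rw [integral_const_mul]

theorem integral_mellin_F (hp : 0 < p) {ν : ℂ} {s : ℝ} (hs : 0 < s) (hsν : 0 < s + ν.re) :
    ∫ x in Set.Ioi (0 : ℝ), ((x ^ (s - 1) : ℝ) : ℂ) * F p ν x
      = Complex.Gamma s * Complex.Gamma ((s + ν) / p) / p := by
  have h := integral_integral_swap (f := fun x t => mellinIntegrand p ν s (x, t))
    (integrable_mellinIntegrand hp hs hsν)
  have e1 : ∀ x : ℝ, ((x ^ (s - 1) : ℝ) : ℂ) * F p ν x
      = ∫ t in Set.Ioi (0 : ℝ), mellinIntegrand p ν s (x, t) := fun x => by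
    simp only [mellinIntegrand, F]
    rw [integral_const_mul]
  have e2 : ∀ t ∈ Set.Ioi (0 : ℝ), ∫ x in Set.Ioi (0 : ℝ), mellinIntegrand p ν s (x, t)
      = Complex.Gamma s
        * ((t : ℂ) ^ ((s + ν) - 1) * Complex.exp (-((1 * t ^ p : ℝ) : ℂ))) := fun t ht => by
    have ht : 0 < t := ht
    simp only [mellinIntegrand_eq]
    rw [integral_const_mul, integral_complex_ofReal, integral_rpow_mul_exp_neg_div hs ht, one_mul]
    have htc : (t : ℂ) ≠ 0 := by exact_mod_cast ht.ne'
    have : (t : ℂ) ^ ((s + ν) - 1) = ((t ^ s : ℝ) : ℂ) * (t : ℂ) ^ (ν - 1) := by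
      rw [Complex.ofReal_cpow ht.le, ← Complex.cpow_add _ _ htc]; congr 1; ring
    rw [this, Complex.Gamma_ofReal]
    push_cast
    ring
  simp only [e1]
  rw [h, setIntegral_congr_fun measurableSet_Ioi e2, integral_const_mul,
    integral_cpow_mul_exp_neg_mul_rpow hp one_pos (by simpa using hsν)]
  simp
  ring

/-- If `E = O(w)` at infinity, then the Mellin transform of `E` at real `s → ∞` is bounded by that
of `w`. -/
theorem exists_norm_mellin_le {E : ℝ → ℂ} {w : ℝ → ℝ} {x₀ s₀ C : ℝ} (hx₀ : 0 < x₀)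
    (hw : ∀ x, 0 < x → 0 < w x) (hE : ∀ x, x₀ < x → ‖E x‖ ≤ C * w x)
    (hEi : ∀ s, s₀ ≤ s → IntegrableOn (fun x : ℝ => ((x ^ (s - 1) : ℝ) : ℂ) * E x) (Set.Ioi 0))
    (hwi : ∀ s, s₀ ≤ s → IntegrableOn (fun x : ℝ => x ^ (s - 1) * w x) (Set.Ioi 0)) :
    ∃ C' : ℝ, ∀ s, s₀ ≤ s → ‖∫ x in Set.Ioi (0 : ℝ), ((x ^ (s - 1) : ℝ) : ℂ) * E x‖
      ≤ C' * ∫ x in Set.Ioi (0 : ℝ), x ^ (s - 1) * w x := by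
  have hC : 0 ≤ C := by
    have h1 := (norm_nonneg _).trans (hE (x₀ + 1) (by linarith))
    exact nonneg_of_mul_nonneg_left h1 (hw _ (by linarith))
  have hsub1 : Set.Ioc 0 x₀ ⊆ Set.Ioi (0 : ℝ) := fun x hx => hx.1
  have hsub2 : Set.Ioi x₀ ⊆ Set.Ioi (0 : ℝ) := fun x hx => lt_trans hx₀ hx
  set A : ℝ := ∫ x in Set.Ioc 0 x₀, ‖((x ^ (s₀ - 1) : ℝ) : ℂ) * E x‖ with hA
  set A' : ℝ := ∫ x in Set.Ioi x₀, x ^ (s₀ - 1) * w x with hA'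
  have hA0 : 0 ≤ A := integral_nonneg fun x => norm_nonneg _
  have hA'0 : 0 < A' := by
    rw [hA', setIntegral_pos_iff_support_of_nonneg_ae]
    · have : Set.Ioi x₀ ⊆ Function.support (fun x : ℝ => x ^ (s₀ - 1) * w x) ∩ Set.Ioi x₀ :=
        fun x hx => ⟨(mul_pos (Real.rpow_pos_of_pos (hsub2 hx) _) (hw x (hsub2 hx))).ne', hx⟩
      refine lt_of_lt_of_le ?_ (measure_mono this)
      simp
    · filter_upwards [ae_restrict_mem measurableSet_Ioi] with x hx
      exact (mul_pos (Real.rpow_pos_of_pos (hsub2 hx) _) (hw x (hsub2 hx))).le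
    · exact (hwi s₀ le_rfl).mono_set hsub2
  -- The hypothesis on `E` says nothing on `(0, x₀]`. There `x^(s-s₀) ≤ x₀^(s-s₀)`, while on the
  -- tail the reverse holds, so the head is at most `A/A'` times the tail of the transform of `w`.
  refine ⟨A / A' + C, fun s hs => ?_⟩
  set I : ℝ := ∫ x in Set.Ioi x₀, x ^ (s - 1) * w x with hI
  have hpow : ∀ x : ℝ, 0 < x → x ^ (s - 1) = x ^ (s - s₀) * x ^ (s₀ - 1) := fun x hx => by
    rw [← Real.rpow_add hx]; congr 1; ring
  have h1 : ‖∫ x in Set.Ioc 0 x₀, ((x ^ (s - 1) : ℝ) : ℂ) * E x‖ ≤ x₀ ^ (s - s₀) * A := by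
    rw [hA, ← integral_const_mul]
    refine norm_integral_le_of_norm_le
      (((hEi s₀ le_rfl).mono_set hsub1).norm.const_mul _) ?_
    filter_upwards [ae_restrict_mem measurableSet_Ioc] with x hx
    have hx0 : 0 < x := hx.1
    rw [norm_mul, norm_mul, Complex.norm_real, Complex.norm_real,
      Real.norm_of_nonneg (by positivity), Real.norm_of_nonneg (by positivity), hpow x hx0,
      mul_assoc]
    gcongr
    exact hx.2
  have h2 : x₀ ^ (s - s₀) * A' ≤ I := by
    rw [hA', hI, ← integral_const_mul]
    refine setIntegral_mono_on (((hwi s₀ le_rfl).mono_set hsub2).const_mul _)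
      ((hwi s hs).mono_set hsub2) measurableSet_Ioi fun x hx => ?_
    have hx0 : 0 < x := hsub2 hx
    rw [hpow x hx0, mul_assoc]
    have := (hw x hx0).le
    gcongr
    exact le_of_lt hx
  have h3 : ‖∫ x in Set.Ioi x₀, ((x ^ (s - 1) : ℝ) : ℂ) * E x‖ ≤ C * I := by
    rw [hI, ← integral_const_mul]
    refine norm_integral_le_of_norm_le (((hwi s hs).mono_set hsub2).const_mul _) ?_
    filter_upwards [ae_restrict_mem measurableSet_Ioi] with x hx
    have hx0 : 0 < x := hsub2 hx
    rw [norm_mul, Complex.norm_real, Real.norm_of_nonneg (by positivity), mul_left_comm]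
    gcongr
    exact hE x hx
  have h4 : I ≤ ∫ x in Set.Ioi (0 : ℝ), x ^ (s - 1) * w x := by
    refine setIntegral_mono_set (hwi s hs) ?_ hsub2.eventuallyLE
    filter_upwards [ae_restrict_mem measurableSet_Ioi] with x hx
    exact (mul_pos (Real.rpow_pos_of_pos hx _) (hw x hx)).le
  have h5 : ∫ x in Set.Ioi (0 : ℝ), ((x ^ (s - 1) : ℝ) : ℂ) * E x
      = (∫ x in Set.Ioc 0 x₀, ((x ^ (s - 1) : ℝ) : ℂ) * E x)
        + ∫ x in Set.Ioi x₀, ((x ^ (s - 1) : ℝ) : ℂ) * E x := by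
    rw [← setIntegral_union (Set.Ioc_disjoint_Ioi le_rfl) measurableSet_Ioi
      ((hEi s hs).mono_set hsub1) ((hEi s hs).mono_set hsub2), Set.Ioc_union_Ioi_eq_Ioi hx₀.le]
  calc _ ≤ x₀ ^ (s - s₀) * A + C * I := by
        rw [h5]; exact (norm_add_le _ _).trans (add_le_add h1 h3)
    _ = A / A' * (x₀ ^ (s - s₀) * A') + C * I := by field_simp
    _ ≤ A / A' * I + C * I := by gcongr
    _ = (A / A' + C) * I := by ring
    _ ≤ _ := by gcongr

/-! ### Comparison of Gamma functions along the real axis -/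

/-- Since `log y` is real, the real part of the Stirling exponent depends on `β` only through `Re
β`, up to a bounded remainder. This is needed because absolute values in the remainder estimate
replace `ϑ` by `Re ϑ`. -/
theorem Gamma_isBigO_Gamma_of_re_eq {β β' : ℂ} (h : β.re = β'.re) :
    (fun y : ℝ => Complex.Gamma (y + β)) =O[atTop] fun y : ℝ => Complex.Gamma (y + β') := by
  obtain ⟨m, hm, hg⟩ := exists_Gamma_affine_eq one_pos β
  obtain ⟨m', hm', hg'⟩ := exists_Gamma_affine_eq one_pos β'
  have ht := tendsto_ofReal_sectorAtTop (η := 1) (by norm_num)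
  obtain ⟨C, hC⟩ := ((hm.isBigO_one one_pos).comp_tendsto ht).bound
  obtain ⟨C', hC'⟩ := ((hm'.isBigO_one one_pos).comp_tendsto ht).bound
  refine IsBigO.of_bound (Real.exp (C + C')) ?_
  filter_upwards [ht.eventually (hg 1 one_pos), ht.eventually (hg' 1 one_pos), hC, hC',
    eventually_gt_atTop 0] with y e e' b b' hy
  simp only [Complex.ofReal_one, one_mul, Real.log_one, Complex.ofReal_zero, add_zero] at e e'
  simp only [Function.comp_apply, norm_one, mul_one] at b b'
  rw [e, e', norm_mul, norm_mul, Complex.norm_exp, Complex.norm_exp, mul_left_comm, ← Real.exp_add]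
  gcongr
  have hre : ∀ γ w : ℂ, ((y + γ - 1 / 2) * Complex.log y - y + w).re
      = (y + γ.re - 1 / 2) * Real.log y - y + w.re := fun γ w => by
    rw [← Complex.ofReal_log hy.le]
    simp
  rw [hre, hre, h]
  have h1 := (abs_le.mp ((Complex.abs_re_le_norm (m y)).trans b)).2
  have h2 := (abs_le.mp ((Complex.abs_re_le_norm (m' y)).trans b')).1
  linarith

/-- If `e_j` were the first nonzero coefficient, the case `M = j + 1` would give `Γ(z+1) = O(Γ(z))`,
that is, `z = O(1)` as `Re z → ∞`. -/
theorem Gamma_shift_coeff_eq_zero {β : ℂ} {e : ℕ → ℂ}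
    (h : ∀ M : ℕ, (fun y : ℝ => ∑ j ∈ Finset.range M, e j * Complex.Gamma (y + (β - j)))
      =O[atTop] fun y : ℝ => Complex.Gamma (y + (β - M))) (j : ℕ) : e j = 0 := by
  induction j using Nat.strong_induction_on with
  | _ j ih =>
    by_contra hj
    have h1 := h (j + 1)
    have h2 : (fun y : ℝ => Complex.Gamma (y + (β - j)))
        =O[atTop] fun y : ℝ => Complex.Gamma (y + (β - (j + 1 : ℕ))) := by
      have : ∀ y : ℝ, ∑ i ∈ Finset.range (j + 1), e i * Complex.Gamma (y + (β - i))
          = e j * Complex.Gamma (y + (β - j)) := fun y => by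
        rw [Finset.sum_range_succ, Finset.sum_eq_zero, zero_add]
        intro i hi
        rw [ih i (Finset.mem_range.mp hi), zero_mul]
      simp only [this] at h1
      exact (isBigO_const_mul_left_iff hj).mp h1
    obtain ⟨C, hC⟩ := h2.bound
    have hlim : Tendsto (fun y : ℝ => y + (β.re - j - 1)) atTop atTop :=
      tendsto_atTop_add_const_right _ _ tendsto_id
    obtain ⟨y, hy1, hy2, hy3⟩ := (hC.and ((hlim.eventually_gt_atTop C).and
      (hlim.eventually_gt_atTop 0))).exists
    set z : ℂ := y + (β - (j + 1 : ℕ)) with hz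
    have hzre : z.re = y + (β.re - j - 1) := by
      simp [hz]; ring
    have hz0 : z ≠ 0 := by
      intro h0; rw [h0, Complex.zero_re] at hzre; linarith
    have e1 : (y : ℂ) + (β - j) = z + 1 := by rw [hz]; push_cast; ring
    rw [e1, Complex.Gamma_add_one z hz0, norm_mul] at hy1
    have hG : 0 < ‖Complex.Gamma z‖ :=
      norm_pos_iff.mpr (Complex.Gamma_ne_zero_of_re_pos (by rw [hzre]; exact hy3))
    have h3 : ‖z‖ ≤ C := le_of_mul_le_mul_right hy1 hG
    have h4 := Complex.re_le_norm z
    linarith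

/-! ### The two expansions agree -/

/-- `κ X` at a positive real `x`. -/
def realPhase (p x : ℝ) : ℝ := kappa p * p ^ (1 / (p + 1)) * x ^ (p / (p + 1))

theorem realPhase_pos (hp : 0 < p) {x : ℝ} (hx : 0 < x) : 0 < realPhase p x := by
  have := kappa_pos hp
  unfold realPhase; positivity

theorem kappa_mul_X_ofReal {x : ℝ} (hx : 0 < x) :
    (kappa p : ℂ) * X p (x : ℂ) = (realPhase p x : ℂ) := by
  rw [X, ← Complex.ofReal_cpow hx.le, realPhase]
  push_cast
  ring

/-- The constant `2π A₀ / (κ p)` of the prefactor. -/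
def prefactorConst (p : ℝ) (ν : ℂ) : ℂ := 2 * (Real.pi : ℂ) * A0 p ν / ((kappa p : ℂ) * (p : ℂ))

theorem mellinPrefactor_eq (ν Y : ℂ) :
    mellinPrefactor p ν Y = prefactorConst p ν
      * (((kappa p : ℂ) * Y) ^ theta p ν * Complex.exp (-((kappa p : ℂ) * Y))) := by
  rw [mellinPrefactor, prefactorConst, neg_mul, mul_assoc]

/-- The terms of the saddle point expansion on the real axis. -/
def realTerm (p : ℝ) (z : ℂ) (x : ℝ) : ℂ :=
  (realPhase p x : ℂ) ^ z * Complex.exp (-(realPhase p x : ℂ))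

theorem norm_realTerm (hp : 0 < p) (z : ℂ) {x : ℝ} (hx : 0 < x) :
    ‖realTerm p z x‖ = realPhase p x ^ z.re * Real.exp (-realPhase p x) := by
  rw [realTerm, norm_mul, Complex.norm_cpow_eq_rpow_re_of_pos (realPhase_pos hp hx),
    ← Complex.ofReal_neg, Complex.norm_exp_ofReal]

/-- The scale of `κX = b x^(p/(p+1))` enters the Mellin transform as `b^(-κs)`; this identifies it
with the base `(h κ^κ)^(-s)`. -/
theorem log_realPhase_base (hp : 0 < p) :
    kappa p * Real.log (kappa p * p ^ (1 / (p + 1))) = Real.log (expBase p) := by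
  have := kappa_pos hp
  rw [log_expBase hp, Real.log_mul this.ne' (by positivity), Real.log_rpow hp, mul_add,
    add_comm]
  congr 1
  rw [kappa]
  field_simp

theorem integral_mellin_realTerm (hp : 0 < p) {s : ℝ} {z : ℂ}
    (hs : 0 < s + p / (p + 1) * z.re) :
    ∫ x in Set.Ioi (0 : ℝ), ((x ^ (s - 1) : ℝ) : ℂ) * realTerm p z x
      = kappa p * (expBase p : ℂ) ^ (-(s : ℂ)) * Complex.Gamma (kappa p * s + z) := by
  have hκ := kappa_pos hp
  have hb : 0 < kappa p * p ^ (1 / (p + 1)) := by positivity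
  have h := integral_mellin_cpow_mul_exp (by positivity : 0 < p / (p + 1)) hb hs
  have hpc : (p : ℂ) ≠ 0 := by exact_mod_cast hp.ne'
  have hp1 := ofReal_add_one_ne_zero hp
  have e1 : (s : ℂ) / ((p / (p + 1) : ℝ) : ℂ) = kappa p * s := by
    rw [kappa]; push_cast; field_simp
  have e2 : (1 : ℂ) / ((p / (p + 1) : ℝ) : ℂ) = kappa p := by
    rw [kappa]; push_cast; field_simp
  have e3 : ((kappa p * p ^ (1 / (p + 1)) : ℝ) : ℂ) ^ (-(kappa p * s : ℂ))
      = (expBase p : ℂ) ^ (-(s : ℂ)) := by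
    rw [ofReal_cpow_eq_exp hb, ofReal_cpow_eq_exp (expBase_pos hp), ← log_realPhase_base hp]
    congr 1
    push_cast
    ring
  rw [e1, e2, e3] at h
  exact h

theorem integrableOn_mellin_realTerm (hp : 0 < p) {s : ℝ} {z : ℂ}
    (hs : 0 < s + p / (p + 1) * z.re) :
    IntegrableOn (fun x : ℝ => ((x ^ (s - 1) : ℝ) : ℂ) * realTerm p z x) (Set.Ioi 0) := by
  have hκ := kappa_pos hp
  exact integrableOn_mellin_cpow_mul_exp (by positivity : 0 < p / (p + 1))
    (by positivity : 0 < kappa p * p ^ (1 / (p + 1))) hs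

/-- The inverse factorial coefficients `(-1)^j c_j` predicted by the saddle point expansion. -/
def saddleFactorial (p : ℝ) (ν : ℂ) (τ : ℂ → ℂ) (j : ℕ) : ℂ :=
  (2 * (kappa p : ℂ)) ^ j * halfPoch j * B p ν τ j

theorem exists_norm_F_sub_le (hp : 0 < p) (ν : ℂ) {τ : ℂ → ℂ} (hτ : IsSaddleInverse p τ) (M : ℕ) :
    ∃ x₀ > 0, ∃ C : ℝ, ∀ x : ℝ, x₀ < x →
      ‖F p ν x - ∑ j ∈ Finset.range M,
          saddleFactorial p ν τ j * (prefactorConst p ν * realTerm p (theta p ν - j) x)‖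
        ≤ C * (realPhase p x ^ ((theta p ν).re - M) * Real.exp (-realPhase p x)) := by
  have ht : Tendsto (fun x : ℝ => (x : ℂ)) atTop
      (Bornology.cobounded ℂ ⊓ 𝓟 {x : ℂ | |x.arg| < Real.pi / 2}) := by
    refine tendsto_inf.mpr ⟨?_, tendsto_principal.mpr ?_⟩
    · rw [← tendsto_norm_atTop_iff_cobounded]
      simpa using tendsto_abs_atTop_atTop
    · filter_upwards [eventually_gt_atTop 0] with x hx
      rw [Complex.arg_ofReal_of_nonneg hx.le, abs_zero]
      positivity
  obtain ⟨C, hC⟩ := ((F_div_prefactor_isBigO hp ν hτ M).comp_tendsto ht).bound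
  obtain ⟨x₁, hx₁⟩ := eventually_atTop.mp hC
  -- The factor `κ^M` arises on rewriting `X^(-M)` in terms of `κX`.
  refine ⟨max x₁ 1, by positivity, ‖prefactorConst p ν‖ * C * kappa p ^ M, fun x hx => ?_⟩
  have hx0 : 0 < x := lt_of_lt_of_le one_pos ((le_max_right _ _).trans hx.le)
  have hb := hx₁ x ((le_max_left _ _).trans hx.le)
  simp only [Function.comp_apply] at hb
  have hxc : (x : ℂ) ≠ 0 := by exact_mod_cast hx0.ne'
  have hκ := kappa_pos hp
  have hκc : (kappa p : ℂ) ≠ 0 := by exact_mod_cast hκ.ne'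
  have hu := realPhase_pos hp hx0
  have huc : (realPhase p x : ℂ) ≠ 0 := by exact_mod_cast hu.ne'
  have hX : X p (x : ℂ) = (realPhase p x : ℂ) / kappa p := by
    rw [← kappa_mul_X_ofReal hx0]; field_simp
  have hpref : prefactor p ν x = prefactorConst p ν * realTerm p (theta p ν) x := by
    have harg : |Complex.arg (x : ℂ)| < Real.pi / 2 := by
      rw [Complex.arg_ofReal_of_nonneg hx0.le, abs_zero]; positivity
    rw [prefactor_eq_prefactorLog hp ν hxc, ← mellinPrefactor_XLog hp ν (abs_argX_log_lt hp harg),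
      ← X_eq_XLog hxc, mellinPrefactor_eq, kappa_mul_X_ofReal hx0, realTerm]
  have hC0 : prefactorConst p ν ≠ 0 := by
    have h1 : (Real.pi : ℂ) ≠ 0 := by exact_mod_cast Real.pi_ne_zero
    have h2 : (p : ℂ) ≠ 0 := by exact_mod_cast hp.ne'
    exact div_ne_zero (mul_ne_zero (mul_ne_zero two_ne_zero h1) (A0_ne_zero hp ν))
      (mul_ne_zero hκc h2)
  have hR0 : realTerm p (theta p ν) x ≠ 0 :=
    mul_ne_zero (by simp [Complex.cpow_eq_zero_iff, huc]) (Complex.exp_ne_zero _)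
  have hterm : ∀ j : ℕ, saddleFactorial p ν τ j
        * (prefactorConst p ν * realTerm p (theta p ν - j) x)
      = prefactor p ν x * (halfPoch j * B p ν τ j / (X p x / 2) ^ j) := fun j => by
    rw [hpref, hX, saddleFactorial, realTerm, realTerm, Complex.cpow_sub _ _ huc,
      Complex.cpow_natCast, div_pow, div_pow, mul_pow]
    field_simp
  simp only [hterm]
  rw [← Finset.mul_sum]
  have e : F p ν x = prefactor p ν x * (F p ν x / prefactor p ν x) := by
    rw [mul_div_cancel₀]
    rw [hpref]
    exact mul_ne_zero hC0 hR0
  rw [e, ← mul_sub, norm_mul]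
  refine (mul_le_mul_of_nonneg_left hb (norm_nonneg _)).trans (le_of_eq ?_)
  rw [hpref, norm_mul, norm_realTerm hp _ hx0, hX, norm_div, norm_one, norm_pow, norm_div,
    Complex.norm_real, Complex.norm_real, Real.norm_of_nonneg hu.le, Real.norm_of_nonneg hκ.le,
    Real.rpow_sub hu, Real.rpow_natCast, div_pow]
  field_simp

/-- The Mellin transform of the saddle point expansion, term by term. The remainder is compared with
a positive weight of the same family, whose transform is again a Gamma function. -/
theorem Gamma_mul_Gamma_sub_isBigO (hp : 0 < p) (ν : ℂ) {τ : ℂ → ℂ} (hτ : IsSaddleInverse p τ)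
    (M : ℕ) :
    (fun s : ℝ => Complex.Gamma s * Complex.Gamma ((s + ν) / p)
        - 2 * (Real.pi : ℂ) * A0 p ν * (expBase p : ℂ) ^ (-(s : ℂ))
          * ∑ j ∈ Finset.range M,
              saddleFactorial p ν τ j * Complex.Gamma (kappa p * s + (theta p ν - j)))
      =O[atTop] fun s : ℝ => (expBase p : ℂ) ^ (-(s : ℂ))
        * Complex.Gamma (kappa p * s + (((theta p ν).re - M : ℝ) : ℂ)) := by
  obtain ⟨x₀, hx₀, C, hC⟩ := exists_norm_F_sub_le hp ν hτ M
  have hκ := kappa_pos hp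
  have hκc : (kappa p : ℂ) ≠ 0 := by exact_mod_cast hκ.ne'
  have hpc : (p : ℂ) ≠ 0 := by exact_mod_cast hp.ne'
  set q : ℝ := p / (p + 1) with hq
  have hq0 : 0 < q := by positivity
  -- Large enough for the transforms of `F`, of all `M` terms and of the weight to converge when `s
  -- ≥ s₀`.
  set s₀ : ℝ := 1 + |ν.re| + q * (|(theta p ν).re| + M) with hs₀
  have hM : (0 : ℝ) ≤ M := M.cast_nonneg
  have c1 : ∀ s, s₀ ≤ s → 0 < s := fun s hs => lt_of_lt_of_le (by positivity) hs
  have c2 : ∀ s, s₀ ≤ s → 0 < s + ν.re := fun s hs => by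
    have h1 := neg_abs_le ν.re
    have : 0 ≤ q * (|(theta p ν).re| + M) := by positivity
    linarith
  have c3 : ∀ s, s₀ ≤ s → ∀ r : ℝ, (theta p ν).re - M ≤ r → 0 < s + q * r := fun s hs r hr => by
    have h1 := neg_abs_le (theta p ν).re
    have h2 : q * (-(|(theta p ν).re| + M)) ≤ q * r := by
      apply mul_le_mul_of_nonneg_left _ hq0.le
      linarith
    have := abs_nonneg ν.re
    linarith
  have c4 : ∀ j ∈ Finset.range M, (theta p ν).re - M ≤ (theta p ν - j).re := fun j hj => by
    have : (j : ℝ) ≤ M := by exact_mod_cast (Finset.mem_range.mp hj).le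
    simp only [Complex.sub_re, Complex.natCast_re]
    linarith
  set E : ℝ → ℂ := fun x => F p ν x - ∑ j ∈ Finset.range M,
      saddleFactorial p ν τ j * (prefactorConst p ν * realTerm p (theta p ν - j) x) with hE
  set w : ℝ → ℝ := fun x => realPhase p x ^ ((theta p ν).re - M) * Real.exp (-realPhase p x) with hw
  set zM : ℂ := (((theta p ν).re - M : ℝ) : ℂ) with hzM
  have hzMre : zM.re = (theta p ν).re - M := Complex.ofReal_re _
  have hwT : ∀ s : ℝ, ∀ x ∈ Set.Ioi (0 : ℝ),
      ((x ^ (s - 1) * w x : ℝ) : ℂ) = ((x ^ (s - 1) : ℝ) : ℂ) * realTerm p zM x := fun s x hx => by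
    rw [realTerm, hzM, ← Complex.ofReal_cpow (realPhase_pos hp hx).le]
    push_cast [hw]
    rfl
  have hT : ∀ s, s₀ ≤ s → ∀ j ∈ Finset.range M, IntegrableOn (fun x : ℝ =>
      (saddleFactorial p ν τ j * prefactorConst p ν)
        * (((x ^ (s - 1) : ℝ) : ℂ) * realTerm p (theta p ν - j) x)) (Set.Ioi 0) := fun s hs j hj =>
    (integrableOn_mellin_realTerm hp (c3 s hs _ (c4 j hj))).const_mul _
  have hEeq : ∀ s : ℝ, (fun x : ℝ => ((x ^ (s - 1) : ℝ) : ℂ) * E x)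
      = fun x : ℝ => ((x ^ (s - 1) : ℝ) : ℂ) * F p ν x - ∑ j ∈ Finset.range M,
        (saddleFactorial p ν τ j * prefactorConst p ν)
          * (((x ^ (s - 1) : ℝ) : ℂ) * realTerm p (theta p ν - j) x) := fun s => by
    ext x
    simp only [hE]
    rw [mul_sub, Finset.mul_sum]
    congr 1
    exact Finset.sum_congr rfl fun j _ => by ring
  obtain ⟨C', hC'⟩ := exists_norm_mellin_le (E := E) (w := w) (s₀ := s₀) hx₀
    (fun x hx => mul_pos (Real.rpow_pos_of_pos (realPhase_pos hp hx) _) (Real.exp_pos _)) hC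
    (fun s hs => by
      rw [hEeq]
      exact (integrableOn_mellin_F hp (c1 s hs) (c2 s hs)).sub
        (integrable_finsetSum _ (hT s hs)))
    (fun s hs => by
      have h1 : IntegrableOn (fun x : ℝ => ((x ^ (s - 1) : ℝ) : ℂ) * realTerm p zM x)
          (Set.Ioi 0) :=
        integrableOn_mellin_realTerm hp (c3 s hs _ hzMre.ge)
      have h2 : IntegrableOn (fun x : ℝ => (((x ^ (s - 1) : ℝ) : ℂ) * realTerm p zM x).re)
          (Set.Ioi 0) := h1.re
      refine h2.congr_fun (fun x hx => ?_) measurableSet_Ioi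
      simp only
      rw [← hwT s x hx, Complex.ofReal_re])
  refine IsBigO.of_bound (p * |C'| * kappa p) ?_
  filter_upwards [eventually_ge_atTop s₀] with s hs
  have h1 := hC' s hs
  rw [hEeq, integral_sub (integrableOn_mellin_F hp (c1 s hs) (c2 s hs))
    (integrable_finsetSum _ (hT s hs)), integral_finsetSum _ (hT s hs),
    integral_mellin_F hp (c1 s hs) (c2 s hs)] at h1
  have h2 : ∀ j ∈ Finset.range M, ∫ x in Set.Ioi (0 : ℝ),
      (saddleFactorial p ν τ j * prefactorConst p ν)
        * (((x ^ (s - 1) : ℝ) : ℂ) * realTerm p (theta p ν - j) x)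
      = 2 * (Real.pi : ℂ) * A0 p ν / p * (expBase p : ℂ) ^ (-(s : ℂ))
        * (saddleFactorial p ν τ j * Complex.Gamma (kappa p * s + (theta p ν - j))) := fun j hj => by
    rw [integral_const_mul, integral_mellin_realTerm hp (c3 s hs _ (c4 j hj)), prefactorConst]
    field_simp
  rw [Finset.sum_congr rfl h2, ← Finset.mul_sum] at h1
  have h3 : ‖∫ x in Set.Ioi (0 : ℝ), x ^ (s - 1) * w x‖
      = kappa p * ‖(expBase p : ℂ) ^ (-(s : ℂ)) * Complex.Gamma (kappa p * s + zM)‖ := by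
    rw [← Complex.norm_real, ← integral_complex_ofReal,
      setIntegral_congr_fun measurableSet_Ioi (hwT s),
      integral_mellin_realTerm hp (c3 s hs _ hzMre.ge), mul_assoc, norm_mul, Complex.norm_real,
      Real.norm_of_nonneg hκ.le]
  have h4 := h1.trans ((le_abs_self _).trans (le_of_eq (abs_mul _ _)))
  rw [← Real.norm_eq_abs (∫ x in Set.Ioi (0 : ℝ), x ^ (s - 1) * w x), h3] at h4
  have h5 : ∀ a b c d e : ℂ, p * (a * b / p - c / p * d * e) = a * b - c * d * e := by
    intro a b c d e
    field_simp
  rw [← h5, norm_mul, Complex.norm_real, Real.norm_of_nonneg hp.le]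
  calc _ ≤ p * (|C'| * (kappa p * ‖(expBase p : ℂ) ^ (-(s : ℂ))
        * Complex.Gamma (kappa p * s + zM)‖)) := by gcongr
    _ = _ := by ring

/-- On the positive real axis the given expansion is subtracted from the transformed saddle point
expansion. Dividing by `2π A₀ (h κ^κ)^(-s)` and setting `y = κs` leaves a Gamma expansion of zero,
whose coefficients vanish. -/
theorem IsInverseFactorialExpansion.coeff_eq (hp : 0 < p) {ν : ℂ} {τ : ℂ → ℂ}
    (hτ : IsSaddleInverse p τ) {c : ℕ → ℂ} (hc : IsInverseFactorialExpansion p ν c) (j : ℕ) :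
    c j = (-1) ^ j * saddleFactorial p ν τ j := by
  have hκ := kappa_pos hp
  have hκc : (kappa p : ℂ) ≠ 0 := by exact_mod_cast hκ.ne'
  have hA : 2 * (Real.pi : ℂ) * A0 p ν ≠ 0 := by
    have : (Real.pi : ℂ) ≠ 0 := by exact_mod_cast Real.pi_ne_zero
    exact mul_ne_zero (mul_ne_zero two_ne_zero this) (A0_ne_zero hp ν)
  have hK : ∀ s : ℝ, (expBase p : ℂ) ^ (-(s : ℂ)) ≠ 0 := fun s => by
    have : (expBase p : ℂ) ≠ 0 := by exact_mod_cast (expBase_pos hp).ne'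
    simp [Complex.cpow_eq_zero_iff, this]
  have ht : Tendsto (fun x : ℝ => (x : ℂ)) atTop
      -- Any `δ` in `(0, π]` would serve, since only positive real `s` is used.
      (Bornology.cobounded ℂ ⊓ 𝓟 {s : ℂ | |s.arg| ≤ Real.pi - 1}) := by
    refine tendsto_inf.mpr ⟨?_, tendsto_principal.mpr ?_⟩
    · rw [← tendsto_norm_atTop_iff_cobounded]
      simpa using tendsto_abs_atTop_atTop
    · filter_upwards [eventually_gt_atTop 0] with x hx
      rw [Complex.arg_ofReal_of_nonneg hx.le, abs_zero]
      linarith [Real.pi_gt_three]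
  have hdiv : Tendsto (fun y : ℝ => y / kappa p) atTop atTop := tendsto_id.atTop_div_const hκ
  have hmul : Tendsto (fun s : ℝ => kappa p * s) atTop atTop := tendsto_id.const_mul_atTop hκ
  have key : ∀ M : ℕ, (fun y : ℝ => ∑ j ∈ Finset.range M,
      (saddleFactorial p ν τ j - (-1) ^ j * c j) * Complex.Gamma (y + (theta p ν - j)))
      =O[atTop] fun y : ℝ => Complex.Gamma (y + (theta p ν - M)) := fun M => by
    have hG : (fun s : ℝ => Complex.Gamma (kappa p * s + (((theta p ν).re - M : ℝ) : ℂ)))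
        =O[atTop] fun s : ℝ => Complex.Gamma (kappa p * s + (theta p ν - M)) := by
      have := (Gamma_isBigO_Gamma_of_re_eq (β := (((theta p ν).re - M : ℝ) : ℂ))
        (β' := theta p ν - M) (by simp)).comp_tendsto hmul
      simpa [Function.comp_def] using this
    have h1 := (Gamma_mul_Gamma_sub_isBigO hp ν hτ M).trans
      ((isBigO_refl (fun s : ℝ => (expBase p : ℂ) ^ (-(s : ℂ))) atTop).mul hG)
    have h2 := (hc M 1 one_pos).comp_tendsto ht
    have h3 : (fun s : ℝ => 2 * (Real.pi : ℂ) * A0 p ν * (expBase p : ℂ) ^ (-(s : ℂ))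
        * Complex.Gamma (kappa p * s + theta p ν - M))
        =O[atTop] fun s : ℝ => (expBase p : ℂ) ^ (-(s : ℂ))
          * Complex.Gamma (kappa p * s + (theta p ν - M)) := by
      refine IsBigO.congr_left (isBigO_const_mul_self (2 * (Real.pi : ℂ) * A0 p ν) _ _) fun s => ?_
      simp only [add_sub_assoc, mul_assoc]
    have h4 := (h2.trans h3).sub h1
    have h5 := ((isBigO_refl (fun s : ℝ => (2 * (Real.pi : ℂ) * A0 p ν
      * (expBase p : ℂ) ^ (-(s : ℂ)))⁻¹) atTop).mul h4).comp_tendsto hdiv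
    have h6 : (fun y : ℝ => (2 * (Real.pi : ℂ) * A0 p ν
        * (expBase p : ℂ) ^ (-((y / kappa p : ℝ) : ℂ)))⁻¹
        * ((expBase p : ℂ) ^ (-((y / kappa p : ℝ) : ℂ))
          * Complex.Gamma (kappa p * ((y / kappa p : ℝ) : ℂ) + (theta p ν - M))))
        =O[atTop] fun y : ℝ => Complex.Gamma (y + (theta p ν - M)) := by
      refine IsBigO.congr_left
        (isBigO_const_mul_self ((2 * (Real.pi : ℂ) * A0 p ν)⁻¹) _ _) fun y => ?_
      have e : (kappa p : ℂ) * ((y / kappa p : ℝ) : ℂ) = y := by push_cast; field_simp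
      have hKy := hK (y / kappa p)
      rw [e]
      field_simp
    refine (h5.trans h6).congr_left fun y => ?_
    have e : (kappa p : ℂ) * ((y / kappa p : ℝ) : ℂ) = y := by push_cast; field_simp
    have hKy := hK (y / kappa p)
    simp only [Function.comp_apply]
    rw [e]
    change _ * (_ - 2 * (Real.pi : ℂ) * A0 p ν * (expBase p : ℂ) ^ (-((y / kappa p : ℝ) : ℂ)) * _
      - _) = _
    rw [sub_sub_sub_cancel_left, ← mul_sub, inv_mul_cancel_left₀ (mul_ne_zero hA hKy),
      ← Finset.sum_sub_distrib]
    refine Finset.sum_congr rfl fun i _ => ?_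
    rw [add_sub_assoc]
    ring
  have h0 := Gamma_shift_coeff_eq_zero key j
  have h1 : saddleFactorial p ν τ j = (-1) ^ j * c j := sub_eq_zero.mp h0
  rw [h1, ← mul_assoc, ← mul_pow]
  simp

/-- With prefactors and coefficients identified, this is the saddle point expansion in other
notation; any choice of `τ` serves. -/
theorem FLog_div_mellinPrefactor_isBigO (hp : 0 < p) {ν : ℂ} {c : ℕ → ℂ}
    (hc : IsInverseFactorialExpansion p ν c) (M : ℕ) {δ : ℝ} (hδ : 0 < δ) :
    (fun ζ : ℂ => FLog p ν ζ / mellinPrefactor p ν (XLog p ζ)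
        - ∑ j ∈ Finset.range M, (-1) ^ j * c j / ((kappa p : ℂ) * XLog p ζ) ^ j)
      =O[comap (fun ζ : ℂ => ‖XLog p ζ‖) atTop ⊓ 𝓟 {ζ : ℂ | |argX p ζ| ≤ Real.pi / 2 - δ}]
    (fun ζ : ℂ => 1 / XLog p ζ ^ M) := by
  obtain ⟨τ, hτ⟩ := exists_isSaddleInverse hp
  have hκc : (kappa p : ℂ) ≠ 0 := by exact_mod_cast (kappa_pos hp).ne'
  refine (FLog_div_prefactorLog_isBigO hp ν hτ M hδ).congr' ?_ EventuallyEq.rfl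
  filter_upwards [mem_inf_of_right (mem_principal_self _)] with ζ hζ
  have hζ' : |argX p ζ| < Real.pi / 2 := by
    have : |argX p ζ| ≤ Real.pi / 2 - δ := hζ
    linarith
  rw [mellinPrefactor_XLog hp ν hζ']
  congr 1
  refine Finset.sum_congr rfl fun j _ => ?_
  have hX := XLog_ne_zero hp ζ
  rw [hc.coeff_eq hp hτ j, ← mul_assoc, ← mul_pow, neg_one_mul, neg_neg, one_pow, one_mul,
    saddleFactorial, mul_pow, mul_pow, div_pow]
  field_simp

end Kratzel

end

theorem mainTheorem1 (p : ℝ) (hp : 0 < p) (ν : ℂ) :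
    -- the integral converges for `x ≠ 0`, `|arg x| < π/2`
    (∀ x : ℂ, x ≠ 0 → |x.arg| < Real.pi / 2 →
      IntegrableOn (Kratzel.integrand p ν x) (Set.Ioi (0 : ℝ))) ∧
    -- its analytic continuation to `|arg X| < π/2`
    (∀ ζ : ℂ, |Kratzel.argX p ζ| < Real.pi / 2 →
      IntegrableOn (Kratzel.contIntegrand p ν ζ) (Set.Ioi (0 : ℝ))) ∧
    DifferentiableOn ℂ (Kratzel.FLog p ν) {ζ : ℂ | |Kratzel.argX p ζ| < Real.pi / 2} ∧
    (∀ ζ : ℂ, |ζ.im| < Real.pi / 2 →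
      Kratzel.FLog p ν ζ = Kratzel.F p ν (Complex.exp ζ)) ∧
    -- the inversion at the saddle and the inverse factorial expansion exist
    (∃ τ : ℂ → ℂ, Kratzel.IsSaddleInverse p τ) ∧
    (∃ c : ℕ → ℂ, Kratzel.IsInverseFactorialExpansion p ν c) ∧
    -- the expansion with the saddle point coefficients, in `|arg x| < π/2`
    (∀ τ : ℂ → ℂ, Kratzel.IsSaddleInverse p τ → ∀ M : ℕ,
      (fun x : ℂ => Kratzel.F p ν x / Kratzel.prefactor p ν x
          - ∑ k ∈ Finset.range M,
              Kratzel.halfPoch k * Kratzel.B p ν τ k / (Kratzel.X p x / 2) ^ k)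
        =O[Bornology.cobounded ℂ ⊓ 𝓟 {x : ℂ | |x.arg| < Real.pi / 2}]
      (fun x : ℂ => 1 / Kratzel.X p x ^ M)) ∧
    -- the expansion with the inverse factorial coefficients, in `|arg X| < π/2`
    (∀ c : ℕ → ℂ, Kratzel.IsInverseFactorialExpansion p ν c → ∀ M : ℕ, ∀ δ : ℝ, 0 < δ →
      (fun ζ : ℂ =>
          Kratzel.FLog p ν ζ / Kratzel.mellinPrefactor p ν (Kratzel.XLog p ζ)
          - ∑ j ∈ Finset.range M,
              (-1) ^ j * c j / ((Kratzel.kappa p : ℂ) * Kratzel.XLog p ζ) ^ j)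
        =O[comap (fun ζ : ℂ => ‖Kratzel.XLog p ζ‖) atTop
            ⊓ 𝓟 {ζ : ℂ | |Kratzel.argX p ζ| ≤ Real.pi / 2 - δ}]
      (fun ζ : ℂ => 1 / Kratzel.XLog p ζ ^ M)) ∧
    -- the two expansions are the same
    (∀ x : ℂ, x ≠ 0 → |x.arg| < Real.pi / 2 →
      Kratzel.mellinPrefactor p ν (Kratzel.X p x) = Kratzel.prefactor p ν x) ∧
    (∀ ζ : ℂ, |Kratzel.argX p ζ| < Real.pi / 2 →
      Kratzel.mellinPrefactor p ν (Kratzel.XLog p ζ) = Kratzel.prefactorLog p ν ζ) ∧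
    (∀ τ : ℂ → ℂ, Kratzel.IsSaddleInverse p τ →
      ∀ c : ℕ → ℂ, Kratzel.IsInverseFactorialExpansion p ν c → ∀ j : ℕ,
        c j = (-1) ^ j * (2 * (Kratzel.kappa p : ℂ)) ^ j * Kratzel.halfPoch j
          * Kratzel.B p ν τ j) := by
  refine ⟨fun x hx harg => ?_, fun ζ hζ => Kratzel.integrableOn_contIntegrand hp ν hζ,
    fun ζ hζ => (Kratzel.differentiableAt_FLog hp ν hζ).differentiableWithinAt,
    fun ζ hζ => Kratzel.FLog_eq_F hp ν hζ, Kratzel.exists_isSaddleInverse hp,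
    Kratzel.exists_isInverseFactorialExpansion hp ν,
    fun τ hτ M => Kratzel.F_div_prefactor_isBigO hp ν hτ M,
    fun c hc M δ hδ => Kratzel.FLog_div_mellinPrefactor_isBigO hp hc M hδ, fun x hx harg => ?_,
    fun ζ hζ => Kratzel.mellinPrefactor_XLog hp ν hζ, fun τ hτ c hc j => ?_⟩
  · refine Kratzel.integrableOn_integrand hp ν ?_
    exact (Complex.abs_arg_lt_pi_div_two_iff.mp harg).resolve_right hx
  · rw [Kratzel.X_eq_XLog hx, Kratzel.prefactor_eq_prefactorLog hp ν hx,
      Kratzel.mellinPrefactor_XLog hp ν (Kratzel.abs_argX_log_lt hp harg)]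
  · rw [hc.coeff_eq hp hτ j, Kratzel.saddleFactorial]
    ring
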